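/- **Theorem 2.1.** Let $d\in\{1,2,3\}$, let $\lambda\in\mathbb R\setminus\{0\}$, and let $\Omega$ be either $\mathbb R^d$, or a bounded domain in $\mathbb R^d$ with the homogeneous Dirichlet boundary condition, or a box $\prod_{i=1}^d(a_i,b_i)$ with the periodic boundary condition. For $\varepsilon>0$ consider the regularized logarithmic Schrödinger equation $$i\partial_t u^\varepsilon+\Delta u^\varepsilon=\lambda\,u^\varepsilon\ln\big((\varepsilon+|u^\varepsilon|)^2\big),\qquad u^\varepsilon(0)=u_0,$$ on $\Omega$ with the given boundary condition. For a time step $\tau>0$, let $t_n=n\tau$, and let the Lie–Trotter splitting be defined by $$u^{\varepsilon,0}=u_0,\qquad u^{\varepsilon,n+1}=e^{i\tau\Delta}\,\Phi_B^\tau(u^{\varepsilon,n}),\qquad \Phi_B^\tau(\omega)=\omega\, e^{-i\tau\lambda\ln((\varepsilon+|\omega|)^2)},$$ where $e^{it\Delta}v_0$ is the solution at time $t$ of $i\partial_t v=-\Delta v$, $v(0)=v_0$, with the given boundary condition. There are functions $\varepsilon_0:\mathbb R\to(0,\infty)$ and $C:\mathbb R^2\to\mathbb R$, depending only on $d$,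 $\Omega$, the boundary condition and $\lambda$, such that the following holds. Let $T>0$, let $M,m\ge 0$, let $0<\varepsilon\le\varepsilon_0(M)$, and let $u^\varepsilon\in C([0,T];L^2(\Omega))$ be a weak solution of the equation on $[0,T]$ with $$\|u^\varepsilon\|_{L^\infty(0,T;H^1(\Omega))}\le M\ \text{ if } d=1,\qquad \|u^\varepsilon\|_{L^\infty(0,T;H^2(\Omega))}\le M\ \text{ if } d=2,3,$$ and $\|u^\varepsilon\|_{L^\infty(0,T;H^1(\Omega))}\le m$. Then for all $\tau>0$ and all integers $n\ge0$ with $n\tau\le T$, $$\|u^{\varepsilon,n}-u^\varepsilon(t_n)\|_{L^2(\Omega)}\le C(T,m)\,\ln(\varepsilon^{-1})\,\tau^{1/2}.$$ In particular the constant $C(T,m)$ does not depend on $\varepsilon$, $\tau$, $n$, nor on $M$. -/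

import Mathlib

open MeasureTheory Set
open scoped ENNReal ContDiff Laplacian

noncomputable section

/-- The space `ℝ^d` with its Euclidean norm. -/
abbrev Space (d : ℕ) : Type := EuclideanSpace ℝ (Fin d)

/-- The spatial settings: the whole space `ℝ^d`; a bounded domain (an open connected set, no
regularity of the boundary being required) with the homogeneous Dirichlet boundary condition; a box
`∏ (a i, b i)` with the periodic boundary condition. -/
inductive Setting (d : ℕ) : Type
  | whole : Setting d
  | dirichlet (U : Set (Space d)) (isOpen : IsOpen U) (isConnected : IsConnected U)
      (isBounded : Bornology.IsBounded U) : Setting d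
  | periodic (a b : Fin d → ℝ) (lt : ∀ i, a i < b i) : Setting d

/-- The phase function `z ↦ ln ((ε + |z|)²)` of the regularized logarithm. -/
def logPhase (ε : ℝ) (z : ℂ) : ℝ := Real.log ((ε + ‖z‖) ^ 2)

/-- The regularized nonlinearity `φ^ε(z) = z ln ((ε + |z|)²)`. -/
def regNonlin (ε : ℝ) (z : ℂ) : ℂ := z * (logPhase ε z : ℂ)

/-- The pointwise flow `z ↦ z exp (-i t λ ln ((ε + |z|)²))` of `i ω' = λ φ^ε(ω)`. -/
def nonlinFlow (lam ε t : ℝ) (z : ℂ) : ℂ :=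
  z * Complex.exp (((-(t * lam * logPhase ε z) : ℝ) : ℂ) * Complex.I)

lemma norm_nonlinFlow (lam ε t : ℝ) (z : ℂ) : ‖nonlinFlow lam ε t z‖ = ‖z‖ := by
  rw [nonlinFlow, norm_mul, Complex.norm_exp_ofReal_mul_I, mul_one]

lemma measurable_nonlinFlow (lam ε t : ℝ) : Measurable (nonlinFlow lam ε t) := by
  unfold nonlinFlow logPhase
  fun_prop

/-- The partial derivative `∂_j ψ`. -/
def partialDeriv {d : ℕ} (j : Fin d) (ψ : Space d → ℂ) (x : Space d) : ℂ :=
  fderiv ℝ ψ x (EuclideanSpace.single j 1)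

namespace Setting

variable {d : ℕ}

/-- The set `Ω`. -/
def carrier : Setting d → Set (Space d)
  | whole => univ
  | dirichlet U _ _ _ => U
  | periodic a b _ => {x | ∀ i, a i < x i ∧ x i < b i}

/-- The test functions: `C_c^∞(Ω)` for the whole space and for the Dirichlet condition, the smooth
functions on `ℝ^d` of period `b i - a i` in the `i`-th variable for the periodic condition. -/
def IsTest : Setting d → (Space d → ℂ) → Prop
  | whole, ψ => ContDiff ℝ ∞ ψ ∧ HasCompactSupport ψ
  | dirichlet U _ _ _, ψ => ContDiff ℝ ∞ ψ ∧ HasCompactSupport ψ ∧ tsupport ψ ⊆ U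
  | periodic a b _, ψ => ContDiff ℝ ∞ ψ ∧
      ∀ (i : Fin d) (x : Space d), ψ (x + EuclideanSpace.single i (b i - a i)) = ψ x

/-- Lebesgue measure on `Ω`. -/
abbrev meas (D : Setting d) : Measure (Space d) := volume.restrict D.carrier

/-- The Hilbert space `L²(Ω)` of complex-valued functions. -/
abbrev L2 (D : Setting d) : Type := Lp ℂ 2 D.meas

/-- `g ∈ L²(Ω)` is the weak derivative `∂_j u` of `u ∈ L²(Ω)`. (In the periodic setting the test
functions are the periodic ones, so that this is the weak derivative on the torus.) -/
def HasWeakDeriv (D : Setting d) (j : Fin d) (u g : D.L2) : Prop :=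
  ∀ ψ, D.IsTest ψ → ∫ x, u x * partialDeriv j ψ x ∂D.meas = -∫ x, g x * ψ x ∂D.meas

/-- The norm of `H¹(Ω)`; it is `⊤` when `u ∉ H¹(Ω)`. Weak derivatives are unique, so the infimum
runs over at most one family. -/
def h1Norm (D : Setting d) (u : D.L2) : ℝ≥0∞ :=
  ⨅ (g : Fin d → D.L2) (_ : ∀ j, D.HasWeakDeriv j u (g j)),
    ENNReal.ofReal (Real.sqrt (‖u‖ ^ 2 + ∑ j, ‖g j‖ ^ 2))

/-- The norm of `H²(Ω)`; it is `⊤` when `u ∉ H²(Ω)`. -/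
def h2Norm (D : Setting d) (u : D.L2) : ℝ≥0∞ :=
  ⨅ (g : Fin d → D.L2) (h : Fin d → Fin d → D.L2)
    (_ : ∀ j, D.HasWeakDeriv j u (g j)) (_ : ∀ j k, D.HasWeakDeriv k (g j) (h j k)),
    ENNReal.ofReal (Real.sqrt (‖u‖ ^ 2 + ∑ j, ‖g j‖ ^ 2 + ∑ j, ∑ k, ‖h j k‖ ^ 2))

/-- The norm in which the solution is assumed bounded: that of `H¹(Ω)` if `d = 1`, that of `H²(Ω)`
in the other dimensions. -/
def regNorm (D : Setting d) (u : D.L2) : ℝ≥0∞ := if d = 1 then D.h1Norm u else D.h2Norm u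

/-- The norm of `L^∞(0,T;X)`, for a norm `N` (that of `X`) on a subspace `X` of `L²(Ω)`. -/
def linftyNorm (D : Setting d) (T : ℝ) (N : D.L2 → ℝ≥0∞) (u : ℝ → D.L2) : ℝ≥0∞ :=
  essSup (fun t => N (u t)) (volume.restrict (Ioo 0 T))

/-- Membership in the energy space, the closure of the test functions in `H¹(Ω)`: it is `H¹(ℝ^d)`
for the whole space, `H¹₀(Ω)` for the Dirichlet condition, and the space of periodic `H¹` functions
for the periodic condition. -/
def MemEnergy (D : Setting d) (u : D.L2) : Prop :=
  ∃ g : Fin d → D.L2, (∀ j, D.HasWeakDeriv j u (g j)) ∧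
    ∀ δ : ℝ, 0 < δ → ∃ ψ, D.IsTest ψ ∧
      eLpNorm (fun x => u x - ψ x) 2 D.meas < ENNReal.ofReal δ ∧
      ∀ j, eLpNorm (fun x => g j x - partialDeriv j ψ x) 2 D.meas < ENNReal.ofReal δ

/-- The graph of the (self-adjoint) Laplacian on `L²(Ω)` with the boundary condition: `w` is in the
energy space and its distributional Laplacian is `f ∈ L²(Ω)`. -/
def IsLaplacian (D : Setting d) (w f : D.L2) : Prop :=
  D.MemEnergy w ∧
    ∀ ψ, D.IsTest ψ → ∫ x, w x * (Δ ψ) x ∂D.meas = ∫ x, f x * ψ x ∂D.meas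

/-- `v ∈ C(ℝ; L²(Ω))` is the (weak) solution of `i ∂ₜ v = -Δ v`, `v(0) = v₀`, with the boundary
condition: `d/dt ⟨w, v(t)⟩ = i ⟨Δ w, v(t)⟩` for all `w` in the domain of the Laplacian. -/
def IsFreeSolution (D : Setting d) (v₀ : D.L2) (v : ℝ → D.L2) : Prop :=
  Continuous v ∧ v 0 = v₀ ∧ ∀ w f, D.IsLaplacian w f → ∀ t : ℝ,
    HasDerivAt (fun s => inner ℂ w (v s)) (Complex.I * inner ℂ f (v t)) t

open Classical in
/-- The evolution operator `Φ_A^t = e^{itΔ}` on `L²(Ω)`: the value at time `t` of the solution of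
the free Schrödinger equation (which exists and is unique for every `v₀ ∈ L²(Ω)`, the Laplacian
being self-adjoint). -/
def flowA (D : Setting d) (t : ℝ) (v₀ : D.L2) : D.L2 :=
  if h : ∃ v, D.IsFreeSolution v₀ v then h.choose t else 0

lemma memLp_nonlinFlow (D : Setting d) (lam ε t : ℝ) (z : D.L2) :
    MemLp (fun x => nonlinFlow lam ε t (z x)) 2 D.meas :=
  (Lp.memLp z).of_le
    ((measurable_nonlinFlow lam ε t).comp_aemeasurable
      (Lp.aestronglyMeasurable z).aemeasurable).aestronglyMeasurable
    (Filter.Eventually.of_forall fun x => (norm_nonlinFlow lam ε t (z x)).le)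

/-- The evolution operator `Φ_B^t(z) = z exp (-i t λ ln ((ε + |z|)²))` on `L²(Ω)`. -/
def flowB (D : Setting d) (lam ε t : ℝ) (z : D.L2) : D.L2 :=
  (D.memLp_nonlinFlow lam ε t z).toLp _

/-- The Lie–Trotter splitting `u^{n+1} = Φ_A^τ(Φ_B^τ(u^n))`, `u^0 = u₀`, with time step `τ`. -/
def lieTrotter (D : Setting d) (lam ε τ : ℝ) (u₀ : D.L2) : ℕ → D.L2
  | 0 => u₀
  | n + 1 => D.flowA τ (D.flowB lam ε τ (lieTrotter D lam ε τ u₀ n))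

/-- `u ∈ C([0,T]; L²(Ω))` is a weak solution on `[0,T]` of
`i ∂ₜ u + Δ u = λ u ln ((ε + |u|)²)` with initial value `u₀` and the boundary condition. -/
structure IsSolution (D : Setting d) (lam ε T : ℝ) (u₀ : D.L2) (u : ℝ → D.L2) : Prop where
  continuousOn : ContinuousOn u (Icc 0 T)
  initial : u 0 = u₀
  boundary : ∀ᵐ t ∂(volume.restrict (Ioo 0 T)), D.MemEnergy (u t)
  equation : ∀ ψ, D.IsTest ψ → ∀ t ∈ Ioo 0 T,
    HasDerivAt (fun s => ∫ x, u s x * ψ x ∂D.meas)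
      (Complex.I * ∫ x, u t x * (Δ ψ) x ∂D.meas
        - Complex.I * (lam * ∫ x, regNonlin ε (u t x) * ψ x ∂D.meas)) t

end Setting

end

/-! The energy space enters through the closure in `L²(Ω) × L²(Ω)^d` of the graph of the gradient
on the test functions. Orthogonal projection onto this graph yields the resolvent of `Δ = -∇^* ∇`,
and the functional calculus of the resolvent yields the unitary group `e^{itΔ}`. This treats the
three boundary conditions at once; they differ only in the density and embedding properties of the
test functions.

The bound in the regularity norm makes the solution bounded pointwise by some `K M`: for `d = 1`
because `H¹ ⊆ L^∞`, and for `d = 2, 3` by Stampacchia's truncation method, from the Sobolev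
embedding `H¹ ⊆ L⁶` alone, so that no regularity of the boundary is needed. For small `ε` one may
therefore replace the nonlinearity by a globally Lipschitz one, whose Lipschitz constant
`C ln (1/ε)` does not depend on `K M`. Composition with a Lipschitz map preserves `H¹`, and on `H¹`
the group moves functions by `O(√t)` only. Hence one step of the splitting has the local error
`O(ln (1/ε) τ^{3/2})`. Since `Φ_B^τ` is Lipschitz with constant `1 + O(τ)` uniformly in `ε`, the
discrete Gronwall inequality gives the global error if `ln (1/ε) √τ ≤ 1`; otherwise the estimate
follows from the boundedness of both solutions in `L²`. -/

open Filter Topology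

noncomputable section

/-! ### The unitary group generated by a self-adjoint contraction with dense range -/

section UnitaryGroup

/-- The function `r ↦ r exp (i t (1 - 1/r))`, which for the resolvent `r = (1 + x)⁻¹` at `x ≥ 0` is
`r exp (-i t x)`. At `r = 0` the junk value `0⁻¹ = 0` is harmless because of the factor `r`. -/
def resolventPhase (t r : ℝ) : ℂ := r * Complex.exp ((t * (1 - r⁻¹) : ℝ) * Complex.I)

lemma norm_resolventPhase (t r : ℝ) : ‖resolventPhase t r‖ = |r| := by
  rw [resolventPhase, norm_mul, Complex.norm_exp_ofReal_mul_I, mul_one, Complex.norm_real,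
    Real.norm_eq_abs]

lemma resolventPhase_zero_left (r : ℝ) : resolventPhase 0 r = r := by
  simp [resolventPhase]

lemma resolventPhase_zero_right (t : ℝ) : resolventPhase t 0 = 0 := by
  simp [resolventPhase]

lemma continuous_resolventPhase (t : ℝ) : Continuous (resolventPhase t) := by
  rw [continuous_iff_continuousAt]
  intro r
  rcases eq_or_ne r 0 with rfl | hr
  · rw [ContinuousAt, resolventPhase_zero_right]
    refine squeeze_zero_norm (a := fun r => |r|) (fun r => (norm_resolventPhase t r).le) ?_
    simpa only [abs_zero] using continuous_abs.tendsto (0 : ℝ)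
  · unfold resolventPhase
    fun_prop (disch := exact hr)

lemma resolventPhase_add (s t r : ℝ) : resolventPhase (s + t) r
    = resolventPhase s r * Complex.exp ((t * (1 - r⁻¹) : ℝ) * Complex.I) := by
  rw [resolventPhase, resolventPhase, mul_assoc, ← Complex.exp_add]
  push_cast
  ring_nf

lemma resolventPhase_mul (s t r : ℝ) :
    resolventPhase s r * resolventPhase t r = r * resolventPhase (s + t) r := by
  rw [resolventPhase_add, resolventPhase, resolventPhase]
  ring

lemma star_resolventPhase (t r : ℝ) : star (resolventPhase t r) = resolventPhase (-t) r := by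
  unfold resolventPhase
  rw [star_mul', Complex.star_def, Complex.conj_ofReal, ← Complex.exp_conj,
    map_mul, Complex.conj_ofReal, Complex.conj_I]
  push_cast; ring_nf

lemma norm_exp_mul_I_sub_one_le (x : ℝ) : ‖Complex.exp (x * Complex.I) - 1‖ ≤ |x| := by
  have h := Real.norm_exp_I_mul_ofReal_sub_one_le (x := x)
  rwa [mul_comm, Real.norm_eq_abs] at h

lemma norm_exp_mul_I_sub_one_sub_le (x : ℝ) :
    ‖Complex.exp (x * Complex.I) - 1 - x * Complex.I‖ ≤ 2 * x ^ 2 := by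
  have hx : ‖(x * Complex.I : ℂ)‖ = |x| := by simp
  rcases le_total |x| 1 with h | h
  · have := Complex.norm_exp_sub_one_sub_id_le (x := x * Complex.I) (by rwa [hx])
    rw [hx, sq_abs] at this
    nlinarith [sq_nonneg x]
  · calc _ ≤ ‖Complex.exp (x * Complex.I) - 1‖ + ‖(x * Complex.I : ℂ)‖ := norm_sub_le _ _
      _ ≤ |x| + |x| := by rw [hx]; gcongr; exact norm_exp_mul_I_sub_one_le x
      _ ≤ 2 * |x| ^ 2 := by nlinarith
      _ = 2 * x ^ 2 := by rw [sq_abs]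

lemma norm_resolventPhase_sub_le (s t : ℝ) {r : ℝ} (hr : |r| ≤ 1) :
    ‖resolventPhase t r - resolventPhase s r‖ ≤ 2 * |t - s| := by
  rcases eq_or_ne r 0 with rfl | h0
  · simp [resolventPhase_zero_right]
  have hfactor : resolventPhase t r - resolventPhase s r
      = resolventPhase s r * (Complex.exp (((t - s) * (1 - r⁻¹) : ℝ) * Complex.I) - 1) := by
    rw [mul_sub, mul_one, ← resolventPhase_add, add_sub_cancel]
  rw [hfactor, norm_mul, norm_resolventPhase]
  calc |r| * _ ≤ |r| * |(t - s) * (1 - r⁻¹)| := by gcongr; exact norm_exp_mul_I_sub_one_le _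
    _ = |t - s| * |r - 1| := by
      rw [← abs_mul, ← abs_mul]; congr 1; field_simp
    _ ≤ |t - s| * 2 := by
      gcongr
      rw [abs_le] at *; constructor <;> linarith
    _ = _ := mul_comm _ _

lemma norm_resolventPhase_taylor_le (t h : ℝ) {r : ℝ} (hr : |r| ≤ 1) :
    ‖r * resolventPhase (t + h) r - r * resolventPhase t r
      - h * Complex.I * (r * resolventPhase t r - resolventPhase t r)‖ ≤ 8 * h ^ 2 := by
  rcases eq_or_ne r 0 with rfl | h0
  · simp only [resolventPhase_zero_right, mul_zero, sub_zero, norm_zero]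
    positivity
  have hc : (r : ℂ) ≠ 0 := by exact_mod_cast h0
  have hfactor : r * resolventPhase (t + h) r - r * resolventPhase t r
      - h * Complex.I * (r * resolventPhase t r - resolventPhase t r)
      = r * resolventPhase t r * (Complex.exp ((h * (1 - r⁻¹) : ℝ) * Complex.I) - 1
        - (h * (1 - r⁻¹) : ℝ) * Complex.I) := by
    rw [resolventPhase_add]
    push_cast
    field_simp
  rw [hfactor, norm_mul, norm_mul, norm_resolventPhase, Complex.norm_real, Real.norm_eq_abs]
  calc |r| * |r| * _ ≤ |r| * |r| * (2 * (h * (1 - r⁻¹)) ^ 2) := by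
        gcongr; exact norm_exp_mul_I_sub_one_sub_le _
    _ = 2 * h ^ 2 * (r - 1) ^ 2 := by rw [abs_mul_abs_self]; field_simp
    _ ≤ 2 * h ^ 2 * 4 := by
      gcongr; rw [abs_le] at hr; nlinarith
    _ = _ := by ring

variable {H : Type*} [NormedAddCommGroup H] [InnerProductSpace ℂ H] [CompleteSpace H]

/-- For a self-adjoint `R`, the operator `R exp (i t (1 - R⁻¹))`. -/
def phaseOp (R : H →L[ℂ] H) (t : ℝ) : H →L[ℂ] H := cfc (fun z : ℂ => resolventPhase t z.re) R

/-- For a self-adjoint contraction `R` with dense range, the unitary `exp (i t (1 - R⁻¹))`. It maps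
`R x` to `phaseOp R t x` and extends from the range of `R` by density. -/
def unitaryGroup (R : H →L[ℂ] H) (t : ℝ) : H →L[ℂ] H :=
  (phaseOp R t : H →ₗ[ℂ] H).extendOfNorm (R : H →ₗ[ℂ] H)

/-- Self-adjoint contractions with dense range; among them are the resolvents `(1 + A)⁻¹` of the
nonnegative self-adjoint operators `A`. -/
structure IsResolvent (R : H →L[ℂ] H) : Prop where
  selfAdjoint : IsSelfAdjoint R
  norm_le : ‖R‖ ≤ 1
  denseRange : DenseRange R

namespace IsResolvent

variable {R : H →L[ℂ] H}

lemma re_of_mem (hR : IsResolvent R) {z : ℂ} (hz : z ∈ spectrum ℂ R) : (z.re : ℂ) = z :=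
  (hR.selfAdjoint.mem_spectrum_eq_re hz).symm

lemma abs_re_le (hR : IsResolvent R) {z : ℂ} (hz : z ∈ spectrum ℂ R) : |z.re| ≤ 1 := by
  have h1 := spectrum.norm_le_norm_mul_of_mem hz
  have h2 : ‖(1 : H →L[ℂ] H)‖ ≤ 1 := ContinuousLinearMap.norm_id_le
  calc |z.re| ≤ ‖z‖ := Complex.abs_re_le_norm z
    _ ≤ ‖R‖ * ‖(1 : H →L[ℂ] H)‖ := h1
    _ ≤ 1 * 1 := by gcongr; exact hR.norm_le
    _ = 1 := one_mul 1

lemma continuousOn_phase (t : ℝ) (s : Set ℂ) :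
    ContinuousOn (fun z : ℂ => resolventPhase t z.re) s :=
  ((continuous_resolventPhase t).comp Complex.continuous_re).continuousOn

lemma cfc_re (hR : IsResolvent R) : cfc (fun z : ℂ => (z.re : ℂ)) R = R := by
  have := hR.selfAdjoint.isStarNormal
  rw [cfc_congr (g := fun z : ℂ => z) fun z hz => hR.re_of_mem hz]
  exact cfc_id' ℂ R

lemma mul_phaseOp (hR : IsResolvent R) (t : ℝ) :
    R * phaseOp R t = cfc (fun z : ℂ => (z.re : ℂ) * resolventPhase t z.re) R := by
  rw [cfc_mul _ _ R (by fun_prop) (continuousOn_phase t _), hR.cfc_re, phaseOp]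

lemma phaseOp_zero (hR : IsResolvent R) : phaseOp R 0 = R := by
  simp_rw [phaseOp, resolventPhase_zero_left, hR.cfc_re]

lemma phaseOp_mul (hR : IsResolvent R) (s t : ℝ) :
    phaseOp R s * phaseOp R t = R * phaseOp R (s + t) := by
  rw [hR.mul_phaseOp, phaseOp, phaseOp,
    ← cfc_mul _ _ R (continuousOn_phase s _) (continuousOn_phase t _)]
  simp_rw [resolventPhase_mul]

lemma phaseOp_comm (hR : IsResolvent R) (t : ℝ) : phaseOp R t * R = R * phaseOp R t := by
  simpa only [hR.phaseOp_zero, add_zero] using hR.phaseOp_mul t 0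

lemma star_phaseOp (t : ℝ) : star (phaseOp R t) = phaseOp R (-t) := by
  rw [phaseOp, phaseOp, ← cfc_star]
  simp_rw [star_resolventPhase]

lemma norm_phaseOp_apply (hR : IsResolvent R) (t : ℝ) (x : H) : ‖phaseOp R t x‖ = ‖R x‖ := by
  have star_mul_self : star (phaseOp R t) * phaseOp R t = star R * R := by
    rw [star_phaseOp, hR.phaseOp_mul, neg_add_cancel, hR.phaseOp_zero, hR.selfAdjoint.star_eq]
  have norm_sq (S : H →L[ℂ] H) : ‖S x‖ ^ 2 = RCLike.re (inner ℂ ((star S * S) x) x) := by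
    rw [mul_apply_eq_comp, ContinuousLinearMap.star_eq_adjoint,
      ContinuousLinearMap.adjoint_inner_left, inner_self_eq_norm_sq]
  rw [← sq_eq_sq₀ (norm_nonneg _) (norm_nonneg _), norm_sq, norm_sq, star_mul_self]

lemma norm_phaseOp_sub_le (hR : IsResolvent R) (s t : ℝ) :
    ‖phaseOp R t - phaseOp R s‖ ≤ 2 * |t - s| := by
  rw [phaseOp, phaseOp, ← cfc_sub _ _ R (continuousOn_phase _ _) (continuousOn_phase _ _)]
  exact norm_cfc_le (by positivity) fun z hz =>
    norm_resolventPhase_sub_le s t (hR.abs_re_le hz)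

lemma continuous_phaseOp (hR : IsResolvent R) : Continuous (phaseOp R) :=
  LipschitzWith.continuous (K := 2) <| LipschitzWith.of_dist_le_mul fun s t => by
    rw [dist_eq_norm, Real.dist_eq]
    exact hR.norm_phaseOp_sub_le t s

lemma norm_phaseOp_taylor_le (hR : IsResolvent R) (t h : ℝ) :
    ‖R * phaseOp R (t + h) - R * phaseOp R t
      - (h * Complex.I) • (R * phaseOp R t - phaseOp R t)‖ ≤ 8 * h ^ 2 := by
  have hphase (s : ℝ) : Continuous fun z : ℂ => resolventPhase s z.re :=
    (continuous_resolventPhase s).comp Complex.continuous_re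
  rw [hR.mul_phaseOp, hR.mul_phaseOp, phaseOp, ← cfc_sub _ _ R (by fun_prop) (by fun_prop),
    ← cfc_sub _ _ R (by fun_prop) (hphase t).continuousOn, ← cfc_smul _ _ R (by fun_prop),
    ← cfc_sub _ _ R (by fun_prop) (by fun_prop)]
  exact norm_cfc_le (by positivity) fun z hz =>
    norm_resolventPhase_taylor_le t h (hR.abs_re_le hz)

lemma unitaryGroup_apply (hR : IsResolvent R) (t : ℝ) (x : H) :
    unitaryGroup R t (R x) = phaseOp R t x :=
  LinearMap.extendOfNorm_eq (f := (phaseOp R t : H →ₗ[ℂ] H)) (e := (R : H →ₗ[ℂ] H)) hR.denseRange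
    ⟨1, fun x => by simpa using (hR.norm_phaseOp_apply t x).le⟩ x

lemma norm_unitaryGroup (hR : IsResolvent R) (t : ℝ) (x : H) : ‖unitaryGroup R t x‖ = ‖x‖ := by
  refine hR.denseRange.induction_on (p := fun x => ‖unitaryGroup R t x‖ = ‖x‖) x
    (isClosed_eq (by fun_prop) (by fun_prop)) fun y => ?_
  rw [hR.unitaryGroup_apply, hR.norm_phaseOp_apply]

lemma unitaryGroup_comm (hR : IsResolvent R) (t : ℝ) (x : H) :
    unitaryGroup R t (R x) = R (unitaryGroup R t x) := by
  refine hR.denseRange.induction_on (p := fun x => unitaryGroup R t (R x)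
    = R (unitaryGroup R t x)) x (isClosed_eq (by fun_prop) (by fun_prop)) fun y => ?_
  rw [hR.unitaryGroup_apply, hR.unitaryGroup_apply]
  exact DFunLike.congr_fun (hR.phaseOp_comm t) y

lemma unitaryGroup_zero (hR : IsResolvent R) (x : H) : unitaryGroup R 0 x = x := by
  refine hR.denseRange.induction_on (p := fun x => unitaryGroup R 0 x = x) x
    (isClosed_eq (by fun_prop) (by fun_prop)) fun y => ?_
  rw [hR.unitaryGroup_apply, hR.phaseOp_zero]

lemma unitaryGroup_add (hR : IsResolvent R) (s t : ℝ) (x : H) :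
    unitaryGroup R (s + t) x = unitaryGroup R s (unitaryGroup R t x) := by
  refine hR.denseRange.induction_on (p := fun x => unitaryGroup R (s + t) x
    = unitaryGroup R s (unitaryGroup R t x)) x (isClosed_eq (by fun_prop) (by fun_prop)) fun y => ?_
  refine hR.denseRange.induction_on (p := fun y => unitaryGroup R (s + t) (R y)
    = unitaryGroup R s (unitaryGroup R t (R y))) y
    (isClosed_eq (by fun_prop) (by fun_prop)) fun z => ?_
  have hmul : phaseOp R s (phaseOp R t z) = R (phaseOp R (s + t) z) :=
    DFunLike.congr_fun (hR.phaseOp_mul s t) z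
  have hcomm : phaseOp R t (R z) = R (phaseOp R t z) := DFunLike.congr_fun (hR.phaseOp_comm t) z
  rw [hR.unitaryGroup_apply t, hcomm, hR.unitaryGroup_apply s, hmul, hR.unitaryGroup_comm,
    hR.unitaryGroup_apply]

lemma unitaryGroup_apply_neg (hR : IsResolvent R) (t : ℝ) (x : H) :
    unitaryGroup R t (unitaryGroup R (-t) x) = x := by
  rw [← hR.unitaryGroup_add, add_neg_cancel, hR.unitaryGroup_zero]

lemma inner_unitaryGroup (hR : IsResolvent R) (t : ℝ) (x y : H) :
    inner ℂ (unitaryGroup R t x) (unitaryGroup R t y) = inner ℂ x y :=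
  LinearIsometry.inner_map_map
    ⟨(unitaryGroup R t : H →ₗ[ℂ] H), fun x => hR.norm_unitaryGroup t x⟩ x y

lemma inner_unitaryGroup_left (hR : IsResolvent R) (t : ℝ) (x y : H) :
    inner ℂ (unitaryGroup R t x) y = inner ℂ x (unitaryGroup R (-t) y) := by
  rw [← hR.inner_unitaryGroup t x, hR.unitaryGroup_apply_neg]

lemma continuous_unitaryGroup (hR : IsResolvent R) (x : H) :
    Continuous fun t => unitaryGroup R t x := by
  have continuous_on_range (y : H) : Continuous fun t => unitaryGroup R t (R y) := by
    simp_rw [hR.unitaryGroup_apply]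
    exact hR.continuous_phaseOp.clm_apply continuous_const
  have dist_eq (r : ℝ) (y z : H) : dist (unitaryGroup R r y) (unitaryGroup R r z) = dist y z := by
    rw [dist_eq_norm, ← map_sub, hR.norm_unitaryGroup, dist_eq_norm]
  refine continuous_of_uniform_approx_of_continuous fun U hU => ?_
  obtain ⟨ε, hε, hεU⟩ := Metric.mem_uniformity_dist.1 hU
  obtain ⟨y, hy⟩ := hR.denseRange.exists_dist_lt x hε
  exact ⟨_, continuous_on_range y, fun t => hεU (by rwa [dist_eq])⟩

lemma continuousOn_unitaryGroup_apply (hR : IsResolvent R) {X : Type*} [TopologicalSpace X]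
    {τ : X → ℝ} {f : X → H} {s : Set X} (hτ : ContinuousOn τ s) (hf : ContinuousOn f s) :
    ContinuousOn (fun x => unitaryGroup R (τ x) (f x)) s := by
  intro a ha
  rw [ContinuousWithinAt, tendsto_iff_norm_sub_tendsto_zero]
  have hlim : Tendsto (fun x => ‖f x - f a‖
      + ‖unitaryGroup R (τ x) (f a) - unitaryGroup R (τ a) (f a)‖) (𝓝[s] a) (𝓝 0) := by
    have hf_lim := tendsto_iff_norm_sub_tendsto_zero.1 (hf a ha)
    have hτ_lim := tendsto_iff_norm_sub_tendsto_zero.1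
      (((hR.continuous_unitaryGroup (f a)).tendsto (τ a)).comp (hτ a ha))
    simpa only [add_zero, Function.comp_apply] using hf_lim.add hτ_lim
  refine squeeze_zero (fun _ => norm_nonneg _) (fun x => ?_) hlim
  calc _ = ‖unitaryGroup R (τ x) (f x - f a)
        + (unitaryGroup R (τ x) (f a) - unitaryGroup R (τ a) (f a))‖ := by
          rw [map_sub]; congr 1; abel
    _ ≤ _ := (norm_add_le _ _).trans (by rw [hR.norm_unitaryGroup])

lemma hasDerivAt_unitaryGroup_range_sq (hR : IsResolvent R) (y : H) (t : ℝ) :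
    HasDerivAt (fun s => unitaryGroup R s (R (R y)))
      (Complex.I • unitaryGroup R t (R (R y) - R y)) t := by
  have group_eq (s : ℝ) : unitaryGroup R s (R (R y)) = (R * phaseOp R s) y := by
    rw [hR.unitaryGroup_apply, ← hR.phaseOp_comm, mul_apply_eq_comp]
  have deriv_eq : unitaryGroup R t (R (R y) - R y) = (R * phaseOp R t - phaseOp R t) y := by
    rw [map_sub, group_eq, hR.unitaryGroup_apply, sub_apply]
  rw [deriv_eq, hasDerivAt_iff_isLittleO_nhds_zero]
  simp_rw [group_eq]
  refine Asymptotics.IsBigO.trans_isLittleO (g := fun h : ℝ => h ^ 2)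
    (Asymptotics.IsBigO.of_bound (8 * ‖y‖) (Eventually.of_forall fun h => ?_)) ?_
  · have := ContinuousLinearMap.le_of_opNorm_le _ (hR.norm_phaseOp_taylor_le t h) y
    rw [Real.norm_of_nonneg (sq_nonneg h), mul_right_comm]
    simpa [mul_smul] using this
  · simpa using Asymptotics.isLittleO_pow_pow (𝕜 := ℝ) (m := 1) (n := 2) (by norm_num)

lemma hasDerivAt_unitaryGroup (hR : IsResolvent R) (k : H) (t : ℝ) :
    HasDerivAt (fun s => unitaryGroup R s (R k))
      (Complex.I • unitaryGroup R t (R k - k)) t := by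
  obtain ⟨y, hy⟩ : ∃ y : ℕ → H, Tendsto (fun n => R (y n)) atTop (𝓝 k) := by
    obtain ⟨v, hv, hlim⟩ := mem_closure_iff_seq_limit.1 (hR.denseRange k)
    choose y hy using hv
    exact ⟨y, by simpa only [hy] using hlim⟩
  have hRy : Tendsto (fun n => R (R (y n))) atTop (𝓝 (R k)) := (R.continuous.tendsto k).comp hy
  have hderiv : TendstoUniformlyOn
      (fun n s => Complex.I • unitaryGroup R s (R (R (y n)) - R (y n)))
      (fun s => Complex.I • unitaryGroup R s (R k - k)) atTop univ := by
    rw [Metric.tendstoUniformlyOn_iff]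
    intro ε hε
    filter_upwards [Metric.tendsto_nhds.1 (hRy.sub hy) ε hε] with n hn s _
    rwa [dist_comm, dist_eq_norm, ← smul_sub, ← map_sub, norm_smul, Complex.norm_I, one_mul,
      hR.norm_unitaryGroup, ← dist_eq_norm]
  exact hasDerivAt_of_tendstoUniformlyOn isOpen_univ hderiv
    (Eventually.of_forall fun n s _ => hR.hasDerivAt_unitaryGroup_range_sq (y n) s)
    (fun s _ => ((unitaryGroup R s).continuous.tendsto _).comp hRy) (mem_univ t)

end IsResolvent

end UnitaryGroup

/-! ### The self-adjoint operator of a closed gradient -/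

section GradientGraph

variable {H E : Type*} [NormedAddCommGroup H] [InnerProductSpace ℂ H]
  [NormedAddCommGroup E] [InnerProductSpace ℂ E]

/-- The operator `Δ = -∇^* ∇` as a relation `f = Δ w`, where the operator `∇` from `H` to `E` is
encoded by its graph `G`. -/
def GraphLaplacian (G : Submodule ℂ (WithLp 2 (H × E))) (w f : H) : Prop :=
  ∃ g, WithLp.toLp 2 (w, g) ∈ G ∧ ∀ p ∈ G, inner ℂ g p.snd = -inner ℂ f p.fst

lemma GraphLaplacian.smul {G : Submodule ℂ (WithLp 2 (H × E))} {w f : H}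
    (h : GraphLaplacian G w f) (c : ℂ) : GraphLaplacian G (c • w) (c • f) := by
  obtain ⟨g, hg, hw⟩ := h
  refine ⟨c • g, G.smul_mem c hg, fun p hp => ?_⟩
  rw [inner_smul_left, inner_smul_left, hw p hp, mul_neg]

/-- The resolvent `(1 + ∇^* ∇)⁻¹`, where `G` is the graph of `∇`: it maps `f` to the first component
of the orthogonal projection of `(f, 0)` onto `G`. -/
def graphResolvent (G : Submodule ℂ (WithLp 2 (H × E))) [G.HasOrthogonalProjection] : H →L[ℂ] H :=
  WithLp.fstL 2 ℂ H E ∘L G.starProjection ∘L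
    ((WithLp.prodContinuousLinearEquiv 2 ℂ H E).symm : H × E →L[ℂ] WithLp 2 (H × E)) ∘L
      ContinuousLinearMap.inl ℂ H E

/-- The map `(u, g) ↦ (u, c g)`, which rescales a gradient. -/
def smulSnd (c : ℂ) : WithLp 2 (H × E) →L[ℂ] WithLp 2 (H × E) :=
  ((WithLp.prodContinuousLinearEquiv 2 ℂ H E).symm : H × E →L[ℂ] WithLp 2 (H × E)) ∘L
    (WithLp.fstL 2 ℂ H E).prod (c • WithLp.sndL 2 ℂ H E)

section Resolvent

variable (G : Submodule ℂ (WithLp 2 (H × E))) [G.HasOrthogonalProjection]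

lemma exists_graphResolvent_eq (f : H) : ∃ g, WithLp.toLp 2 (graphResolvent G f, g) ∈ G ∧
    ∀ p ∈ G, inner ℂ g p.snd = inner ℂ (f - graphResolvent G f) p.fst := by
  set q := G.starProjection (WithLp.toLp 2 (f, 0)) with hq
  refine ⟨q.snd, G.starProjection_apply_mem (WithLp.toLp 2 (f, 0)), fun p hp => ?_⟩
  have h := (G.mem_orthogonal' _).1
    (G.sub_starProjection_mem_orthogonal (WithLp.toLp 2 (f, 0))) p hp
  rw [← hq, WithLp.prod_inner_apply] at h
  simp only [WithLp.ofLp_sub, Prod.fst_sub, Prod.snd_sub, zero_sub, inner_neg_left] at h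
  rw [← sub_eq_add_neg, sub_eq_zero] at h
  exact h.symm

lemma eq_graphResolvent {f w : H} {g : E} (hw : WithLp.toLp 2 (w, g) ∈ G)
    (h : ∀ p ∈ G, inner ℂ g p.snd = inner ℂ (f - w) p.fst) : w = graphResolvent G f := by
  obtain ⟨g', hw', h'⟩ := exists_graphResolvent_eq G f
  have hdiff := G.sub_mem hw hw'
  have e := h _ hdiff
  have e' := h' _ hdiff
  simp only [← WithLp.toLp_sub, Prod.mk_sub_mk, WithLp.toLp_fst, WithLp.toLp_snd] at e e'
  have energy : inner ℂ (g - g') (g - g')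
      = -inner ℂ (w - graphResolvent G f) (w - graphResolvent G f) := by
    rw [inner_sub_left, e, e', ← inner_sub_left, ← inner_neg_left]; congr 1; abel
  have energy_re := congrArg RCLike.re energy
  rw [map_neg, inner_self_eq_norm_sq, inner_self_eq_norm_sq] at energy_re
  have : ‖w - graphResolvent G f‖ ^ 2 = 0 :=
    le_antisymm (by nlinarith [sq_nonneg ‖g - g'‖]) (sq_nonneg _)
  exact sub_eq_zero.1 (norm_eq_zero.1 (pow_eq_zero_iff two_ne_zero |>.1 this))

lemma graphLaplacian_iff {w f : H} :
    GraphLaplacian G w f ↔ w = graphResolvent G (w - f) := by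
  constructor
  · rintro ⟨g, hg, h⟩
    refine eq_graphResolvent G hg fun p hp => ?_
    rw [h p hp, sub_sub_cancel_left, inner_neg_left]
  · intro h
    obtain ⟨g, hg, h'⟩ := exists_graphResolvent_eq G (w - f)
    rw [← h] at hg h'
    refine ⟨g, hg, fun p hp => ?_⟩
    rw [h' p hp, sub_sub_cancel_left, inner_neg_left]

lemma graphLaplacian_graphResolvent (k : H) :
    GraphLaplacian G (graphResolvent G k) (graphResolvent G k - k) := by
  rw [graphLaplacian_iff, sub_sub_cancel]

lemma inner_graphResolvent_comm (x y : H) :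
    inner ℂ (graphResolvent G x) y = inner ℂ x (graphResolvent G y) := by
  have inner_eq (x y : H) : inner ℂ x (graphResolvent G y)
      = inner ℂ (WithLp.toLp 2 (x, (0 : E))) (G.starProjection (WithLp.toLp 2 (y, 0))) := by
    rw [WithLp.prod_inner_apply]; simp [graphResolvent]
  have hsymm : inner ℂ (G.starProjection (WithLp.toLp 2 (x, (0 : E)))) (WithLp.toLp 2 (y, 0))
      = inner ℂ (WithLp.toLp 2 (x, (0 : E))) (G.starProjection (WithLp.toLp 2 (y, 0))) :=
    G.starProjection_isSymmetric _ _
  rw [inner_eq, ← inner_conj_symm, inner_eq, ← hsymm, inner_conj_symm]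

lemma norm_graphResolvent_le : ‖graphResolvent G‖ ≤ 1 := by
  refine ContinuousLinearMap.opNorm_le_bound _ zero_le_one fun x => ?_
  calc ‖graphResolvent G x‖
      ≤ ‖G.starProjection (WithLp.toLp 2 (x, (0 : E)))‖ := WithLp.norm_fst_le _ _
    _ ≤ ‖WithLp.toLp 2 (x, (0 : E))‖ := G.norm_starProjection_apply_le _
    _ = 1 * ‖x‖ := by simp

end Resolvent

variable [CompleteSpace H]

lemma isResolvent_graphResolvent (G : Submodule ℂ (WithLp 2 (H × E))) [G.HasOrthogonalProjection]
    (hG : ∀ f : H, (∀ p ∈ G, inner ℂ f p.fst = 0) → f = 0) :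
    IsResolvent (graphResolvent G) where
  selfAdjoint :=
    ContinuousLinearMap.isSelfAdjoint_iff_isSymmetric.2 fun x y => inner_graphResolvent_comm G x y
  norm_le := norm_graphResolvent_le G
  denseRange := by
    change Dense ((graphResolvent G).range : Set H)
    rw [Submodule.dense_iff_topologicalClosure_eq_top, Submodule.topologicalClosure_eq_top_iff,
      Submodule.eq_bot_iff]
    intro f hf
    have hf0 : graphResolvent G f = 0 := by
      refine ext_inner_left ℂ fun y => ?_
      rw [← inner_graphResolvent_comm, inner_zero_right]
      exact (Submodule.mem_orthogonal _ _).1 hf _ ⟨y, rfl⟩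
    obtain ⟨g, hg, h⟩ := exists_graphResolvent_eq G f
    rw [hf0] at hg h
    have hg0 : g = 0 := by simpa using h _ hg
    refine hG f fun p hp => ?_
    rw [← sub_zero f, ← h p hp, hg0, inner_zero_left]

lemma exists_resolvent_scaled [CompleteSpace E] {G : Submodule ℂ (WithLp 2 (H × E))}
    (hG : IsClosed (G : Set (WithLp 2 (H × E)))) {r : ℝ} (hr : r ≠ 0) (u : H) :
    ∃ w h, WithLp.toLp 2 (w, h) ∈ G ∧
      ∀ p ∈ G, (r : ℂ) ^ 2 * inner ℂ h p.snd = inner ℂ (u - w) p.fst := by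
  have hrc : (r : ℂ) ≠ 0 := by exact_mod_cast hr
  let scale : WithLp 2 (H × E) →L[ℂ] WithLp 2 (H × E) := smulSnd (r⁻¹ : ℂ)
  set S := G.comap (scale : WithLp 2 (H × E) →ₗ[ℂ] WithLp 2 (H × E))
  have : CompleteSpace S := (hG.preimage scale.continuous).completeSpace_coe
  obtain ⟨γ, hγ, h⟩ := exists_graphResolvent_eq S u
  refine ⟨graphResolvent S u, (r⁻¹ : ℂ) • γ, hγ, fun p hp => ?_⟩
  have hmem : WithLp.toLp 2 (p.fst, (r : ℂ) • p.snd) ∈ S := by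
    change WithLp.toLp 2 (p.fst, (r⁻¹ : ℂ) • (r : ℂ) • p.snd) ∈ G
    rwa [inv_smul_smul₀ hrc]
  have := h _ hmem
  change inner ℂ γ ((r : ℂ) • p.snd) = inner ℂ (u - graphResolvent S u) p.fst at this
  rw [inner_smul_right] at this
  rw [inner_smul_left, map_inv₀, Complex.conj_ofReal, ← this]
  field_simp

lemma exists_graphLaplacian_near [CompleteSpace E] {G : Submodule ℂ (WithLp 2 (H × E))}
    (hG : IsClosed (G : Set (WithLp 2 (H × E)))) {u : H} {g : E} (hu : WithLp.toLp 2 (u, g) ∈ G)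
    {r : ℝ} (hr : 0 < r) :
    ∃ w f, GraphLaplacian G w f ∧ ‖u - w‖ ≤ r * ‖g‖ ∧ r * ‖f‖ ≤ ‖g‖ := by
  obtain ⟨w, h, hwh, hres⟩ := exists_resolvent_scaled hG hr.ne' u
  have energy : r ^ 2 * (RCLike.re (inner ℂ h g) - ‖h‖ ^ 2) = ‖u - w‖ ^ 2 := by
    have e := congrArg RCLike.re (hres _ (G.sub_mem hu hwh))
    simp only [← WithLp.toLp_sub, Prod.mk_sub_mk, WithLp.toLp_fst, WithLp.toLp_snd] at e
    rwa [inner_self_eq_norm_sq, inner_sub_right, ← Complex.ofReal_pow, RCLike.re_eq_complex_re,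
      Complex.re_ofReal_mul, ← RCLike.re_eq_complex_re, map_sub, inner_self_eq_norm_sq] at e
  have hclose : ‖u - w‖ ≤ r * ‖g‖ := by
    refine le_of_sq_le_sq ?_ (by positivity)
    rw [← energy, mul_pow]
    gcongr
    nlinarith [re_inner_le_norm (𝕜 := ℂ) h g, sq_nonneg (‖h‖ - ‖g‖ / 2), sq_nonneg ‖g‖]
  refine ⟨w, ((r ^ 2 : ℝ) : ℂ)⁻¹ • (w - u), ⟨h, hwh, fun p hp => ?_⟩, hclose, ?_⟩
  · have hrc : (r : ℂ) ≠ 0 := by exact_mod_cast hr.ne'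
    rw [inner_smul_left, ← neg_sub u w, inner_neg_left, ← hres p hp, map_inv₀, Complex.conj_ofReal]
    push_cast
    field_simp
  · rw [norm_smul, norm_inv, Complex.norm_real, Real.norm_of_nonneg (by positivity), norm_sub_rev]
    calc r * ((r ^ 2)⁻¹ * ‖u - w‖) ≤ r * ((r ^ 2)⁻¹ * (r * ‖g‖)) := by gcongr
      _ = ‖g‖ := by field_simp

/-- The unitary group `e^{itΔ}`, where `Δ = -∇^* ∇` and `G` is the graph of `∇`. -/
def graphGroup (G : Submodule ℂ (WithLp 2 (H × E))) [G.HasOrthogonalProjection] (t : ℝ) :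
    H →L[ℂ] H :=
  unitaryGroup (graphResolvent G) t

variable {G : Submodule ℂ (WithLp 2 (H × E))} [G.HasOrthogonalProjection]
  (hR : IsResolvent (graphResolvent G)) {w f : H}

include hR

lemma norm_graphGroup (t : ℝ) (x : H) : ‖graphGroup G t x‖ = ‖x‖ := hR.norm_unitaryGroup t x

lemma graphGroup_zero (x : H) : graphGroup G 0 x = x := hR.unitaryGroup_zero x

lemma graphGroup_add (s t : ℝ) (x : H) :
    graphGroup G (s + t) x = graphGroup G s (graphGroup G t x) :=
  hR.unitaryGroup_add s t x

lemma inner_graphGroup_left (t : ℝ) (x y : H) :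
    inner ℂ (graphGroup G t x) y = inner ℂ x (graphGroup G (-t) y) :=
  hR.inner_unitaryGroup_left t x y

lemma GraphLaplacian.hasDerivAt_graphGroup (h : GraphLaplacian G w f) (t : ℝ) :
    HasDerivAt (fun s => graphGroup G s w) (Complex.I • graphGroup G t f) t := by
  have := hR.hasDerivAt_unitaryGroup (w - f) t
  rwa [← (graphLaplacian_iff G).1 h, sub_sub_cancel] at this

lemma GraphLaplacian.map_graphGroup (h : GraphLaplacian G w f) (t : ℝ) :
    GraphLaplacian G (graphGroup G t w) (graphGroup G t f) := by
  rw [graphLaplacian_iff, ← map_sub]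
  conv_lhs => rw [(graphLaplacian_iff G).1 h]
  exact hR.unitaryGroup_comm t _

lemma GraphLaplacian.norm_graphGroup_sub_le (h : GraphLaplacian G w f) (t : ℝ) :
    ‖graphGroup G t w - w‖ ≤ ‖f‖ * |t| := by
  have := Convex.norm_image_sub_le_of_norm_hasDerivWithin_le (𝕜 := ℝ) (s := univ) (x := 0) (y := t)
    (f := fun s => graphGroup G s w) (C := ‖f‖)
    (fun s _ => (h.hasDerivAt_graphGroup hR s).hasDerivWithinAt)
    (fun s _ => by rw [norm_smul, Complex.norm_I, one_mul, norm_graphGroup hR])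
    convex_univ (mem_univ _) (mem_univ _)
  simpa only [graphGroup_zero hR, sub_zero, Real.norm_eq_abs] using this

lemma norm_graphGroup_sub_le [CompleteSpace E] (hG : IsClosed (G : Set (WithLp 2 (H × E))))
    {u : H} {g : E} (hu : WithLp.toLp 2 (u, g) ∈ G) (t : ℝ) :
    ‖graphGroup G t u - u‖ ≤ 3 * √|t| * ‖g‖ := by
  rcases eq_or_ne t 0 with rfl | ht
  · simp [graphGroup_zero hR]
  obtain ⟨w, f, h, huw, hf⟩ :=
    exists_graphLaplacian_near hG hu (Real.sqrt_pos.2 (abs_pos.2 ht))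
  have hw : ‖graphGroup G t w - w‖ ≤ √|t| * ‖g‖ :=
    calc ‖graphGroup G t w - w‖ ≤ ‖f‖ * |t| := h.norm_graphGroup_sub_le hR t
      _ = √|t| * (√|t| * ‖f‖) := by
          rw [← mul_assoc, Real.mul_self_sqrt (abs_nonneg t), mul_comm]
      _ ≤ √|t| * ‖g‖ := by gcongr
  calc ‖graphGroup G t u - u‖ = ‖graphGroup G t (u - w) + (graphGroup G t w - w) - (u - w)‖ := by
        rw [map_sub]; congr 1; abel
    _ ≤ ‖graphGroup G t (u - w)‖ + ‖graphGroup G t w - w‖ + ‖u - w‖ :=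
      (norm_sub_le _ _).trans (by gcongr; exact norm_add_le _ _)
    _ ≤ _ := by rw [norm_graphGroup hR]; linarith

lemma hasDerivAt_inner_graphGroup (h : GraphLaplacian G w f) (y : H) (t : ℝ) :
    HasDerivAt (fun s => inner ℂ w (graphGroup G s y))
      (Complex.I * inner ℂ f (graphGroup G t y)) t := by
  have inner_eq (s : ℝ) (x : H) :
      inner ℂ x (graphGroup G s y) = inner ℂ (graphGroup G (-s) x) y := by
    rw [inner_graphGroup_left hR, neg_neg]
  simp_rw [inner_eq]
  have hgroup := HasDerivAt.scomp t (h.hasDerivAt_graphGroup hR (-t)) (hasDerivAt_neg t)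
  refine (hgroup.inner ℂ (hasDerivAt_const t y)).congr_deriv ?_
  simp [inner_smul_left]

lemma hasDerivAt_inner_graphGroup_sub {v : ℝ → H} {N : H} {a t : ℝ} (hv : ContinuousAt v t)
    (hd : ∀ w f, GraphLaplacian G w f →
      HasDerivAt (fun s => inner ℂ w (v s)) (Complex.I * inner ℂ f (v t) + inner ℂ w N) t)
    (h : GraphLaplacian G w f) :
    HasDerivAt (fun s => inner ℂ w (graphGroup G (a - s) (v s)))
      (inner ℂ w (graphGroup G (a - t) N)) t := by
  have inner_eq (s : ℝ) (y : H) :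
      inner ℂ w (graphGroup G (a - s) y) = inner ℂ (graphGroup G (s - a) w) y := by
    rw [inner_graphGroup_left hR, neg_sub]
  simp_rw [inner_eq]
  have hsolution := hd _ _ (h.map_graphGroup hR (t - a))
  -- `v` is merely continuous, so the product rule is applied to slopes.
  have hgroup : HasDerivAt
      (fun s => inner ℂ (graphGroup G (s - a) w - graphGroup G (t - a) w) (v s))
      (inner ℂ (Complex.I • graphGroup G (t - a) f) (v t)) t := by
    rw [hasDerivAt_iff_tendsto_slope]
    have hslope := (hasDerivAt_iff_tendsto_slope.1
      ((h.hasDerivAt_graphGroup hR (t - a)).comp_sub_const t a)).inner (𝕜 := ℂ)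
      (hv.tendsto.mono_left (nhdsWithin_le_nhds (s := {t}ᶜ)))
    refine hslope.congr fun s => ?_
    rw [slope_def_module, slope_def_module, sub_self, inner_zero_left, sub_zero,
      ← Complex.coe_smul, ← Complex.coe_smul, inner_smul_left, Complex.conj_ofReal, smul_eq_mul]
  refine (hgroup.add hsolution).congr_deriv ?_ |>.congr_of_eventuallyEq
    (Eventually.of_forall fun s => ?_)
  · rw [inner_smul_left, Complex.conj_I]; ring
  · simp

lemma re_inner_graphGroup_sub_le {v N : ℝ → H} {c : H} {a b B : ℝ} (hab : a ≤ b)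
    (hv : ContinuousOn v (Icc a b))
    (hd : ∀ w f, GraphLaplacian G w f → ∀ t ∈ Ioo a b,
      HasDerivAt (fun s => inner ℂ w (v s)) (Complex.I * inner ℂ f (v t) + inner ℂ w (N t)) t)
    (hB : ∀ t ∈ Ioo a b, ‖graphGroup G (a - t) (N t) - c‖ ≤ B) (h : GraphLaplacian G w f) :
    (inner ℂ w (graphGroup G (a - b) (v b) - v a - ((b - a : ℝ) : ℂ) • c)).re
      ≤ ‖w‖ * B * (b - a) := by
  set e : ℝ → H := fun s => graphGroup G (a - s) (v s) - ((s - a : ℝ) : ℂ) • c with he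
  have he_cont : ContinuousOn e (Icc a b) :=
    (hR.continuousOn_unitaryGroup_apply (by fun_prop) hv).sub (by fun_prop)
  have he_deriv : ∀ t ∈ Ioo a b, HasDerivAt (fun s => (inner ℂ w (e s)).re)
      (inner ℂ w (graphGroup G (a - t) (N t) - c)).re t := fun t ht => by
    have hgroup := hasDerivAt_inner_graphGroup_sub (a := a) hR
      (hv.continuousAt (Icc_mem_nhds ht.1 ht.2)) (fun w f h => hd w f h t ht) h
    have hlin : HasDerivAt (fun s : ℝ => ((s - a : ℝ) : ℂ) * inner ℂ w c) (1 * inner ℂ w c) t :=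
      HasDerivAt.mul_const (by exact_mod_cast ((hasDerivAt_id t).sub_const a).ofReal_comp) _
    have hdiff : HasDerivAt (fun s => inner ℂ w (e s))
        (inner ℂ w (graphGroup G (a - t) (N t) - c)) t := by
      simpa only [he, inner_sub_right, inner_smul_right, one_mul] using hgroup.fun_sub hlin
    exact Complex.reCLM.hasFDerivAt.comp_hasDerivAt t hdiff
  have hmvt := (convex_Icc a b).image_sub_le_mul_sub_of_deriv_le
    (f := fun s => (inner ℂ w (e s)).re) (C := ‖w‖ * B)
    (Complex.continuous_re.comp_continuousOn (continuousOn_const.inner he_cont))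
    (fun t ht => (he_deriv t (by rwa [interior_Icc] at ht)).differentiableAt.differentiableWithinAt)
    (fun t ht => by
      rw [interior_Icc] at ht
      rw [(he_deriv t ht).deriv]
      exact (re_inner_le_norm (𝕜 := ℂ) _ _).trans (by gcongr; exact hB t ht))
    a (left_mem_Icc.2 hab) b (right_mem_Icc.2 hab) hab
  rw [← Complex.sub_re, ← inner_sub_right] at hmvt
  have hdiff : e b - e a = graphGroup G (a - b) (v b) - v a - ((b - a : ℝ) : ℂ) • c := by
    simp [he, graphGroup_zero hR, sub_right_comm]
  rwa [hdiff] at hmvt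

lemma norm_graphGroup_sub_sub_smul_le {v N : ℝ → H} {c : H} {a b B : ℝ} (hab : a ≤ b)
    (hv : ContinuousOn v (Icc a b))
    (hd : ∀ w f, GraphLaplacian G w f → ∀ t ∈ Ioo a b,
      HasDerivAt (fun s => inner ℂ w (v s)) (Complex.I * inner ℂ f (v t) + inner ℂ w (N t)) t)
    (hB : ∀ t ∈ Ioo a b, ‖graphGroup G (a - t) (N t) - c‖ ≤ B) :
    ‖graphGroup G (a - b) (v b) - v a - ((b - a : ℝ) : ℂ) • c‖ ≤ B * (b - a) := by
  rcases hab.eq_or_lt with rfl | hlt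
  · simp [graphGroup_zero hR]
  set x := graphGroup G (a - b) (v b) - v a - ((b - a : ℝ) : ℂ) • c
  have hinner (w : H) : (inner ℂ w x).re ≤ ‖w‖ * B * (b - a) :=
    hR.denseRange.induction_on (p := fun w => (inner ℂ w x).re ≤ ‖w‖ * B * (b - a)) w
      (isClosed_le (Complex.continuous_re.comp (by fun_prop)) (by fun_prop))
      fun k => re_inner_graphGroup_sub_le hR hab hv hd hB (graphLaplacian_graphResolvent G k)
  have hB0 : 0 ≤ B := (norm_nonneg _).trans (hB ((a + b) / 2) ⟨by linarith, by linarith⟩)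
  have hsq : ‖x‖ * ‖x‖ ≤ ‖x‖ * (B * (b - a)) := by
    rw [← mul_assoc, ← sq, ← inner_self_eq_norm_sq (𝕜 := ℂ)]
    exact hinner x
  rcases (norm_nonneg x).eq_or_lt with h0 | h0
  · rw [← h0]; exact mul_nonneg hB0 (sub_nonneg.2 hab)
  · exact le_of_mul_le_mul_left hsq h0

lemma eq_graphGroup_of_weak {v : ℝ → H} (hv : Continuous v)
    (hd : ∀ w f, GraphLaplacian G w f → ∀ t,
      HasDerivAt (fun s => inner ℂ w (v s)) (Complex.I * inner ℂ f (v t)) t) (t : ℝ) :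
    v t = graphGroup G t (v 0) := by
  have hflow {a b : ℝ} (hab : a ≤ b) : graphGroup G (a - b) (v b) = v a := by
    have := norm_graphGroup_sub_sub_smul_le (N := 0) (c := 0) (B := 0) hR hab hv.continuousOn
      (fun w f h t _ => by simpa using hd w f h t) (fun _ _ => by simp)
    simpa [sub_eq_zero] using this
  rcases le_total t 0 with ht | ht
  · rw [← hflow ht, sub_zero]
  · rw [← hflow ht, ← graphGroup_add hR, zero_sub, add_neg_cancel, graphGroup_zero hR]

end GradientGraph

/-! ### Test functions -/

lemma partialDeriv_add {d : ℕ} {ψ χ : Space d → ℂ} (hψ : Differentiable ℝ ψ)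
    (hχ : Differentiable ℝ χ) (j : Fin d) :
    partialDeriv j (fun x => ψ x + χ x) = fun x => partialDeriv j ψ x + partialDeriv j χ x := by
  ext x
  simp only [partialDeriv, fderiv_fun_add (hψ x) (hχ x), add_apply]

lemma partialDeriv_const_mul {d : ℕ} {ψ : Space d → ℂ} (hψ : Differentiable ℝ ψ) (c : ℂ)
    (j : Fin d) : partialDeriv j (fun x => c * ψ x) = fun x => c * partialDeriv j ψ x := by
  ext x
  simp only [partialDeriv, fderiv_const_mul (hψ x), FunLike.coe_smul, Pi.smul_apply, smul_eq_mul]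

lemma partialDeriv_conj {d : ℕ} {ψ : Space d → ℂ} (hψ : Differentiable ℝ ψ) (j : Fin d) :
    partialDeriv j (fun x => starRingEnd ℂ (ψ x))
      = fun x => starRingEnd ℂ (partialDeriv j ψ x) := by
  ext x
  exact DFunLike.congr_fun
    ((Complex.conjCLE : ℂ →L[ℝ] ℂ).hasFDerivAt.comp x (hψ x).hasFDerivAt).fderiv _

lemma partialDeriv_mul {d : ℕ} {ψ χ : Space d → ℂ} (hψ : Differentiable ℝ ψ)
    (hχ : Differentiable ℝ χ) (j : Fin d) (x : Space d) :
    partialDeriv j (fun y => ψ y * χ y) x =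
      partialDeriv j ψ x * χ x + ψ x * partialDeriv j χ x := by
  have h : HasFDerivAt (fun y => ψ y * χ y) (ψ x • fderiv ℝ χ x + χ x • fderiv ℝ ψ x) x :=
    (hψ x).hasFDerivAt.mul (hχ x).hasFDerivAt
  rw [partialDeriv, h.fderiv]
  simp [partialDeriv]
  ring

lemma contDiff_partialDeriv {d : ℕ} {ψ : Space d → ℂ} (hψ : ContDiff ℝ ∞ ψ) (j : Fin d) :
    ContDiff ℝ ∞ (partialDeriv j ψ) :=
  (hψ.fderiv_right (m := ∞) le_rfl).clm_apply contDiff_const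

lemma laplacian_conj {d : ℕ} (ψ : Space d → ℂ) :
    Δ (fun x => starRingEnd ℂ (ψ x)) = fun x => starRingEnd ℂ ((Δ ψ) x) :=
  InnerProductSpace.laplacian_CLE_comp_left (l := Complex.conjCLE) (f := ψ)

lemma laplacian_eq_sum_partialDeriv {d : ℕ} {ψ : Space d → ℂ} (hψ : ContDiff ℝ ∞ ψ) :
    Δ ψ = fun x => ∑ j, partialDeriv j (partialDeriv j ψ) x := by
  ext x
  have hdiff : DifferentiableAt ℝ (fderiv ℝ ψ) x :=
    ((hψ.fderiv_right (m := ∞) le_rfl).differentiable (by simp)) x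
  rw [InnerProductSpace.laplacian_eq_iteratedFDeriv_orthonormalBasis ψ
    (EuclideanSpace.basisFun (Fin d) ℝ)]
  refine Finset.sum_congr rfl fun j _ => ?_
  unfold partialDeriv
  rw [iteratedFDeriv_two_apply, fderiv_clm_apply hdiff (differentiableAt_const _)]
  simp

lemma norm_fderiv_le_sum_partialDeriv {d : ℕ} (ψ : Space d → ℂ) (x : Space d) :
    ‖fderiv ℝ ψ x‖ ≤ ∑ j, ‖partialDeriv j ψ x‖ := by
  refine ContinuousLinearMap.opNorm_le_bound _ (by positivity) fun v => ?_
  have hv : v = ∑ j, v j • EuclideanSpace.single j (1 : ℝ) := by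
    simpa using ((EuclideanSpace.basisFun (Fin d) ℝ).sum_repr v).symm
  conv_lhs => rw [hv, map_sum]
  rw [Finset.sum_mul]
  refine (norm_sum_le _ _).trans (Finset.sum_le_sum fun j _ => ?_)
  rw [map_smul, norm_smul, mul_comm]
  exact mul_le_mul_of_nonneg_left (PiLp.norm_apply_le v j) (norm_nonneg _)

lemma norm_partialDeriv_comp_le {d : ℕ} {F : ℂ → ℂ} {K : NNReal} (hF : LipschitzWith K F)
    (hF' : Differentiable ℝ F) {ψ : Space d → ℂ} (hψ : Differentiable ℝ ψ) (j : Fin d)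
    (x : Space d) : ‖partialDeriv j (F ∘ ψ) x‖ ≤ K * ‖partialDeriv j ψ x‖ := by
  unfold partialDeriv
  rw [fderiv_comp x (hF' _) (hψ x), ContinuousLinearMap.comp_apply]
  exact (fderiv ℝ F (ψ x)).le_of_opNorm_le (norm_fderiv_le_of_lipschitz ℝ hF) _

/-- The compact box `∏ [a i, b i]` in Euclidean space, the closure of a nonempty periodic cell. -/
def closedBox {d : ℕ} (a b : Fin d → ℝ) : Set (Space d) := WithLp.toLp 2 '' Icc a b

lemma isCompact_closedBox {d : ℕ} (a b : Fin d → ℝ) : IsCompact (closedBox a b) :=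
  isCompact_Icc.image (PiLp.continuous_toLp 2 _)

lemma mem_closedBox {d : ℕ} {a b : Fin d → ℝ} {x : Space d} :
    x ∈ closedBox a b ↔ ∀ i, a i ≤ x i ∧ x i ≤ b i :=
  ⟨fun ⟨_, hy, hyx⟩ i => hyx ▸ ⟨hy.1 i, hy.2 i⟩,
    fun h => ⟨WithLp.ofLp x, ⟨fun i => (h i).1, fun i => (h i).2⟩, rfl⟩⟩

lemma setIntegral_openBox {d : ℕ} (a b : Fin d → ℝ) (f : Space d → ℂ) :
    ∫ x in {x : Space d | ∀ i, a i < x i ∧ x i < b i}, f x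
      = ∫ y in Icc a b, f (WithLp.toLp 2 y) := by
  have hpre : WithLp.toLp 2 ⁻¹' {x : Space d | ∀ i, a i < x i ∧ x i < b i}
      = Set.pi univ fun i => Ioo (a i) (b i) := by
    ext y; simp
  rw [← (PiLp.volume_preserving_toLp (Fin d)).setIntegral_preimage_emb
    (MeasurableEquiv.toLp 2 (Fin d → ℝ)).measurableEmbedding, hpre, volume_pi]
  exact setIntegral_congr_set Measure.univ_pi_Ioo_ae_eq_Icc

lemma integral_partialDeriv_of_hasCompactSupport {d : ℕ} {ψ : Space d → ℂ} (hψ : ContDiff ℝ 1 ψ)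
    (hs : HasCompactSupport ψ) (j : Fin d) : ∫ x, partialDeriv j ψ x = 0 := by
  have hdiff : Differentiable ℝ ψ := hψ.differentiable one_ne_zero
  have hint : Integrable (partialDeriv j ψ) :=
    ((hψ.continuous_fderiv one_ne_zero).clm_apply continuous_const).integrable_of_hasCompactSupport
      ((hs.fderiv ℝ).comp_left (g := fun L : Space d →L[ℝ] ℂ => L (EuclideanSpace.single j 1)) rfl)
  have hparts := integral_mul_fderiv_eq_neg_fderiv_mul_of_integrable (μ := volume)
    (f := fun _ : Space d => (1 : ℂ)) (g := ψ) (v := EuclideanSpace.single j 1)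
    (by simp) (by simpa using! hint)
    (by simpa using! hψ.continuous.integrable_of_hasCompactSupport hs)
    (fun x _ => by fun_prop) (fun x _ => hdiff x)
  simpa using! hparts

lemma setIntegral_Icc_fderiv_single {E : Type*} [NormedAddCommGroup E] [NormedSpace ℝ E] {n : ℕ}
    {a b : Fin (n + 1) → ℝ} (hab : a ≤ b) {φ : (Fin (n + 1) → ℝ) → E} (hφ : ContDiff ℝ 1 φ)
    (j : Fin (n + 1)) :
    ∫ y in Icc a b, fderiv ℝ φ y (Pi.single j 1) =
      (∫ x in Icc (a ∘ j.succAbove) (b ∘ j.succAbove), φ (j.insertNth (b j) x)) -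
        ∫ x in Icc (a ∘ j.succAbove) (b ∘ j.succAbove), φ (j.insertNth (a j) x) := by
  let f' (i : Fin (n + 1)) (y : Fin (n + 1) → ℝ) : (Fin (n + 1) → ℝ) →L[ℝ] E :=
    if i = j then fderiv ℝ φ y else 0
  have hdiv (y : Fin (n + 1) → ℝ) :
      ∑ i, f' i y (Pi.single i 1) = fderiv ℝ φ y (Pi.single j 1) := by
    rw [Finset.sum_eq_single j (fun i _ hi => by simp [f', hi]) (by simp)]
    simp [f']
  have hdivergence := integral_divergence_of_hasFDerivAt_off_countable' a b hab
    (fun i y => if i = j then φ y else 0) f' ∅ countable_empty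
    (fun i => by
      split_ifs
      exacts [hφ.continuous.continuousOn, continuousOn_const])
    (fun y _ i => by
      simp only [f']
      split_ifs
      exacts [(hφ.differentiable one_ne_zero y).hasFDerivAt, hasFDerivAt_const _ _])
    (by
      simp_rw [hdiv]
      exact ((hφ.continuous_fderiv one_ne_zero).clm_apply
        continuous_const).continuousOn.integrableOn_compact isCompact_Icc)
  simp_rw [hdiv] at hdivergence
  rw [hdivergence, Finset.sum_eq_single j (fun i _ hi => by simp [hi]) (by simp)]
  simp

lemma setIntegral_Icc_partialDeriv_of_periodic {d : ℕ} {a b : Fin d → ℝ} (hab : a ≤ b)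
    {ψ : Space d → ℂ} (hψ : ContDiff ℝ 1 ψ) {j : Fin d}
    (hper : ∀ x, ψ (x + EuclideanSpace.single j (b j - a j)) = ψ x) :
    ∫ y in Icc a b, partialDeriv j ψ (WithLp.toLp 2 y) = 0 := by
  obtain ⟨n, rfl⟩ : ∃ n, d = n + 1 := ⟨d - 1, by have := j.pos; omega⟩
  let L := (PiLp.continuousLinearEquiv 2 ℝ fun _ : Fin (n + 1) => ℝ).symm
  have hchain (y : Fin (n + 1) → ℝ) :
      partialDeriv j ψ (WithLp.toLp 2 y) = fderiv ℝ (ψ ∘ L) y (Pi.single j 1) := by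
    rw [L.comp_right_fderiv]
    rfl
  have hface (x : Fin n → ℝ) : ψ (L (j.insertNth (b j) x)) = ψ (L (j.insertNth (a j) x)) := by
    rw [← hper (L (j.insertNth (a j) x))]
    congr 1
    ext k
    refine Fin.succAboveCases j ?_ (fun k => ?_) k <;> simp [L]
  simp_rw [hchain]
  rw [setIntegral_Icc_fderiv_single hab (hψ.comp L.contDiff), sub_eq_zero]
  simp only [Function.comp_apply, hface]

namespace Setting

variable {d : ℕ} {D : Setting d} {ψ χ : Space d → ℂ}

lemma isOpen_carrier (D : Setting d) : IsOpen D.carrier := by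
  cases D with
  | whole => exact isOpen_univ
  | dirichlet U h _ _ => exact h
  | periodic a b _ =>
    simp only [carrier, ofPred_forall, ofPred_and]
    exact isOpen_iInter_of_finite fun i => (isOpen_lt (by fun_prop) (by fun_prop)).inter
      (isOpen_lt (by fun_prop) (by fun_prop))

lemma measurableSet_carrier (D : Setting d) : MeasurableSet D.carrier :=
  D.isOpen_carrier.measurableSet

lemma periodic_carrier_subset (a b : Fin d → ℝ) (h : ∀ i, a i < b i) :
    (periodic a b h).carrier ⊆ closedBox a b := fun _ hx =>
  mem_closedBox.2 fun i => ⟨(hx i).1.le, (hx i).2.le⟩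

lemma volume_periodic_carrier_lt_top (a b : Fin d → ℝ) (h : ∀ i, a i < b i) :
    volume (periodic a b h).carrier < ⊤ :=
  (measure_mono (periodic_carrier_subset a b h)).trans_lt (isCompact_closedBox a b).measure_lt_top

namespace IsTest

lemma contDiff (hψ : D.IsTest ψ) : ContDiff ℝ ∞ ψ := by
  cases D <;> exact hψ.1

lemma continuous (hψ : D.IsTest ψ) : Continuous ψ := hψ.contDiff.continuous

lemma differentiable (hψ : D.IsTest ψ) : Differentiable ℝ ψ := hψ.contDiff.differentiable (by simp)

lemma comp (hψ : D.IsTest ψ) {F : ℂ → ℂ} (hF : ContDiff ℝ ∞ F) (h0 : F 0 = 0) :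
    D.IsTest (F ∘ ψ) := by
  cases D with
  | whole => exact ⟨hF.comp hψ.1, hψ.2.comp_left h0⟩
  | dirichlet U _ _ _ =>
    exact ⟨hF.comp hψ.1, hψ.2.1.comp_left h0, (tsupport_comp_subset h0 ψ).trans hψ.2.2⟩
  | periodic a b _ => exact ⟨hF.comp hψ.1, fun i x => congrArg F (hψ.2 i x)⟩

lemma const_mul (hψ : D.IsTest ψ) (c : ℂ) : D.IsTest (fun x => c * ψ x) :=
  hψ.comp (F := fun z => c * z) (by fun_prop) (mul_zero c)

lemma conj (hψ : D.IsTest ψ) : D.IsTest (fun x => starRingEnd ℂ (ψ x)) :=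
  hψ.comp (F := fun z => starRingEnd ℂ z) Complex.conjCLE.contDiff (map_zero _)

lemma add (hψ : D.IsTest ψ) (hχ : D.IsTest χ) : D.IsTest (fun x => ψ x + χ x) := by
  cases D with
  | whole => exact ⟨hψ.1.add hχ.1, hψ.2.add hχ.2⟩
  | dirichlet U _ _ _ =>
    exact ⟨hψ.1.add hχ.1, hψ.2.1.add hχ.2.1,
      (tsupport_add ψ χ).trans (union_subset hψ.2.2 hχ.2.2)⟩
  | periodic a b _ => exact ⟨hψ.1.add hχ.1, fun i x => congrArg₂ (· + ·) (hψ.2 i x) (hχ.2 i x)⟩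

lemma mul (hψ : D.IsTest ψ) (hχ : D.IsTest χ) : D.IsTest (fun x => ψ x * χ x) := by
  cases D with
  | whole => exact ⟨hψ.1.mul hχ.1, hψ.2.mul_right⟩
  | dirichlet U _ _ _ =>
    exact ⟨hψ.1.mul hχ.1, hψ.2.1.mul_right, (tsupport_mul_subset_left).trans hψ.2.2⟩
  | periodic a b _ => exact ⟨hψ.1.mul hχ.1, fun i x => congrArg₂ (· * ·) (hψ.2 i x) (hχ.2 i x)⟩

lemma zero (D : Setting d) : D.IsTest (fun _ => 0) := by
  cases D with
  | whole => exact ⟨contDiff_const, HasCompactSupport.zero⟩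
  | dirichlet U _ _ _ =>
    refine ⟨contDiff_const, HasCompactSupport.zero, ?_⟩
    rw [tsupport_eq_empty_iff.2 (rfl : (fun _ : Space d => (0 : ℂ)) = 0)]
    exact empty_subset _
  | periodic a b _ => exact ⟨contDiff_const, fun _ _ => rfl⟩

protected lemma partialDeriv (hψ : D.IsTest ψ) (j : Fin d) : D.IsTest (partialDeriv j ψ) := by
  have hc := contDiff_partialDeriv hψ.contDiff j
  have hsupport : Function.support (_root_.partialDeriv j ψ) ⊆ Function.support (fderiv ℝ ψ) :=
    fun x hx h => hx (by simp [_root_.partialDeriv, h])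
  have hsub : tsupport (_root_.partialDeriv j ψ) ⊆ tsupport ψ :=
    (closure_mono hsupport).trans (tsupport_fderiv_subset ℝ)
  cases D with
  | whole => exact ⟨hc, hψ.2.of_isClosed_subset (isClosed_tsupport _) hsub⟩
  | dirichlet U _ _ _ =>
    exact ⟨hc, hψ.2.1.of_isClosed_subset (isClosed_tsupport _) hsub, hsub.trans hψ.2.2⟩
  | periodic a b _ =>
    refine ⟨hc, fun i x => ?_⟩
    unfold _root_.partialDeriv
    rw [← fderiv_comp_add_right]
    simp_rw [hψ.2 i]

lemma memLp (hψ : D.IsTest ψ) (p : ℝ≥0∞) : MemLp ψ p D.meas := by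
  cases D with
  | whole => exact (hψ.continuous.memLp_of_hasCompactSupport hψ.2).restrict _
  | dirichlet U _ _ _ => exact (hψ.continuous.memLp_of_hasCompactSupport hψ.2.1).restrict _
  | periodic a b h =>
    obtain ⟨C, hC⟩ := (isCompact_closedBox a b).exists_bound_of_continuousOn
      hψ.continuous.continuousOn
    have : IsFiniteMeasure (periodic a b h).meas :=
      isFiniteMeasure_restrict.2 (volume_periodic_carrier_lt_top a b h).ne
    exact MemLp.of_bound hψ.continuous.aestronglyMeasurable C
      ((ae_restrict_iff' (measurableSet_carrier _)).2 (Filter.Eventually.of_forall fun x hx =>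
        hC x (periodic_carrier_subset a b h hx)))

lemma integrable (hψ : D.IsTest ψ) : Integrable ψ D.meas := memLp_one_iff_integrable.1 (hψ.memLp 1)

lemma integral_partialDeriv (hψ : D.IsTest ψ) (j : Fin d) :
    ∫ x, partialDeriv j ψ x ∂D.meas = 0 := by
  have hC1 : ContDiff ℝ 1 ψ := hψ.contDiff.of_le (by simp)
  cases D with
  | whole =>
    simpa [meas, carrier] using integral_partialDeriv_of_hasCompactSupport hC1 hψ.2 j
  | dirichlet U _ _ _ =>
    rw [← integral_partialDeriv_of_hasCompactSupport hC1 hψ.2.1 j]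
    refine setIntegral_eq_integral_of_forall_compl_eq_zero fun x hx => ?_
    have hx' : x ∉ tsupport (fderiv ℝ ψ) := fun h => hx (hψ.2.2 (tsupport_fderiv_subset ℝ h))
    simp [partialDeriv, image_eq_zero_of_notMem_tsupport hx']
  | periodic a b h =>
    exact (setIntegral_openBox a b _).trans
      (setIntegral_Icc_partialDeriv_of_periodic (fun i => (h i).le) hC1 (hψ.2 j))

lemma integral_mul_partialDeriv (hψ : D.IsTest ψ) (hχ : D.IsTest χ) (j : Fin d) :
    ∫ x, ψ x * partialDeriv j χ x ∂D.meas = -∫ x, partialDeriv j ψ x * χ x ∂D.meas := by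
  have h := (hψ.mul hχ).integral_partialDeriv j
  simp_rw [partialDeriv_mul hψ.differentiable hχ.differentiable] at h
  rw [integral_add ((hψ.partialDeriv j).mul hχ).integrable (hψ.mul (hχ.partialDeriv j)).integrable]
    at h
  exact (neg_eq_of_add_eq_zero_right h).symm

protected lemma sum {ι : Type*} (s : Finset ι) {ψ : ι → Space d → ℂ} (hψ : ∀ i, D.IsTest (ψ i)) :
    D.IsTest (fun x => ∑ i ∈ s, ψ i x) := by
  classical
  induction s using Finset.induction_on with
  | empty => simpa using zero D
  | insert i s hi ih => simpa only [Finset.sum_insert hi] using (hψ i).add ih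

protected lemma laplacian (hψ : D.IsTest ψ) : D.IsTest (Δ ψ) := by
  rw [laplacian_eq_sum_partialDeriv hψ.contDiff]
  exact .sum _ fun j => (hψ.partialDeriv j).partialDeriv j

end IsTest

end Setting

/-! ### Density of test functions -/

section Periodize

variable {d : ℕ} {a b : Fin d → ℝ}

/-- The representative modulo the periods `b i - a i` of a point of `ℝ^d` in the half-open box
`∏ [a i, b i)`; composing with it extends a function on the box periodically. -/
def wrapBox (h : ∀ i, a i < b i) (x : Space d) : Space d :=
  WithLp.toLp 2 fun i => toIcoMod (sub_pos.2 (h i)) (a i) (x i)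

lemma wrapBox_add_single (h : ∀ i, a i < b i) (i : Fin d) (x : Space d) :
    wrapBox h (x + EuclideanSpace.single i (b i - a i)) = wrapBox h x := by
  ext j
  rcases eq_or_ne j i with rfl | hj
  · simp [wrapBox]
  · simp [wrapBox, hj]

lemma wrapBox_of_mem (h : ∀ i, a i < b i) {x : Space d} (hx : ∀ i, a i < x i ∧ x i < b i) :
    wrapBox h x = x := by
  ext i
  exact (toIcoMod_eq_self _).2 ⟨(hx i).1.le, by linarith [(hx i).2]⟩

lemma wrapBox_eventuallyEq_sub (h : ∀ i, a i < b i) {x : Space d}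
    (hx : ∀ i, ¬ x i ≡ a i [PMOD (b i - a i)]) :
    ∃ c, wrapBox h =ᶠ[𝓝 x] fun y => y - c := by
  refine ⟨WithLp.toLp 2 fun i => toIcoDiv (sub_pos.2 (h i)) (a i) (x i) • (b i - a i), ?_⟩
  have hdiv : ∀ i, ∀ᶠ y : Space d in 𝓝 x,
      toIcoDiv (sub_pos.2 (h i)) (a i) (y i) = toIcoDiv (sub_pos.2 (h i)) (a i) (x i) := fun i =>
    (PiLp.continuous_apply 2 (fun _ => ℝ) i).continuousAt.eventually
      (eventuallyEq_toIcoDiv_nhds (sub_pos.2 (h i)) (a i) (hx i))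
  filter_upwards [Filter.eventually_all.2 hdiv] with y hy
  ext i
  change toIcoMod (sub_pos.2 (h i)) (a i) (y i) = y i - _
  rw [toIcoMod, hy i]
  rfl

lemma eventually_toIcoMod_notMem {p : ℝ} (hp : 0 < p) {c t : ℝ} (ht : c ≡ t [PMOD p])
    {S : Set ℝ} (hS : IsClosed S) (hc : c ∉ S) (hcp : c + p ∉ S) :
    ∀ᶠ s in 𝓝 t, toIcoMod hp c s ∉ S := by
  rw [← nhdsLT_sup_nhdsGE, Filter.eventually_sup]
  constructor
  · have hlim : Tendsto (fun s => s - toIocDiv hp c t • p) (𝓝[<] t) (𝓝 (c + p)) := by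
      rw [← (AddCommGroup.modEq_iff_toIocMod_eq_right hp).1 ht]
      exact ((continuous_id.sub continuous_const).tendsto t).mono_left nhdsWithin_le_nhds
    filter_upwards [hlim.eventually (hS.isOpen_compl.mem_nhds hcp),
      eventuallyEq_toIcoDiv_nhdsLT hp c t] with s hs hdiv
    rwa [toIcoMod, hdiv]
  · have hlim := continuousWithinAt_toIcoMod_Ici hp c t
    rw [ContinuousWithinAt, (AddCommGroup.modEq_iff_toIcoMod_eq_left hp).1 ht] at hlim
    exact hlim.eventually (hS.isOpen_compl.mem_nhds hc)

lemma contDiff_comp_wrapBox (h : ∀ i, a i < b i) {χ : Space d → ℂ} {n : WithTop ℕ∞}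
    (hχ : ContDiff ℝ n χ) (hc : HasCompactSupport χ)
    (hs : tsupport χ ⊆ {x | ∀ i, a i < x i ∧ x i < b i}) :
    ContDiff ℝ n (χ ∘ wrapBox h) := by
  refine contDiff_iff_contDiffAt.2 fun x => ?_
  by_cases hx : ∀ i, ¬ x i ≡ a i [PMOD (b i - a i)]
  · obtain ⟨c, hwrap⟩ := wrapBox_eventuallyEq_sub h hx
    exact (hχ.comp (contDiff_id.sub contDiff_const)).contDiffAt.congr_of_eventuallyEq
      (hwrap.fun_comp χ)
  · push Not at hx
    obtain ⟨i, hi⟩ := hx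
    -- near a lattice hyperplane the `i`-th coordinate of `wrapBox` is close to `a i` or to `b i`
    have hcoord : Continuous fun y : Space d => y i := PiLp.continuous_apply 2 _ i
    have hnot := hcoord.continuousAt.eventually (eventually_toIcoMod_notMem (sub_pos.2 (h i))
      hi.symm (hc.isCompact.image hcoord).isClosed
      (fun ⟨y, hy, hya⟩ => (hs hy i).1.ne' hya)
      (fun ⟨y, hy, hyb⟩ => (hs hy i).2.ne (hyb.trans (by ring))))
    refine contDiffAt_const (c := 0).congr_of_eventuallyEq ?_
    filter_upwards [hnot] with y hy
    exact image_eq_zero_of_notMem_tsupport (f := χ) fun hmem => hy ⟨wrapBox h y, hmem, rfl⟩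

end Periodize

namespace Setting

variable {d : ℕ} {D : Setting d}

lemma exists_isTest_eqOn {χ : Space d → ℂ} (hχ : ContDiff ℝ ∞ χ) (hc : HasCompactSupport χ)
    (hs : tsupport χ ⊆ D.carrier) : ∃ ψ, D.IsTest ψ ∧ EqOn ψ χ D.carrier := by
  cases D with
  | whole => exact ⟨χ, ⟨hχ, hc⟩, fun _ _ => rfl⟩
  | dirichlet U _ _ _ => exact ⟨χ, ⟨hχ, hc, hs⟩, fun _ _ => rfl⟩
  | periodic a b h =>
    refine ⟨χ ∘ wrapBox h, ⟨contDiff_comp_wrapBox h hχ hc hs, fun i x => ?_⟩, fun x hx => ?_⟩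
    · exact congrArg χ (wrapBox_add_single h i x)
    · exact congrArg χ (wrapBox_of_mem h hx)

lemma eq_zero_of_integral_isTest (g : D.L2) (h : ∀ ψ, D.IsTest ψ → ∫ x, g x * ψ x ∂D.meas = 0) :
    g = 0 := by
  have hloc : LocallyIntegrable g D.meas := (Lp.memLp g).locallyIntegrable (by norm_num)
  have hae := D.isOpen_carrier.ae_eq_zero_of_integral_contDiff_smul_eq_zero (μ := D.meas) (f := g)
    (hloc.locallyIntegrableOn _) fun χ hχ hc hs => by
      obtain ⟨ψ, hψ, heq⟩ := exists_isTest_eqOn (D := D) (χ := fun x => (χ x : ℂ))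
        (Complex.ofRealCLM.contDiff.comp hχ) (hc.comp_left (g := fun r : ℝ => (r : ℂ)) (by simp))
        ((tsupport_comp_subset (g := fun r : ℝ => (r : ℂ)) (by simp) χ).trans hs)
      rw [← h ψ hψ]
      refine setIntegral_congr_fun D.measurableSet_carrier fun x hx => ?_
      rw [heq hx, mul_comm]
      exact Complex.real_smul
  rw [Lp.eq_zero_iff_ae_eq_zero]
  filter_upwards [hae, ae_restrict_mem D.measurableSet_carrier] with x hx hmem
  exact hx hmem

/-! ### The graph of the gradient -/

/-- The class in `L²(Ω)` of a test function. -/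
def testL2 {ψ : Space d → ℂ} (hψ : D.IsTest ψ) : D.L2 := (hψ.memLp 2).toLp ψ

lemma testL2_congr {ψ χ : Space d → ℂ} (hψ : D.IsTest ψ) (hχ : D.IsTest χ) (h : ψ = χ) :
    testL2 hψ = testL2 hχ := by
  subst h
  rfl

lemma coeFn_testL2 {ψ : Space d → ℂ} (hψ : D.IsTest ψ) : testL2 hψ =ᵐ[D.meas] ψ :=
  MemLp.coeFn_toLp _

lemma inner_testL2_conj {ψ : Space d → ℂ} (hψ : D.IsTest ψ) (u : D.L2) :
    inner ℂ (testL2 hψ.conj) u = ∫ x, u x * ψ x ∂D.meas := by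
  rw [L2.inner_def]
  refine integral_congr_ae ?_
  filter_upwards [coeFn_testL2 hψ.conj] with x hx
  simp [hx]

lemma inner_testL2 {ψ : Space d → ℂ} (hψ : D.IsTest ψ) (u : D.L2) :
    inner ℂ (testL2 hψ) u = ∫ x, u x * starRingEnd ℂ (ψ x) ∂D.meas := by
  rw [L2.inner_def]
  refine integral_congr_ae ?_
  filter_upwards [coeFn_testL2 hψ] with x hx
  simp [hx]

lemma testL2_sum (s : Finset (Fin d)) {ψ : Fin d → Space d → ℂ} (hψ : ∀ j, D.IsTest (ψ j)) :
    testL2 (.sum s hψ) = ∑ j ∈ s, testL2 (hψ j) := by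
  refine Lp.ext ?_
  filter_upwards [coeFn_testL2 (.sum s hψ), Lp.coeFn_finsetSum s fun j => testL2 (hψ j),
    ae_all_iff.2 fun j => coeFn_testL2 (hψ j)] with x hsum hcoe hx
  rw [hsum, hcoe, Finset.sum_apply]
  exact Finset.sum_congr rfl fun j _ => (hx j).symm

lemma hasWeakDeriv_iff {j : Fin d} {u g : D.L2} : D.HasWeakDeriv j u g ↔
    ∀ ψ (hψ : D.IsTest ψ), inner ℂ (testL2 (hψ.partialDeriv j)) u = -inner ℂ (testL2 hψ) g := by
  constructor <;> intro h ψ hψ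
  · rw [inner_testL2, inner_testL2, ← h _ hψ.conj, partialDeriv_conj hψ.differentiable]
  · have := h _ hψ.conj
    rw [inner_testL2, inner_testL2, partialDeriv_conj hψ.differentiable] at this
    simpa using this

lemma eq_zero_of_inner_testL2 (g : D.L2) (h : ∀ ψ (hψ : D.IsTest ψ), inner ℂ (testL2 hψ) g = 0) :
    g = 0 :=
  eq_zero_of_integral_isTest g fun ψ hψ => by rw [← inner_testL2_conj hψ]; exact h _ _

lemma HasWeakDeriv.unique {j : Fin d} {u g g' : D.L2} (h : D.HasWeakDeriv j u g)
    (h' : D.HasWeakDeriv j u g') : g = g' := by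
  refine sub_eq_zero.1 (eq_zero_of_inner_testL2 _ fun ψ hψ => ?_)
  rw [inner_sub_right, sub_eq_zero]
  exact neg_injective ((hasWeakDeriv_iff.1 h ψ hψ).symm.trans (hasWeakDeriv_iff.1 h' ψ hψ))

lemma hasWeakDeriv_testL2 {ψ : Space d → ℂ} (hψ : D.IsTest ψ) (j : Fin d) :
    D.HasWeakDeriv j (testL2 hψ) (testL2 (hψ.partialDeriv j)) := by
  have hcoe {ψ : Space d → ℂ} (hψ : D.IsTest ψ) (χ : Space d → ℂ) :
      ∫ x, testL2 hψ x * χ x ∂D.meas = ∫ x, ψ x * χ x ∂D.meas :=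
    integral_congr_ae (by filter_upwards [coeFn_testL2 hψ] with x hx; rw [hx])
  intro χ hχ
  rw [hcoe, hcoe, hψ.integral_mul_partialDeriv hχ]

/-- The Hilbert space `L²(Ω) × L²(Ω)^d` in which the graph of the gradient lives. -/
abbrev Pairs (D : Setting d) : Type := WithLp 2 (D.L2 × PiLp 2 fun _ : Fin d => D.L2)

/-- The point `(ψ, ∇ψ)` of the graph of the gradient over a test function. -/
def testPair {ψ : Space d → ℂ} (hψ : D.IsTest ψ) : D.Pairs :=
  WithLp.toLp 2 (testL2 hψ, WithLp.toLp 2 fun j => testL2 (hψ.partialDeriv j))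

lemma testPair_add {ψ χ : Space d → ℂ} (hψ : D.IsTest ψ) (hχ : D.IsTest χ) :
    testPair (hψ.add hχ) = testPair hψ + testPair hχ := by
  have hgrad (j : Fin d) : testL2 ((hψ.add hχ).partialDeriv j)
      = testL2 (hψ.partialDeriv j) + testL2 (hχ.partialDeriv j) :=
    testL2_congr _ ((hψ.partialDeriv j).add (hχ.partialDeriv j))
      (partialDeriv_add hψ.differentiable hχ.differentiable j)
  simp only [testPair, hgrad]
  rfl

lemma testPair_const_mul {ψ : Space d → ℂ} (hψ : D.IsTest ψ) (c : ℂ) :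
    testPair (hψ.const_mul c) = c • testPair hψ := by
  have hgrad (j : Fin d) : testL2 ((hψ.const_mul c).partialDeriv j)
      = c • testL2 (hψ.partialDeriv j) :=
    testL2_congr _ ((hψ.partialDeriv j).const_mul c)
      (partialDeriv_const_mul hψ.differentiable c j)
  simp only [testPair, hgrad]
  rfl

variable (D) in
/-- The graph of the gradient on the test functions. -/
def testGraph : Submodule ℂ D.Pairs where
  carrier := {p | ∃ (ψ : Space d → ℂ) (hψ : D.IsTest ψ), p = testPair hψ}
  zero_mem' := ⟨_, (IsTest.zero D).const_mul 0,
    ((testPair_const_mul (IsTest.zero D) 0).trans (zero_smul ℂ _)).symm⟩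
  add_mem' := by
    rintro _ _ ⟨ψ, hψ, rfl⟩ ⟨χ, hχ, rfl⟩
    exact ⟨_, hψ.add hχ, (testPair_add hψ hχ).symm⟩
  smul_mem' := by
    rintro c _ ⟨ψ, hψ, rfl⟩
    exact ⟨_, hψ.const_mul c, (testPair_const_mul hψ c).symm⟩

variable (D) in
/-- The graph of the gradient on the energy space, as the closure of `testGraph`. -/
def gradGraph : Submodule ℂ D.Pairs := D.testGraph.topologicalClosure

lemma isClosed_gradGraph : IsClosed (D.gradGraph : Set D.Pairs) :=
  D.testGraph.isClosed_topologicalClosure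

instance : CompleteSpace D.gradGraph := isClosed_gradGraph.completeSpace_coe

lemma testPair_mem {ψ : Space d → ℂ} (hψ : D.IsTest ψ) : testPair hψ ∈ D.gradGraph :=
  D.testGraph.le_topologicalClosure ⟨ψ, hψ, rfl⟩

lemma gradGraph_induction {P : D.Pairs → Prop} (hc : IsClosed {p | P p})
    (h : ∀ ψ (hψ : D.IsTest ψ), P (testPair hψ)) {p : D.Pairs} (hp : p ∈ D.gradGraph) : P p := by
  refine (hc.closure_subset_iff (s := (D.testGraph : Set D.Pairs))).2 ?_ hp
  rintro _ ⟨ψ, hψ, rfl⟩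
  exact h ψ hψ

lemma exists_testPair_tendsto {p : D.Pairs} (hp : p ∈ D.gradGraph) :
    ∃ (ψ : ℕ → Space d → ℂ) (hψ : ∀ n, D.IsTest (ψ n)),
      Filter.Tendsto (fun n => testPair (hψ n)) Filter.atTop (nhds p) := by
  obtain ⟨v, hv, hlim⟩ := mem_closure_iff_seq_limit.1 hp
  choose ψ hψ hv using hv
  exact ⟨ψ, hψ, by rwa [funext hv] at hlim⟩

lemma hasWeakDeriv_of_mem_gradGraph {p : D.Pairs} (hp : p ∈ D.gradGraph) (j : Fin d) :
    D.HasWeakDeriv j p.fst (p.snd j) := by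
  rw [hasWeakDeriv_iff]
  intro χ hχ
  refine gradGraph_induction (P := fun p : D.Pairs => inner ℂ (testL2 (hχ.partialDeriv j)) p.fst
    = -inner ℂ (testL2 hχ) (p.snd j)) (isClosed_eq (by fun_prop) (by fun_prop)) ?_ hp
  intro ψ hψ
  exact hasWeakDeriv_iff.1 (hasWeakDeriv_testL2 hψ j) χ hχ

lemma eLpNorm_sub_lt_iff {ψ : Space d → ℂ} (hψ : D.IsTest ψ) (u : D.L2) {δ : ℝ} (hδ : 0 < δ) :
    eLpNorm (fun x => u x - ψ x) 2 D.meas < ENNReal.ofReal δ ↔ ‖u - testL2 hψ‖ < δ := by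
  have hcongr : eLpNorm (fun x => u x - ψ x) 2 D.meas = eLpNorm (u - testL2 hψ) 2 D.meas := by
    refine eLpNorm_congr_ae ?_
    filter_upwards [Lp.coeFn_sub u (testL2 hψ), coeFn_testL2 hψ] with x hsub hx
    rw [hsub, Pi.sub_apply, hx]
  rw [hcongr, ← ENNReal.ofReal_toReal (Lp.eLpNorm_ne_top (u - testL2 hψ)), ← Lp.norm_def,
    ENNReal.ofReal_lt_ofReal_iff hδ]

lemma norm_pairs_le (p : D.Pairs) : ‖p‖ ≤ ‖p.fst‖ + ∑ j, ‖p.snd j‖ := by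
  have hsnd : ‖p.snd‖ ≤ ∑ j, ‖p.snd j‖ := by
    have hsum : p.snd = ∑ j, WithLp.toLp 2 (Pi.single j (p.snd j)) := by
      ext1 i
      simp [Finset.sum_apply, Pi.single_apply]
    conv_lhs => rw [hsum]
    refine (norm_sum_le _ _).trans (Finset.sum_le_sum fun j _ => ?_)
    exact (PiLp.norm_single 2 (fun _ : Fin d => D.L2) j (p.snd j)).le
  have hnorm : ‖p‖ ≤ ‖p.fst‖ + ‖p.snd‖ := by
    refine le_of_sq_le_sq ?_ (by positivity)
    rw [WithLp.prod_norm_sq_eq_of_L2]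
    nlinarith [norm_nonneg p.fst, norm_nonneg p.snd]
  linarith

lemma memEnergy_iff {u : D.L2} : D.MemEnergy u ↔ ∃ g, WithLp.toLp 2 (u, g) ∈ D.gradGraph := by
  constructor
  · rintro ⟨g, -, happrox⟩
    refine ⟨WithLp.toLp 2 g, Metric.mem_closure_iff.2 fun ε hε => ?_⟩
    have hε' : 0 < ε / (d + 1) := by positivity
    obtain ⟨ψ, hψ, hu, hg⟩ := happrox (ε / (d + 1)) hε'
    refine ⟨testPair hψ, ⟨ψ, hψ, rfl⟩, ?_⟩
    rw [dist_eq_norm]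
    calc ‖WithLp.toLp 2 (u, WithLp.toLp 2 g) - testPair hψ‖
        ≤ ‖u - testL2 hψ‖ + ∑ j, ‖g j - testL2 (hψ.partialDeriv j)‖ := norm_pairs_le _
      _ < ε / (d + 1) + ∑ j : Fin d, ε / (d + 1) :=
          add_lt_add_of_lt_of_le ((eLpNorm_sub_lt_iff hψ u hε').1 hu)
            (Finset.sum_le_sum fun j _ => ((eLpNorm_sub_lt_iff _ (g j) hε').1 (hg j)).le)
      _ = ε := by simp; field_simp; ring
  · rintro ⟨g, hg⟩
    refine ⟨fun j => g j, fun j => hasWeakDeriv_of_mem_gradGraph hg j, fun δ hδ => ?_⟩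
    obtain ⟨_, ⟨ψ, hψ, rfl⟩, hdist⟩ := Metric.mem_closure_iff.1 hg δ hδ
    rw [dist_eq_norm] at hdist
    set q : D.Pairs := WithLp.toLp 2 (u, g) - testPair hψ
    exact ⟨ψ, hψ, (eLpNorm_sub_lt_iff hψ u hδ).2 ((WithLp.norm_fst_le _ q).trans_lt hdist),
      fun j => (eLpNorm_sub_lt_iff (hψ.partialDeriv j) (g j) hδ).2
        (((PiLp.norm_apply_le q.snd j).trans (WithLp.norm_snd_le _ q)).trans_lt hdist)⟩

lemma inner_testL2_laplacian {ψ : Space d → ℂ} (hψ : D.IsTest ψ) {p : D.Pairs}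
    (hp : p ∈ D.gradGraph) :
    inner ℂ (testL2 hψ.laplacian) p.fst = -inner ℂ (testPair hψ).snd p.snd := by
  have hsecond (j : Fin d) := (hψ.partialDeriv j).partialDeriv j
  rw [testL2_congr _ (.sum Finset.univ hsecond) (laplacian_eq_sum_partialDeriv hψ.contDiff),
    testL2_sum _ hsecond, sum_inner, PiLp.inner_apply, ← Finset.sum_neg_distrib]
  exact Finset.sum_congr rfl fun j _ =>
    hasWeakDeriv_iff.1 (hasWeakDeriv_of_mem_gradGraph hp j) _ (hψ.partialDeriv j)

lemma forall_integral_laplacian_iff {w f : D.L2} :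
    (∀ ψ, D.IsTest ψ → ∫ x, w x * (Δ ψ) x ∂D.meas = ∫ x, f x * ψ x ∂D.meas) ↔
      ∀ (ψ) (hψ : D.IsTest ψ), inner ℂ (testL2 hψ.laplacian) w = inner ℂ (testL2 hψ) f := by
  constructor <;> intro h ψ hψ
  · rw [inner_testL2, inner_testL2, ← h _ hψ.conj, laplacian_conj]
  · have := h _ hψ.conj
    rw [inner_testL2, inner_testL2, laplacian_conj] at this
    simpa using this

lemma isLaplacian_iff {w f : D.L2} : D.IsLaplacian w f ↔ GraphLaplacian D.gradGraph w f := by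
  rw [IsLaplacian, memEnergy_iff, forall_integral_laplacian_iff]
  constructor
  · rintro ⟨⟨g, hg⟩, h⟩
    refine ⟨g, hg, fun p hp => ?_⟩
    refine gradGraph_induction (P := fun p : D.Pairs => inner ℂ g p.snd = -inner ℂ f p.fst)
      (isClosed_eq (by fun_prop) (by fun_prop)) (fun ψ hψ => ?_) hp
    have hgreen : inner ℂ (testL2 hψ) f = -inner ℂ (testPair hψ).snd g :=
      (h ψ hψ).symm.trans (inner_testL2_laplacian hψ hg)
    rw [← inner_conj_symm, ← inner_conj_symm f, ← map_neg, ← neg_eq_iff_eq_neg.2 hgreen]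
    rfl
  · rintro ⟨g, hg, h⟩
    refine ⟨⟨g, hg⟩, fun ψ hψ => ?_⟩
    have hgreen : inner ℂ (testL2 hψ.laplacian) w = -inner ℂ (testPair hψ).snd g :=
      inner_testL2_laplacian hψ hg
    rw [hgreen, ← inner_conj_symm, h _ (testPair_mem hψ), map_neg, inner_conj_symm, neg_neg]
    rfl

lemma isResolvent_gradGraph : IsResolvent (graphResolvent D.gradGraph) :=
  isResolvent_graphResolvent _ fun f hf => eq_zero_of_inner_testL2 f fun ψ hψ => by
    rw [← inner_conj_symm, map_eq_zero]
    exact hf _ (testPair_mem hψ)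

lemma flowA_eq (t : ℝ) (v₀ : D.L2) : D.flowA t v₀ = graphGroup D.gradGraph t v₀ := by
  have hR := isResolvent_gradGraph (D := D)
  have hex : ∃ v, D.IsFreeSolution v₀ v :=
    ⟨fun t => graphGroup D.gradGraph t v₀, hR.continuous_unitaryGroup v₀, graphGroup_zero hR v₀,
      fun w f h t => hasDerivAt_inner_graphGroup hR (isLaplacian_iff.1 h) v₀ t⟩
  rw [flowA, dif_pos hex]
  obtain ⟨hc, h0, hd⟩ := hex.choose_spec
  rw [eq_graphGroup_of_weak hR hc (fun w f h t => hd w f (isLaplacian_iff.2 h) t) t, h0]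

end Setting

/-! ### Boundedness of the domain of the Laplacian -/

section Truncation

/-- `β` is a smooth truncation: nondecreasing, nonexpansive, vanishing at `0`. -/
structure IsTruncation (β : ℝ → ℝ) : Prop where
  contDiff : ContDiff ℝ ∞ β
  monotone : Monotone β
  lipschitz : LipschitzWith 1 β
  zero : β 0 = 0

/-- The action of a truncation on the real part. -/
def reTrunc (β : ℝ → ℝ) (z : ℂ) : ℂ := (β z.re : ℂ)

namespace IsTruncation

variable {β : ℝ → ℝ}

lemma contDiff_reTrunc (h : IsTruncation β) : ContDiff ℝ ∞ (reTrunc β) :=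
  Complex.ofRealCLM.contDiff.comp (h.contDiff.comp Complex.reCLM.contDiff)

lemma reTrunc_zero (h : IsTruncation β) : reTrunc β 0 = 0 := by
  simp [reTrunc, h.zero]

lemma lipschitz_reTrunc (h : IsTruncation β) : LipschitzWith 1 (reTrunc β) := by
  refine LipschitzWith.of_dist_le_mul fun z w => ?_
  rw [NNReal.coe_one, one_mul, dist_eq_norm, reTrunc, reTrunc, ← Complex.ofReal_sub,
    Complex.norm_real, dist_eq_norm]
  have h1 := h.lipschitz.dist_le_mul z.re w.re
  rw [NNReal.coe_one, one_mul, dist_eq_norm, dist_eq_norm] at h1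
  refine h1.trans ?_
  rw [← Complex.sub_re]
  exact Complex.abs_re_le_norm _

lemma sq_le (h : IsTruncation β) (x : ℝ) : β x ^ 2 ≤ x * β x := by
  have h1 := h.lipschitz.dist_le_mul x 0
  rw [NNReal.coe_one, one_mul, Real.dist_eq, Real.dist_eq, h.zero, sub_zero, sub_zero] at h1
  rcases le_total 0 x with hx | hx
  · have h2 := h.monotone hx
    rw [h.zero] at h2
    rw [abs_of_nonneg hx, abs_of_nonneg h2] at h1
    nlinarith
  · have h2 := h.monotone hx
    rw [h.zero] at h2
    rw [abs_of_nonpos hx, abs_of_nonpos h2] at h1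
    nlinarith

lemma norm_reTrunc_sq_le (h : IsTruncation β) (z : ℂ) :
    ‖reTrunc β z‖ ^ 2 ≤ RCLike.re (inner ℂ z (reTrunc β z)) := by
  have := h.sq_le z.re
  simpa [reTrunc, mul_comm] using this

lemma partialDeriv_reTrunc (h : IsTruncation β) {d : ℕ} {ψ : Space d → ℂ}
    (hψ : Differentiable ℝ ψ) (j : Fin d) (x : Space d) :
    partialDeriv j (reTrunc β ∘ ψ) x = ((deriv β (ψ x).re * (partialDeriv j ψ x).re : ℝ) : ℂ) := by
  have h1 : HasFDerivAt (fun y => (ψ y).re) (Complex.reCLM.comp (fderiv ℝ ψ x)) x :=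
    Complex.reCLM.hasFDerivAt.comp x (hψ x).hasFDerivAt
  have h2 : HasDerivAt β (deriv β (ψ x).re) (ψ x).re :=
    (h.contDiff.differentiable (by simp) _).hasDerivAt
  have h3 := Complex.ofRealCLM.hasFDerivAt.comp x (h2.comp_hasFDerivAt x h1)
  have h4 : fderiv ℝ (reTrunc β ∘ ψ) x = _ := h3.fderiv
  rw [partialDeriv, h4]
  simp [partialDeriv]

lemma norm_partialDeriv_sq_le (h : IsTruncation β) {d : ℕ} {ψ : Space d → ℂ}
    (hψ : Differentiable ℝ ψ) (j : Fin d) (x : Space d) :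
    ‖partialDeriv j (reTrunc β ∘ ψ) x‖ ^ 2
      ≤ RCLike.re (inner ℂ (partialDeriv j ψ x) (partialDeriv j (reTrunc β ∘ ψ) x)) := by
  rw [h.partialDeriv_reTrunc hψ]
  have h0 : 0 ≤ deriv β (ψ x).re := h.monotone.deriv_nonneg
  have h1 : deriv β (ψ x).re ≤ 1 := by
    have := norm_deriv_le_of_lipschitz (x₀ := (ψ x).re) h.lipschitz
    exact (le_abs_self _).trans (by simpa using this)
  have : (deriv β (ψ x).re * (partialDeriv j ψ x).re) ^ 2
      ≤ deriv β (ψ x).re * (partialDeriv j ψ x).re * (partialDeriv j ψ x).re := by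
    have h2 := mul_nonneg (mul_nonneg h0 (sub_nonneg.2 h1)) (sq_nonneg (partialDeriv j ψ x).re)
    nlinarith
  rw [Complex.norm_real, Real.norm_eq_abs, sq_abs]
  simpa [mul_comm, mul_assoc, mul_left_comm] using this

end IsTruncation

lemma exists_lipschitzWith_smoothTransition :
    ∃ K : NNReal, 0 < K ∧ LipschitzWith K Real.smoothTransition := by
  have hsmooth : ContDiff ℝ ∞ Real.smoothTransition := Real.smoothTransition.contDiff
  have hsupp : HasCompactSupport (deriv Real.smoothTransition) := by
    refine HasCompactSupport.intro (isCompact_Icc (a := (0 : ℝ)) (b := 1)) fun x hx => ?_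
    have hconst : ∃ c, Real.smoothTransition =ᶠ[nhds x] fun _ => c := by
      rw [mem_Icc, not_and_or, not_le, not_le] at hx
      rcases hx with hx | hx
      · exact ⟨0, (gt_mem_nhds hx).mono fun y hy => Real.smoothTransition.zero_of_nonpos hy.le⟩
      · exact ⟨1, (lt_mem_nhds hx).mono fun y hy => Real.smoothTransition.one_of_one_le hy.le⟩
    obtain ⟨c, hc⟩ := hconst
    rw [hc.deriv_eq, deriv_const]
  obtain ⟨B, hB⟩ := hsupp.exists_bound_of_continuous (hsmooth.continuous_deriv (by simp))
  refine ⟨B.toNNReal + 1, by positivity,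
    lipschitzWith_of_nnnorm_deriv_le (hsmooth.differentiable (by simp)) fun x => ?_⟩
  rw [← NNReal.coe_le_coe]
  exact (hB x).trans ((Real.le_coe_toNNReal B).trans (by simp))

/-- A truncation that only sees the part of a function above the level `k`: it increases from `0`
to `b` between the levels `k` and `k + δ`. -/
structure IsLevelTruncation (k δ b : ℝ) (β : ℝ → ℝ) : Prop extends IsTruncation β where
  eq_zero : ∀ x ≤ k, β x = 0
  eq_top : ∀ x, k + δ ≤ x → β x = b

lemma IsLevelTruncation.norm_reTrunc_le {k δ b : ℝ} {β : ℝ → ℝ} (h : IsLevelTruncation k δ b β)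
    (z : ℂ) : ‖reTrunc β z‖ ≤ b := by
  have hnonneg : 0 ≤ β z.re := by
    rw [← h.eq_zero _ (min_le_right z.re k)]
    exact h.monotone (min_le_left _ _)
  rw [reTrunc, Complex.norm_real, Real.norm_of_nonneg hnonneg,
    ← h.eq_top _ (le_max_right z.re (k + δ))]
  exact h.monotone (le_max_left _ _)

lemma exists_isLevelTruncation : ∃ c : ℝ, 0 < c ∧ ∀ k δ : ℝ, 0 ≤ k → 0 < δ →
    ∃ β : ℝ → ℝ, IsLevelTruncation k δ (c * δ) β := by
  obtain ⟨K, hK, hlip⟩ := exists_lipschitzWith_smoothTransition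
  have hK' : (0 : ℝ) < K := hK
  refine ⟨(K : ℝ)⁻¹, inv_pos.2 hK', fun k δ hk hδ => ?_⟩
  have eq_zero {x : ℝ} (hx : x ≤ k) :
      (K : ℝ)⁻¹ * δ * Real.smoothTransition ((x - k) / δ) = 0 := by
    rw [Real.smoothTransition.zero_of_nonpos, mul_zero]
    exact div_nonpos_of_nonpos_of_nonneg (sub_nonpos.2 hx) hδ.le
  refine ⟨fun x => (K : ℝ)⁻¹ * δ * Real.smoothTransition ((x - k) / δ),
    { contDiff := contDiff_const.mul (Real.smoothTransition.contDiff.comp (by fun_prop))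
      monotone := fun x y hxy => mul_le_mul_of_nonneg_left
        (Real.smoothTransition.monotone (by gcongr)) (by positivity)
      lipschitz := LipschitzWith.of_dist_le_mul fun x y => ?_
      zero := eq_zero hk
      eq_zero := fun x hx => eq_zero hx
      eq_top := fun x hx => ?_ }⟩
  · rw [NNReal.coe_one, one_mul, Real.dist_eq, Real.dist_eq, ← mul_sub, abs_mul,
      abs_of_pos (by positivity)]
    calc _ ≤ (K : ℝ)⁻¹ * δ * (K * |(x - k) / δ - (y - k) / δ|) := by
          gcongr; exact hlip.dist_le_mul _ _
      _ = |x - y| := by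
        rw [← sub_div, abs_div, abs_of_pos hδ, sub_sub_sub_cancel_right]
        field_simp
  · rw [Real.smoothTransition.one_of_one_le, mul_one]
    rw [le_div_iff₀ hδ]
    linarith

lemma sqrt_le_of_level_step {A x y : ℝ} {n : ℕ} (hA : 0 ≤ A) (hx : √x ≤ (1 / 8) ^ n)
    (hy : y ≤ (A / ((8 * A + 1) * (1 / 2) ^ (n + 1))) ^ 3 * √x ^ 3) : √y ≤ (1 / 8) ^ (n + 1) := by
  have hdiv : A / ((8 * A + 1) * (1 / 2) ^ (n + 1)) ≤ 1 / 8 * 2 ^ (n + 1) := by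
    rw [div_le_iff₀ (by positivity)]
    calc A ≤ 1 / 8 * (8 * A + 1) := by linarith
      _ = 1 / 8 * 2 ^ (n + 1) * ((8 * A + 1) * (1 / 2) ^ (n + 1)) := by
        rw [one_div_pow]
        field_simp
  have hpow : ((2 : ℝ) ^ n) ^ 3 * (1 / 8) ^ n = 1 := by
    rw [← pow_mul, mul_comm n, pow_mul, ← mul_pow]
    norm_num
  refine Real.sqrt_le_iff.2 ⟨by positivity, ?_⟩
  calc y ≤ (A / ((8 * A + 1) * (1 / 2) ^ (n + 1))) ^ 3 * √x ^ 3 := hy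
    _ ≤ (1 / 8 * 2 ^ (n + 1) : ℝ) ^ 3 * ((1 / 8) ^ n) ^ 3 := by gcongr
    _ = ((1 / 8) ^ (n + 1)) ^ 2 := by
      rw [pow_succ, pow_succ]
      linear_combination (1 / 64 * ((1 / 8 : ℝ) ^ n) ^ 2) * hpow

-- Stampacchia's iteration along the levels `k₀ + (8 A + 1) (1 - 2⁻ⁿ)`.
lemma eq_zero_of_level_decay {φ : ℝ → ℝ} {A k₀ : ℝ} (hA : 0 ≤ A) (hφ : ∀ k, 0 ≤ φ k)
    (hanti : AntitoneOn φ (Ici k₀)) (hone : φ k₀ ≤ 1)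
    (hstep : ∀ k, k₀ ≤ k → ∀ δ, 0 < δ → φ (k + δ) ≤ (A / δ) ^ 3 * √(φ k) ^ 3) :
    φ (k₀ + (8 * A + 1)) = 0 := by
  set k : ℕ → ℝ := fun n => k₀ + (8 * A + 1) * (1 - (1 / 2) ^ n) with hk
  have le_level (n : ℕ) : k₀ ≤ k n :=
    le_add_of_nonneg_right (mul_nonneg (by positivity)
      (sub_nonneg.2 (pow_le_one₀ (by norm_num) (by norm_num))))
  have level_le (n : ℕ) : k n ≤ k₀ + (8 * A + 1) := by
    have : 0 ≤ (8 * A + 1) * (1 / 2) ^ n := by positivity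
    simp only [hk]
    linarith
  have level_succ (n : ℕ) : k n + (8 * A + 1) * (1 / 2) ^ (n + 1) = k (n + 1) := by
    simp only [hk]
    ring
  have sqrt_le (n : ℕ) : √(φ (k n)) ≤ (1 / 8) ^ n := by
    induction n with
    | zero => simpa [hk] using hone
    | succ n ih =>
      exact sqrt_le_of_level_step hA ih
        (level_succ n ▸ hstep (k n) (le_level n) _ (by positivity))
  have le_pow (n : ℕ) : φ (k₀ + (8 * A + 1)) ≤ ((1 / 8) ^ n) ^ 2 :=
    (hanti (le_level n) ((le_level n).trans (level_le n)) (level_le n)).trans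
      ((Real.sqrt_le_left (by positivity)).1 (sqrt_le n))
  have hlim : Tendsto (fun n : ℕ => ((1 / 8 : ℝ) ^ n) ^ 2) atTop (𝓝 0) := by
    simpa using (tendsto_pow_atTop_nhds_zero_of_lt_one (r := (1 / 8 : ℝ)) (by norm_num)
      (by norm_num)).pow 2
  exact le_antisymm (ge_of_tendsto' hlim le_pow) (hφ _)

end Truncation

namespace Setting

variable {d : ℕ} {D : Setting d}

lemma exists_subseq_ae_tendsto {v : ℕ → D.L2} {u : D.L2} (h : Tendsto v atTop (𝓝 u)) :
    ∃ ns : ℕ → ℕ, StrictMono ns ∧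
      ∀ᵐ x ∂D.meas, Tendsto (fun n => v (ns n) x) atTop (𝓝 (u x)) :=
  (tendstoInMeasure_of_tendsto_Lp h).exists_seq_tendsto_ae

/-- Composition of an `L²` function with a Lipschitz map fixing `0`. -/
def lipComp {F : ℂ → ℂ} {K : NNReal} (hF : LipschitzWith K F) (h0 : F 0 = 0) (u : D.L2) : D.L2 :=
  hF.compLp h0 u

lemma coeFn_lipComp {F : ℂ → ℂ} {K : NNReal} (hF : LipschitzWith K F) (h0 : F 0 = 0) (u : D.L2) :
    lipComp hF h0 u =ᵐ[D.meas] F ∘ u := hF.coeFn_compLp h0 u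

lemma continuous_lipComp {F : ℂ → ℂ} {K : NNReal} (hF : LipschitzWith K F) (h0 : F 0 = 0) :
    Continuous (lipComp (D := D) hF h0) := hF.continuous_compLp h0

lemma testL2_comp {F : ℂ → ℂ} {K : NNReal} (hF : LipschitzWith K F) (h0 : F 0 = 0)
    (hF' : ContDiff ℝ ∞ F) {ψ : Space d → ℂ} (hψ : D.IsTest ψ) :
    testL2 (hψ.comp hF' h0) = lipComp hF h0 (testL2 hψ) := by
  refine Lp.ext ?_
  filter_upwards [coeFn_testL2 (hψ.comp hF' h0), coeFn_lipComp hF h0 (testL2 hψ),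
    coeFn_testL2 hψ] with x h1 h2 h3
  rw [h1, h2, Function.comp_apply, Function.comp_apply, h3]

lemma norm_sq_le_re_inner {u v : D.L2}
    (h : ∀ᵐ x ∂D.meas, ‖v x‖ ^ 2 ≤ RCLike.re (inner ℂ (u x) (v x))) :
    ‖v‖ ^ 2 ≤ RCLike.re (inner ℂ u v) := by
  rw [← sub_nonneg, ← inner_self_eq_norm_sq (𝕜 := ℂ), ← map_sub, ← inner_sub_left, L2.inner_def,
    ← integral_re (L2.integrable_inner _ _)]
  refine integral_nonneg_of_ae ?_
  filter_upwards [h, Lp.coeFn_sub u v] with x h1 h2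
  rw [h2, Pi.sub_apply, inner_sub_left, map_sub, inner_self_eq_norm_sq]
  exact sub_nonneg.2 h1

/-- The Sobolev inequality `H¹ ⊆ L⁶` for test functions. -/
def Sobolev6 (D : Setting d) (C : NNReal) : Prop :=
  ∀ (ψ) (hψ : D.IsTest ψ), eLpNorm ψ 6 D.meas ≤ C * ENNReal.ofReal ‖testPair hψ‖

lemma norm_testPair_reTrunc_sq_le {β : ℝ → ℝ} (hβ : IsTruncation β) {ψ : Space d → ℂ}
    (hψ : D.IsTest ψ) : ‖testPair (hψ.comp hβ.contDiff_reTrunc hβ.reTrunc_zero)‖ ^ 2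
      ≤ RCLike.re (inner ℂ (testPair hψ)
        (testPair (hψ.comp hβ.contDiff_reTrunc hβ.reTrunc_zero))) := by
  set χ := hψ.comp hβ.contDiff_reTrunc hβ.reTrunc_zero
  have h0 : ‖testL2 χ‖ ^ 2 ≤ RCLike.re (inner ℂ (testL2 hψ) (testL2 χ)) := by
    refine norm_sq_le_re_inner ?_
    filter_upwards [coeFn_testL2 hψ, coeFn_testL2 χ] with x h1 h2
    rw [h1, h2]
    exact hβ.norm_reTrunc_sq_le _
  have h1 (j : Fin d) : ‖testL2 (χ.partialDeriv j)‖ ^ 2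
      ≤ RCLike.re (inner ℂ (testL2 (hψ.partialDeriv j)) (testL2 (χ.partialDeriv j))) := by
    refine norm_sq_le_re_inner ?_
    filter_upwards [coeFn_testL2 (hψ.partialDeriv j), coeFn_testL2 (χ.partialDeriv j)] with x h1 h2
    rw [h1, h2]
    exact hβ.norm_partialDeriv_sq_le hψ.differentiable j x
  rw [WithLp.prod_norm_sq_eq_of_L2, WithLp.prod_inner_apply, map_add]
  refine add_le_add h0 ?_
  rw [PiLp.norm_sq_eq_of_L2, PiLp.inner_apply, map_sum]
  exact Finset.sum_le_sum fun j _ => h1 j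

lemma norm_testPair_reTrunc_le {β : ℝ → ℝ} (hβ : IsTruncation β) {ψ : Space d → ℂ}
    (hψ : D.IsTest ψ) :
    ‖testPair (hψ.comp hβ.contDiff_reTrunc hβ.reTrunc_zero)‖ ≤ ‖testPair hψ‖ := by
  set χ := hψ.comp hβ.contDiff_reTrunc hβ.reTrunc_zero
  have hsq : ‖testPair χ‖ ^ 2 ≤ ‖testPair hψ‖ * ‖testPair χ‖ :=
    (norm_testPair_reTrunc_sq_le hβ hψ).trans (re_inner_le_norm _ _)
  rcases (norm_nonneg (testPair χ)).eq_or_lt with h0 | hpos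
  · rw [← h0]
    exact norm_nonneg _
  · exact le_of_mul_le_mul_right (by rwa [← sq]) hpos

-- Testing `-Δw = -f` with the truncation `χ` of an approximation `ψ` of `w`.
lemma norm_testPair_reTrunc_sq_le_add {w f : D.L2} {g : PiLp 2 fun _ : Fin d => D.L2}
    (hw : ∀ p ∈ D.gradGraph, inner ℂ g p.snd = -inner ℂ f p.fst) {β : ℝ → ℝ}
    (hβ : IsTruncation β) {ψ : Space d → ℂ} (hψ : D.IsTest ψ) :
    ‖testPair (hψ.comp hβ.contDiff_reTrunc hβ.reTrunc_zero)‖ ^ 2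
      ≤ ‖testPair hψ - WithLp.toLp 2 (w, g)‖ * ‖testPair hψ‖
        + ‖w - f‖ * ‖testL2 (hψ.comp hβ.contDiff_reTrunc hβ.reTrunc_zero)‖ := by
  set χ := hψ.comp hβ.contDiff_reTrunc hβ.reTrunc_zero
  set P := WithLp.toLp 2 (w, g)
  have inner_limit : inner ℂ P (testPair χ) = inner ℂ (w - f) (testL2 χ) := by
    rw [WithLp.prod_inner_apply, inner_sub_left, sub_eq_add_neg]
    exact congrArg _ (hw _ (testPair_mem χ))
  have inner_eq : inner ℂ (testPair hψ) (testPair χ)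
      = inner ℂ (testPair hψ - P) (testPair χ) + inner ℂ (w - f) (testL2 χ) := by
    rw [← inner_limit, ← inner_add_left, sub_add_cancel]
  calc ‖testPair χ‖ ^ 2 ≤ RCLike.re (inner ℂ (testPair hψ) (testPair χ)) :=
        norm_testPair_reTrunc_sq_le hβ hψ
    _ ≤ ‖testPair hψ - P‖ * ‖testPair χ‖ + ‖w - f‖ * ‖testL2 χ‖ := by
        rw [inner_eq, map_add]
        exact add_le_add (re_inner_le_norm _ _) (re_inner_le_norm _ _)
    _ ≤ ‖testPair hψ - P‖ * ‖testPair hψ‖ + ‖w - f‖ * ‖testL2 χ‖ := by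
        gcongr
        exact norm_testPair_reTrunc_le hβ hψ

lemma eLpNorm_reTrunc_le {C : NNReal} (hC : D.Sobolev6 C) {w f : D.L2}
    (h : GraphLaplacian D.gradGraph w f) {β : ℝ → ℝ} (hβ : IsTruncation β) :
    eLpNorm (reTrunc β ∘ w) 6 D.meas ≤ C * ENNReal.ofReal (Real.sqrt
      (‖w - f‖ * ‖lipComp hβ.lipschitz_reTrunc hβ.reTrunc_zero w‖)) := by
  obtain ⟨g, hg, hw⟩ := h
  obtain ⟨ψ, hψ, hlim⟩ := exists_testPair_tendsto hg
  set T := lipComp (D := D) hβ.lipschitz_reTrunc hβ.reTrunc_zero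
  set P := WithLp.toLp 2 (w, g)
  set b : ℕ → ℝ := fun n => ‖testPair (hψ n) - P‖ * ‖testPair (hψ n)‖
    + ‖w - f‖ * ‖T (testL2 (hψ n))‖
  have trunc_lim : Tendsto (fun n => T (testL2 (hψ n))) atTop (𝓝 (T w)) :=
    ((continuous_lipComp _ _).tendsto w).comp
      (((WithLp.fstL 2 ℂ D.L2 (PiLp 2 fun _ : Fin d => D.L2)).continuous.tendsto P).comp hlim)
  have bound_lim : Tendsto b atTop (𝓝 (‖w - f‖ * ‖T w‖)) := by
    have herr := (tendsto_iff_norm_sub_tendsto_zero.1 hlim).mul hlim.norm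
    simpa using herr.add (tendsto_const_nhds.mul trunc_lim.norm)
  have eLpNorm_le (n : ℕ) : eLpNorm (T (testL2 (hψ n))) 6 D.meas
      ≤ C * ENNReal.ofReal (√(b n)) := by
    have trunc_eq : _ = T (testL2 (hψ n)) := testL2_comp _ _ hβ.contDiff_reTrunc (hψ n)
    have hsq := norm_testPair_reTrunc_sq_le_add (w := w) hw hβ (hψ n)
    rw [trunc_eq] at hsq
    rw [← trunc_eq, eLpNorm_congr_ae (coeFn_testL2 _)]
    refine (hC _ ((hψ n).comp hβ.contDiff_reTrunc hβ.reTrunc_zero)).trans ?_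
    gcongr
    exact Real.le_sqrt_of_sq_le hsq
  obtain ⟨ns, hns, hae⟩ := exists_subseq_ae_tendsto trunc_lim
  calc eLpNorm (reTrunc β ∘ w) 6 D.meas = eLpNorm (T w) 6 D.meas :=
        eLpNorm_congr_ae (coeFn_lipComp _ _ w).symm
    _ ≤ liminf (fun n => eLpNorm (T (testL2 (hψ (ns n)))) 6 D.meas) atTop :=
        Lp.eLpNorm_lim_le_liminf_eLpNorm (fun n => Lp.aestronglyMeasurable _) (T w) hae
    _ ≤ liminf (fun n => C * ENNReal.ofReal (√(b (ns n)))) atTop :=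
        liminf_le_liminf (Eventually.of_forall fun n => eLpNorm_le (ns n))
    _ = C * ENNReal.ofReal (√(‖w - f‖ * ‖T w‖)) := by
        refine Tendsto.liminf_eq (ENNReal.Tendsto.const_mul ?_ (Or.inr (by simp)))
        exact ENNReal.tendsto_ofReal ((Real.continuous_sqrt.tendsto _).comp
          (bound_lim.comp hns.tendsto_atTop))

lemma norm_lipComp_reTrunc_le {k δ b : ℝ} {β : ℝ → ℝ} (hβ : IsLevelTruncation k δ b β) (hb : 0 ≤ b)
    (w : D.L2) (hfin : D.meas {x | k < (w x).re} ≠ ⊤) :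
    ‖lipComp hβ.lipschitz_reTrunc hβ.reTrunc_zero w‖
      ≤ b * √(D.meas.real {x | k < (w x).re}) := by
  have hmeas : Measurable fun x => (w x).re :=
    Complex.measurable_re.comp (Lp.stronglyMeasurable w).measurable
  have hle : eLpNorm (reTrunc β ∘ w) 2 D.meas
      ≤ eLpNorm ({x | k < (w x).re}.indicator fun _ => b) 2 D.meas := by
    refine eLpNorm_mono fun x => ?_
    by_cases hx : k < (w x).re
    · rw [indicator_of_mem (show x ∈ {x | k < (w x).re} from hx), Real.norm_of_nonneg hb]
      exact hβ.norm_reTrunc_le _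
    · rw [Function.comp_apply, reTrunc, hβ.eq_zero _ (not_lt.1 hx), Complex.ofReal_zero, norm_zero]
      exact norm_nonneg _
  rw [eLpNorm_indicator_const (measurableSet_lt measurable_const hmeas) (by simp) (by simp)] at hle
  rw [Lp.norm_def, eLpNorm_congr_ae (coeFn_lipComp _ _ w)]
  refine ENNReal.toReal_le_of_le_ofReal (by positivity) (hle.trans (le_of_eq ?_))
  rw [ENNReal.ofReal_mul hb, Real.enorm_of_nonneg hb, Real.sqrt_eq_rpow,
    ← ENNReal.ofReal_rpow_of_nonneg measureReal_nonneg (by norm_num), ofReal_measureReal hfin]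
  norm_num

lemma pow_mul_measureReal_level_le {C : NNReal} (hC : D.Sobolev6 C) {w f : D.L2}
    (h : GraphLaplacian D.gradGraph w f) {k δ b : ℝ} {β : ℝ → ℝ} (hβ : IsLevelTruncation k δ b β)
    (hb : 0 ≤ b) :
    b ^ 6 * D.meas.real {x | k + δ < (w x).re}
      ≤ C ^ 6 * (‖w - f‖ * ‖lipComp hβ.lipschitz_reTrunc hβ.reTrunc_zero w‖) ^ 3 := by
  set r := ‖w - f‖ * ‖lipComp hβ.lipschitz_reTrunc hβ.reTrunc_zero w‖
  have hr : 0 ≤ r := by positivity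
  have subset_level :
      {x | k + δ < (w x).re} ⊆ {x | ENNReal.ofReal b ≤ ‖(reTrunc β ∘ w) x‖ₑ} := by
    intro x (hx : k + δ < (w x).re)
    rw [mem_ofPred_eq, Function.comp_apply, reTrunc, hβ.eq_top _ hx.le, ← ofReal_norm,
      Complex.norm_real, Real.norm_of_nonneg hb]
  have chebyshev := mul_meas_ge_le_pow_eLpNorm' D.meas (p := 6) (by simp) (by simp)
    (hβ.contDiff_reTrunc.continuous.comp_aestronglyMeasurable (Lp.aestronglyMeasurable w))
    (ENNReal.ofReal b)
  rw [show (6 : ℝ≥0∞).toReal = (6 : ℕ) by simp, ENNReal.rpow_natCast,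
    ENNReal.rpow_natCast] at chebyshev
  have hle : ENNReal.ofReal b ^ 6 * D.meas {x | k + δ < (w x).re}
      ≤ ENNReal.ofReal (C * √r) ^ 6 := by
    refine (mul_le_mul_right (measure_mono subset_level) _).trans (chebyshev.trans ?_)
    gcongr
    rw [ENNReal.ofReal_mul C.coe_nonneg, ENNReal.ofReal_coe_nnreal]
    exact eLpNorm_reTrunc_le hC h hβ.toIsTruncation
  have := ENNReal.toReal_mono (by finiteness) hle
  rw [ENNReal.toReal_mul, ENNReal.toReal_pow, ENNReal.toReal_pow, ENNReal.toReal_ofReal hb,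
    ENNReal.toReal_ofReal (by positivity), mul_pow (C : ℝ)] at this
  rwa [show √r ^ 6 = r ^ 3 by
    rw [show 6 = 2 * 3 from rfl, pow_mul, Real.sq_sqrt hr]] at this

lemma measureReal_level_le {C : NNReal} (hC : D.Sobolev6 C) {c : ℝ} (hc : 0 < c) {w f : D.L2}
    (h : GraphLaplacian D.gradGraph w f) {k δ : ℝ} {β : ℝ → ℝ} (hδ : 0 < δ)
    (hβ : IsLevelTruncation k δ (c * δ) β) (hfin : D.meas {x | k < (w x).re} ≠ ⊤) :
    D.meas.real {x | k + δ < (w x).re}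
      ≤ (C ^ 2 * ‖w - f‖ / c / δ) ^ 3 * √(D.meas.real {x | k < (w x).re}) ^ 3 := by
  have hb : 0 < c * δ := by positivity
  have hnorm := norm_lipComp_reTrunc_le hβ hb.le w hfin
  set s := √(D.meas.real {x | k < (w x).re})
  rw [← mul_le_mul_iff_right₀ (pow_pos hb 6)]
  calc _ ≤ C ^ 6 * (‖w - f‖ * ‖lipComp hβ.lipschitz_reTrunc hβ.reTrunc_zero w‖) ^ 3 :=
        pow_mul_measureReal_level_le hC h hβ hb.le
    _ ≤ C ^ 6 * (‖w - f‖ * (c * δ * s)) ^ 3 := by gcongr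
    _ = (c * δ) ^ 6 * ((C ^ 2 * ‖w - f‖ / c / δ) ^ 3 * s ^ 3) := by field_simp

lemma measure_level_le_one (w : D.L2) {k : ℝ} (hk : ‖w‖ + 1 ≤ k) :
    D.meas {x | k < (w x).re} ≤ 1 := by
  have hk₀ : 0 < k := by linarith [norm_nonneg w]
  have chebyshev := mul_meas_ge_le_pow_eLpNorm' D.meas (p := 2) (by simp) (by simp)
    (Lp.aestronglyMeasurable w) (ENNReal.ofReal k)
  rw [← Lp.enorm_def, ← ofReal_norm] at chebyshev
  have subset_level : {x | k < (w x).re} ⊆ {x | ENNReal.ofReal k ≤ ‖w x‖ₑ} := by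
    intro x (hx : k < (w x).re)
    rw [mem_ofPred_eq, ← ofReal_norm]
    exact ENNReal.ofReal_le_ofReal (hx.le.trans (Complex.re_le_norm _))
  have hle : ENNReal.ofReal k ^ (2 : ℝ≥0∞).toReal * D.meas {x | k < (w x).re}
      ≤ ENNReal.ofReal k ^ (2 : ℝ≥0∞).toReal * 1 := by
    refine (mul_le_mul_right (measure_mono subset_level) _).trans (chebyshev.trans ?_)
    rw [mul_one]
    gcongr
    linarith
  refine (ENNReal.mul_le_mul_iff_right ?_ ?_).1 hle
  · simpa using hk₀
  · finiteness

lemma ae_re_le {C : NNReal} (hC : D.Sobolev6 C) : ∃ B : ℝ, 0 ≤ B ∧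
    ∀ w f : D.L2, GraphLaplacian D.gradGraph w f →
      ∀ᵐ x ∂D.meas, (w x).re ≤ ‖w‖ + B * ‖w - f‖ + 2 := by
  obtain ⟨c, hc, hβ⟩ := exists_isLevelTruncation
  refine ⟨8 * (C ^ 2 / c), by positivity, fun w f h => ?_⟩
  have hfin {k : ℝ} (hk : ‖w‖ + 1 ≤ k) : D.meas {x | k < (w x).re} ≠ ⊤ :=
    ((measure_level_le_one w hk).trans_lt ENNReal.one_lt_top).ne
  set A := C ^ 2 * ‖w - f‖ / c with hA
  have hA₀ : 0 ≤ A := by positivity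
  have hzero := eq_zero_of_level_decay (A := A) (k₀ := ‖w‖ + 1)
    (φ := fun k => D.meas.real {x | k < (w x).re}) hA₀ (fun k => measureReal_nonneg)
    (fun k hk l _ hkl => measureReal_mono (fun x hx => lt_of_le_of_lt hkl hx) (hfin hk))
    (ENNReal.toReal_mono ENNReal.one_ne_top (measure_level_le_one w le_rfl))
    fun k hk δ hδ => by
      obtain ⟨β, hβ⟩ := hβ k δ (by linarith [norm_nonneg w]) hδ
      exact measureReal_level_le hC hc h hδ hβ (hfin hk)
  rw [measureReal_eq_zero_iff (hfin (by linarith))] at hzero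
  filter_upwards [measure_eq_zero_iff_ae_notMem.1 hzero] with x hx
  refine (not_lt.1 hx).trans (le_of_eq ?_)
  rw [hA]
  ring

lemma ae_norm_le_of_graphLaplacian {C : NNReal} (hC : D.Sobolev6 C) : ∃ B : ℝ, 0 ≤ B ∧
    ∀ w f : D.L2, GraphLaplacian D.gradGraph w f →
      ∀ᵐ x ∂D.meas, ‖w x‖ ≤ 2 * (‖w‖ + B * ‖w - f‖ + 2) := by
  obtain ⟨B, hB, hw⟩ := ae_re_le hC
  refine ⟨B, hB, fun w f h => ?_⟩
  have ae_re_mul_le (c : ℂ) (hc : ‖c‖ = 1) :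
      ∀ᵐ x ∂D.meas, (c * w x).re ≤ ‖w‖ + B * ‖w - f‖ + 2 := by
    have hle := hw _ _ (h.smul c)
    rw [← smul_sub, norm_smul, norm_smul, hc, one_mul, one_mul] at hle
    filter_upwards [hle, Lp.coeFn_smul c w] with x hx hsmul
    rwa [hsmul, Pi.smul_apply, smul_eq_mul] at hx
  filter_upwards [ae_re_mul_le 1 (by simp), ae_re_mul_le (-1) (by simp),
    ae_re_mul_le Complex.I (by simp), ae_re_mul_le (-Complex.I) (by simp)] with x h1 h2 h3 h4
  simp only [one_mul, neg_mul, Complex.neg_re, Complex.I_mul_re, neg_neg] at h1 h2 h3 h4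
  have hre := abs_le.2 ⟨neg_le.1 h2, h1⟩
  have him := abs_le.2 ⟨neg_le.1 h3, h4⟩
  linarith [Complex.norm_le_abs_re_add_abs_im (w x)]

end Setting

/-! ### The Sobolev inequality for test functions -/

section Sobolev

variable {d : ℕ}

/-- The Sobolev inequality `H¹ ⊆ L⁶` for compactly supported smooth functions on `ℝ^d`. -/
def CompactSobolev6 (d : ℕ) (C : NNReal) : Prop :=
  ∀ ψ : Space d → ℂ, ContDiff ℝ ∞ ψ → HasCompactSupport ψ →
    eLpNorm ψ 6 volume ≤ C * (eLpNorm ψ 2 volume + eLpNorm (fderiv ℝ ψ) 2 volume)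

lemma eLpNorm_pow_complex {α : Type*} [MeasurableSpace α] {μ : Measure α} (f : α → ℂ) {n : ℕ}
    (hn : 0 < n) (p : ℝ≥0∞) :
    eLpNorm (fun x => f x ^ n) p μ = eLpNorm f (p * n) μ ^ n := by
  have h := eLpNorm_norm_rpow (p := p) (μ := μ) f (q := n) (by exact_mod_cast hn)
  rw [ENNReal.rpow_natCast, ENNReal.ofReal_natCast] at h
  rw [← h]
  exact eLpNorm_congr_norm_ae (Filter.Eventually.of_forall fun x => by simp)

lemma eLpNorm_fderiv_pow_le {μ : Measure (Space d)} {ψ : Space d → ℂ} (hψ : ContDiff ℝ ∞ ψ)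
    (n : ℕ) : eLpNorm (fderiv ℝ fun x => ψ x ^ (n + 1)) 1 μ
      ≤ (n + 1 : ℕ) * eLpNorm (fun x => ψ x ^ n) 2 μ * eLpNorm (fderiv ℝ ψ) 2 μ := by
  have hfd : fderiv ℝ (fun x => ψ x ^ (n + 1))
      = (((n + 1 : ℕ) : ℂ) • fun x => ψ x ^ n) • fderiv ℝ ψ := by
    funext x
    rw [((hψ.differentiable (by simp) x).hasFDerivAt.pow (n + 1)).fderiv, Pi.smul_apply']
    ext v
    simp
  calc eLpNorm (fderiv ℝ fun x => ψ x ^ (n + 1)) 1 μ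
      ≤ eLpNorm (((n + 1 : ℕ) : ℂ) • fun x => ψ x ^ n) 2 μ * eLpNorm (fderiv ℝ ψ) 2 μ := by
        rw [hfd]
        exact eLpNorm_smul_le_mul_eLpNorm
          ((hψ.continuous_fderiv (by simp)).aestronglyMeasurable)
          ((hψ.continuous.pow n).aestronglyMeasurable.const_smul _)
    _ = (n + 1 : ℕ) * eLpNorm (fun x => ψ x ^ n) 2 μ * eLpNorm (fderiv ℝ ψ) 2 μ := by
        rw [eLpNorm_const_smul, ← ofReal_norm, Complex.norm_natCast, ENNReal.ofReal_natCast]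

lemma exists_eLpNorm_two_le_eLpNorm_fderiv_one : ∃ c : NNReal, ∀ ψ : Space 2 → ℂ,
    ContDiff ℝ ∞ ψ → HasCompactSupport ψ →
      eLpNorm ψ 2 volume ≤ c * eLpNorm (fderiv ℝ ψ) 1 volume := by
  refine ⟨eLpNormLESNormFDerivOneConst (volume : Measure (Space 2)) 2, fun ψ hψ hs => ?_⟩
  have hle := eLpNorm_le_eLpNorm_fderiv_one (volume : Measure (Space 2)) (u := ψ) (p := 2)
    (hψ.of_le (by simp)) hs (by
      simp only [finrank_euclideanSpace, Fintype.card_fin]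
      exact ⟨by norm_num, by norm_num, by norm_num⟩)
  simpa using hle

-- Apply the Gagliardo-Nirenberg-Sobolev inequality for `W^{1,1}` to `ψ ^ 2` and to `ψ ^ 3`.
lemma exists_compactSobolev6_two : ∃ C, CompactSobolev6 2 C := by
  obtain ⟨c, hc⟩ := exists_eLpNorm_two_le_eLpNorm_fderiv_one
  refine ⟨6 * c ^ 2 + 1, fun ψ hψ hs => ?_⟩
  set a := eLpNorm ψ 2 volume
  set b := eLpNorm (fderiv ℝ ψ) 2 volume
  have pow_le (n : ℕ) : eLpNorm (fun x => ψ x ^ (n + 1)) 2 volume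
      ≤ c * ((n + 1 : ℕ) * eLpNorm (fun x => ψ x ^ n) 2 volume * b) :=
    (hc _ (hψ.pow _) (hs.comp_left (g := fun z => z ^ (n + 1)) (by simp))).trans
      (mul_le_mul_right (eLpNorm_fderiv_pow_le hψ n) _)
  have sq_le : eLpNorm (fun x => ψ x ^ 2) 2 volume ≤ c * (2 * a * b) := by
    simpa only [pow_one, Nat.reduceAdd, Nat.cast_ofNat] using pow_le 1
  have cube_le : eLpNorm ψ 6 volume ^ 3 ≤ c * (3 * (c * (2 * a * b)) * b) :=
    calc eLpNorm ψ 6 volume ^ 3 = eLpNorm (fun x => ψ x ^ 3) 2 volume := by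
          rw [eLpNorm_pow_complex ψ (by norm_num)]
          norm_num
      _ ≤ c * (3 * eLpNorm (fun x => ψ x ^ 2) 2 volume * b) := by
          simpa only [Nat.reduceAdd, Nat.cast_ofNat] using pow_le 2
      _ ≤ c * (3 * (c * (2 * a * b)) * b) := by gcongr
  have const_le : ((6 * c ^ 2 : NNReal) : ℝ≥0∞) ≤ (6 * c ^ 2 + 1 : NNReal) ^ 3 := by
    have : 6 * c ^ 2 ≤ (6 * c ^ 2 + 1) ^ 3 :=
      (le_self_add.trans (pow_one _).ge).trans (pow_le_pow_right₀ (by simp) (by norm_num))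
    exact_mod_cast this
  refine (ENNReal.pow_le_pow_left_iff (n := 3) (by norm_num)).1 (cube_le.trans ?_)
  calc c * (3 * (c * (2 * a * b)) * b) = (6 * c ^ 2 : NNReal) * (a * b * b) := by
        push_cast
        ring
    _ ≤ (6 * c ^ 2 + 1 : NNReal) ^ 3 * ((a + b) * (a + b) * (a + b)) := by
        gcongr
        exacts [le_self_add, le_add_self, le_add_self]
    _ = ((6 * c ^ 2 + 1 : NNReal) * (a + b)) ^ 3 := by ring

lemma exists_compactSobolev6_three : ∃ C, CompactSobolev6 3 C := by
  refine ⟨SNormLESNormFDerivOfEqConst ℂ (volume : Measure (Space 3)) 2, fun ψ hψ hs => ?_⟩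
  have hle := eLpNorm_le_eLpNorm_fderiv_of_eq (volume : Measure (Space 3)) (u := ψ) (p := 2)
    (p' := 6) (hψ.of_le (by simp)) hs (by norm_num) (by simp) (by simp; norm_num)
  exact le_trans (by exact_mod_cast hle) (mul_le_mul_right le_add_self _)

lemma exists_compactSobolev6 (hd : d = 2 ∨ d = 3) : ∃ C, CompactSobolev6 d C := by
  rcases hd with rfl | rfl
  · exact exists_compactSobolev6_two
  · exact exists_compactSobolev6_three

lemma eLpNorm_fderiv_smul_le {η : Space d → ℝ} (hη : Differentiable ℝ η) (h₀ : ∀ x, 0 ≤ η x)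
    (h₁ : ∀ x, η x ≤ 1) {K : NNReal} (hK : ∀ x, ‖fderiv ℝ η x‖ ≤ K) {ψ : Space d → ℂ}
    (hψ : ContDiff ℝ ∞ ψ) (μ : Measure (Space d)) :
    eLpNorm (fderiv ℝ (η • ψ)) 2 μ ≤ eLpNorm (fderiv ℝ ψ) 2 μ + K * eLpNorm ψ 2 μ := by
  calc _ ≤ eLpNorm ((fun x => ‖fderiv ℝ ψ x‖) + (K : ℝ) • fun x => ‖ψ x‖) 2 μ := by
        refine eLpNorm_mono_real fun x => ?_
        rw [fderiv_smul (hη x) (hψ.differentiable (by simp) x)]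
        refine (norm_add_le _ _).trans (add_le_add ?_ ?_)
        · rw [norm_smul, Real.norm_of_nonneg (h₀ x)]
          exact mul_le_of_le_one_left (norm_nonneg _) (h₁ x)
        · rw [ContinuousLinearMap.norm_smulRight_apply]
          exact mul_le_mul_of_nonneg_right (hK x) (norm_nonneg _)
    _ ≤ eLpNorm (fun x => ‖fderiv ℝ ψ x‖) 2 μ + eLpNorm ((K : ℝ) • fun x => ‖ψ x‖) 2 μ :=
        eLpNorm_add_le ((hψ.continuous_fderiv (by simp)).norm.aestronglyMeasurable)
          (hψ.continuous.norm.aestronglyMeasurable.const_smul _) (by norm_num)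
    _ = _ := by
        rw [eLpNorm_norm, eLpNorm_const_smul, eLpNorm_norm, Real.enorm_of_nonneg K.coe_nonneg,
          ENNReal.ofReal_coe_nnreal]

lemma eLpNorm_fderiv_restrict_eq_of_tsupport_subset {μ : Measure (Space d)} {f : Space d → ℂ}
    {s : Set (Space d)} (hs : tsupport f ⊆ s) (p : ℝ≥0∞) :
    eLpNorm (fderiv ℝ f) p (μ.restrict s) = eLpNorm (fderiv ℝ f) p μ :=
  eLpNorm_restrict_eq_of_support_subset (f := fderiv ℝ f) ((support_fderiv_subset ℝ).trans hs)

lemma CompactSobolev6.exists_ball_le {C : NNReal} (hC : CompactSobolev6 d C) {R : ℝ} (hR : 0 < R) :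
    ∃ K : NNReal, ∀ ψ : Space d → ℂ, ContDiff ℝ ∞ ψ →
      eLpNorm ψ 6 (volume.restrict (Metric.closedBall 0 R))
        ≤ C * (eLpNorm (fderiv ℝ ψ) 2 (volume.restrict (Metric.closedBall 0 (R + 1)))
          + K * eLpNorm ψ 2 (volume.restrict (Metric.closedBall 0 (R + 1)))) := by
  obtain ⟨η, rIn_eq, rOut_eq⟩ : ∃ η : ContDiffBump (0 : Space d), η.rIn = R ∧ η.rOut = R + 1 :=
    ⟨⟨R, R + 1, hR, by linarith⟩, rfl, rfl⟩
  have hη : ContDiff ℝ ∞ η := η.contDiff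
  obtain ⟨K, hK⟩ := (hη.continuous_fderiv (by simp)).bounded_above_of_compact_support
    (η.hasCompactSupport.fderiv ℝ)
  refine ⟨1 + K.toNNReal, fun ψ hψ => ?_⟩
  set B := volume.restrict (Metric.closedBall (0 : Space d) (R + 1))
  have supp_subset : tsupport ((η : Space d → ℝ) • ψ) ⊆ Metric.closedBall 0 (R + 1) :=
    (tsupport_smul_subset_left η ψ).trans (rOut_eq ▸ η.tsupport_eq.le)
  have eLpNorm_eq : eLpNorm ((η : Space d → ℝ) • ψ) 2 volume
      = eLpNorm ((η : Space d → ℝ) • ψ) 2 B :=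
    (eLpNorm_restrict_eq_of_support_subset ((subset_tsupport _).trans supp_subset)).symm
  have fderiv_eq := eLpNorm_fderiv_restrict_eq_of_tsupport_subset (μ := volume) supp_subset 2
  have eLpNorm_le : eLpNorm ((η : Space d → ℝ) • ψ) 2 B ≤ eLpNorm ψ 2 B :=
    eLpNorm_mono fun x => by
      rw [Pi.smul_apply', norm_smul, Real.norm_of_nonneg η.nonneg]
      exact mul_le_of_le_one_left (norm_nonneg _) η.le_one
  have fderiv_le := eLpNorm_fderiv_smul_le (hη.differentiable (by simp)) (fun _ => η.nonneg)
    (fun _ => η.le_one) (fun x => (hK x).trans (Real.le_coe_toNNReal K)) hψ B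
  calc eLpNorm ψ 6 (volume.restrict (Metric.closedBall 0 R))
      = eLpNorm ((η : Space d → ℝ) • ψ) 6 (volume.restrict (Metric.closedBall 0 R)) := by
        refine eLpNorm_congr_ae ?_
        filter_upwards [ae_restrict_mem measurableSet_closedBall] with x hx
        rw [Pi.smul_apply', η.one_of_mem_closedBall (rIn_eq ▸ hx), one_smul]
    _ ≤ eLpNorm ((η : Space d → ℝ) • ψ) 6 volume :=
        eLpNorm_mono_measure _ Measure.restrict_le_self
    _ ≤ C * (eLpNorm ψ 2 B + (eLpNorm (fderiv ℝ ψ) 2 B + K.toNNReal * eLpNorm ψ 2 B)) := by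
        refine (hC _ (hη.smul hψ) η.hasCompactSupport.smul_right).trans ?_
        rw [eLpNorm_eq, ← fderiv_eq]
        gcongr
    _ = _ := by
        push_cast
        ring

end Sobolev

section Cover

variable {d : ℕ} {a b : Fin d → ℝ}

lemma volume_setOf_apply_eq (i : Fin d) (c : ℝ) : volume {x : Space d | x i = c} = 0 := by
  rw [← (PiLp.volume_preserving_toLp (Fin d)).measure_preimage_equiv
    (f := MeasurableEquiv.toLp 2 (Fin d → ℝ)) {x : Space d | x i = c}]
  exact Measure.pi_hyperplane (fun _ : Fin d => (volume : Measure ℝ)) i c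

/-- The vector with coordinates `k` with respect to the periods `b i - a i` of the box
`∏ (a i, b i)`. -/
def latticeVec (a b : Fin d → ℝ) (k : Fin d → ℤ) : Space d :=
  ∑ i, k i • EuclideanSpace.single i (b i - a i)

lemma latticeVec_apply (a b : Fin d → ℝ) (k : Fin d → ℤ) (i : Fin d) :
    latticeVec a b k i = k i * (b i - a i) := by
  simp [latticeVec, Pi.single_apply]

lemma periodic_latticeVec {α : Type*} {g : Space d → α}
    (hg : ∀ (i : Fin d) x, g (x + EuclideanSpace.single i (b i - a i)) = g x) (k : Fin d → ℤ) :
    Function.Periodic g (latticeVec a b k) := by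
  classical
  refine Finset.sum_induction (fun i => k i • EuclideanSpace.single i (b i - a i))
    (Function.Periodic g) (fun _ _ => Function.Periodic.add_period) ?_ fun i _ =>
      Function.Periodic.zsmul (hg i) (k i)
  simp [Function.Periodic]

lemma wrapBox_eq_sub_latticeVec (h : ∀ i, a i < b i) (x : Space d) :
    wrapBox h x = x - latticeVec a b fun i => toIcoDiv (sub_pos.2 (h i)) (a i) (x i) := by
  ext i
  rw [PiLp.sub_apply, latticeVec_apply, ← zsmul_eq_mul]
  rfl

lemma ae_wrapBox_mem (h : ∀ i, a i < b i) :
    ∀ᵐ x : Space d, ∀ i, a i < wrapBox h x i ∧ wrapBox h x i < b i := by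
  have off_grid : ∀ᵐ x : Space d, ∀ i, ∀ n : ℤ, x i ≠ a i + n • (b i - a i) :=
    ae_all_iff.2 fun i => ae_all_iff.2 fun n => by
      rw [ae_iff]
      simpa using volume_setOf_apply_eq i (a i + n • (b i - a i))
  filter_upwards [off_grid] with x hx i
  have hp : 0 < b i - a i := sub_pos.2 (h i)
  have hmem := toIcoMod_mem_Ico hp (a i) (x i)
  have hne : toIcoMod hp (a i) (x i) ≠ a i := fun heq => hx i (toIcoDiv hp (a i) (x i)) <| by
    conv_lhs => rw [← toIcoMod_add_toIcoDiv_zsmul hp (a i) (x i), heq]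
  exact ⟨hmem.1.lt_of_ne hne.symm, hmem.2.trans_eq (by ring)⟩

lemma abs_toIcoDiv_le {p : ℝ} (hp : 0 < p) (c x : ℝ) :
    |(toIcoDiv hp c x : ℝ)| ≤ |x - c| / p + 1 := by
  have hle := abs_le.1 (le_refl |(x - c) / p|)
  rw [abs_div, abs_of_pos hp] at hle
  rw [toIcoDiv_eq_floor, abs_le]
  exact ⟨by linarith [Int.sub_one_lt_floor ((x - c) / p)],
    by linarith [Int.floor_le ((x - c) / p)]⟩

lemma exists_finset_ae_sub_latticeVec_mem (h : ∀ i, a i < b i) (R : ℝ) :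
    ∃ S : Finset (Fin d → ℤ), ∀ᵐ x : Space d, x ∈ Metric.closedBall 0 R →
      ∃ k ∈ S, ∀ i, a i < (x - latticeVec a b k) i ∧ (x - latticeVec a b k) i < b i := by
  choose N hN using fun i => exists_nat_ge ((R + |a i|) / (b i - a i) + 1)
  refine ⟨Fintype.piFinset fun i => Finset.Icc (-N i : ℤ) (N i), ?_⟩
  filter_upwards [ae_wrapBox_mem h] with x hx hxR
  refine ⟨_, Fintype.mem_piFinset.2 fun i => ?_, wrapBox_eq_sub_latticeVec h x ▸ hx⟩
  have hp : 0 < b i - a i := sub_pos.2 (h i)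
  have abs_sub_le : |x i - a i| ≤ R + |a i| :=
    (abs_sub _ _).trans (add_le_add_left
      ((PiLp.norm_apply_le x i).trans (mem_closedBall_zero_iff.1 hxR)) _)
  have abs_le_N : |(toIcoDiv hp (a i) (x i) : ℝ)| ≤ N i :=
    ((abs_toIcoDiv_le hp (a i) (x i)).trans (by gcongr)).trans (hN i)
  rw [Finset.mem_Icc, ← abs_le]
  exact_mod_cast abs_le_N

lemma exists_lintegral_ball_le (h : ∀ i, a i < b i) (R : ℝ) : ∃ N : ℕ, ∀ g : Space d → ℝ≥0∞,
    (∀ (i : Fin d) x, g (x + EuclideanSpace.single i (b i - a i)) = g x) →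
    ∫⁻ x in Metric.closedBall 0 R, g x
      ≤ N * ∫⁻ x in {x : Space d | ∀ i, a i < x i ∧ x i < b i}, g x := by
  obtain ⟨S, hS⟩ := exists_finset_ae_sub_latticeVec_mem h R
  set Q := {x : Space d | ∀ i, a i < x i ∧ x i < b i}
  refine ⟨S.card, fun g hg => ?_⟩
  have ball_le : (Metric.closedBall 0 R : Set (Space d)) ≤ᵐ[volume]
      ⋃ k : S, (fun x => x - latticeVec a b k) ⁻¹' Q := by
    filter_upwards [hS] with x hx hxR
    obtain ⟨k, hk, hxk⟩ := hx hxR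
    exact mem_iUnion.2 ⟨⟨k, hk⟩, hxk⟩
  have translate (k : Fin d → ℤ) :
      ∫⁻ x in (fun x => x - latticeVec a b k) ⁻¹' Q, g x = ∫⁻ x in Q, g x :=
    (lintegral_congr fun x => ((periodic_latticeVec hg k).sub_eq x).symm).trans
      ((measurePreserving_sub_right volume (latticeVec a b k)).setLIntegral_comp_preimage_emb
        (MeasurableEquiv.subRight (latticeVec a b k)).measurableEmbedding g Q)
  calc ∫⁻ x in Metric.closedBall 0 R, g x
      ≤ ∫⁻ x in ⋃ k : S, (fun x => x - latticeVec a b k) ⁻¹' Q, g x :=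
        lintegral_mono' (Measure.restrict_mono_ae ball_le) le_rfl
    _ ≤ ∑' k : S, ∫⁻ x in (fun x => x - latticeVec a b k) ⁻¹' Q, g x := lintegral_iUnion_le _ _
    _ = S.card * ∫⁻ x in Q, g x := by
        simp only [translate]
        rw [tsum_fintype, Finset.sum_const, nsmul_eq_mul, Finset.card_univ, Fintype.card_coe]

end Cover

namespace Setting

variable {d : ℕ} {D : Setting d}

lemma eLpNorm_two_eq {ψ : Space d → ℂ} (hψ : D.IsTest ψ) :
    eLpNorm ψ 2 D.meas = ENNReal.ofReal ‖testL2 hψ‖ := by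
  rw [Lp.norm_def, ENNReal.ofReal_toReal (Lp.eLpNorm_ne_top _)]
  exact (eLpNorm_congr_ae (coeFn_testL2 hψ)).symm

lemma norm_testL2_le {ψ : Space d → ℂ} (hψ : D.IsTest ψ) : ‖testL2 hψ‖ ≤ ‖testPair hψ‖ :=
  WithLp.norm_fst_le _ (testPair hψ)

lemma norm_testL2_partialDeriv_le {ψ : Space d → ℂ} (hψ : D.IsTest ψ) (j : Fin d) :
    ‖testL2 (hψ.partialDeriv j)‖ ≤ ‖testPair hψ‖ :=
  (PiLp.norm_apply_le (testPair hψ).snd j).trans (WithLp.norm_snd_le _ (testPair hψ))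

lemma eLpNorm_two_le {ψ : Space d → ℂ} (hψ : D.IsTest ψ) :
    eLpNorm ψ 2 D.meas ≤ ENNReal.ofReal ‖testPair hψ‖ := by
  rw [eLpNorm_two_eq hψ]
  exact ENNReal.ofReal_le_ofReal (norm_testL2_le hψ)

lemma eLpNorm_fderiv_le {ψ : Space d → ℂ} (hψ : D.IsTest ψ) :
    eLpNorm (fderiv ℝ ψ) 2 D.meas ≤ d * ENNReal.ofReal ‖testPair hψ‖ := by
  calc eLpNorm (fderiv ℝ ψ) 2 D.meas
      ≤ eLpNorm (∑ j : Fin d, fun x => ‖partialDeriv j ψ x‖) 2 D.meas := by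
        refine eLpNorm_mono_real fun x => ?_
        rw [Finset.sum_apply]
        exact norm_fderiv_le_sum_partialDeriv ψ x
    _ ≤ ∑ j : Fin d, eLpNorm (fun x => ‖partialDeriv j ψ x‖) 2 D.meas :=
        eLpNorm_sum_le (fun j _ => (hψ.partialDeriv j).continuous.norm.aestronglyMeasurable)
          (by norm_num)
    _ ≤ ∑ _j : Fin d, ENNReal.ofReal ‖testPair hψ‖ := by
        refine Finset.sum_le_sum fun j _ => ?_
        rw [eLpNorm_norm, eLpNorm_two_eq (hψ.partialDeriv j)]
        exact ENNReal.ofReal_le_ofReal (norm_testL2_partialDeriv_le hψ j)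
    _ = _ := by simp

lemma sobolev6_of_support {C : NNReal} (hC : CompactSobolev6 d C)
    (hD : ∀ ψ, D.IsTest ψ → HasCompactSupport ψ ∧ tsupport ψ ⊆ D.carrier) :
    D.Sobolev6 (C * (1 + d)) := by
  intro ψ hψ
  obtain ⟨hs, hsub⟩ := hD ψ hψ
  have hle := hC ψ hψ.contDiff hs
  rw [← eLpNorm_restrict_eq_of_support_subset (p := 6) ((subset_tsupport ψ).trans hsub),
    ← eLpNorm_restrict_eq_of_support_subset (p := 2) ((subset_tsupport ψ).trans hsub),
    ← eLpNorm_fderiv_restrict_eq_of_tsupport_subset hsub] at hle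
  refine hle.trans ?_
  calc _ ≤ C * (ENNReal.ofReal ‖testPair hψ‖ + d * ENNReal.ofReal ‖testPair hψ‖) := by
        gcongr
        · exact eLpNorm_two_le hψ
        · exact eLpNorm_fderiv_le hψ
    _ = _ := by
        push_cast
        ring

lemma exists_eLpNorm_ball_le {a b : Fin d → ℝ} (h : ∀ i, a i < b i) (R : ℝ) :
    ∃ N : NNReal, ∀ {F : Type*} [NormedAddCommGroup F] (f : Space d → F),
      (∀ (i : Fin d) x, f (x + EuclideanSpace.single i (b i - a i)) = f x) →
      eLpNorm f 2 (volume.restrict (Metric.closedBall 0 R))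
        ≤ N * eLpNorm f 2 (periodic a b h).meas := by
  obtain ⟨N, hN⟩ := exists_lintegral_ball_le h R
  refine ⟨(N : NNReal) ^ (1 / 2 : ℝ), fun f hf => ?_⟩
  rw [eLpNorm_eq_lintegral_rpow_enorm_toReal (by simp) (by simp),
    eLpNorm_eq_lintegral_rpow_enorm_toReal (by simp) (by simp), ENNReal.toReal_ofNat,
    ENNReal.coe_rpow_of_nonneg _ (by norm_num), ENNReal.coe_natCast,
    ← ENNReal.mul_rpow_of_nonneg _ _ (by norm_num)]
  gcongr
  exact hN _ fun i x => by rw [hf i x]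

lemma exists_sobolev6_periodic {C : NNReal} (hC : CompactSobolev6 d C) {a b : Fin d → ℝ}
    (h : ∀ i, a i < b i) : ∃ C', (periodic a b h).Sobolev6 C' := by
  obtain ⟨R, hR, box_subset⟩ := (isCompact_closedBox a b).isBounded.subset_closedBall_lt 0 0
  obtain ⟨K, hK⟩ := hC.exists_ball_le hR
  obtain ⟨N, hN⟩ := exists_eLpNorm_ball_le h (R + 1)
  refine ⟨C * (N * d + K * N), fun ψ hψ => ?_⟩
  have fderiv_periodic (i : Fin d) (x : Space d) :
      fderiv ℝ ψ (x + EuclideanSpace.single i (b i - a i)) = fderiv ℝ ψ x := by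
    rw [← fderiv_comp_add_right]
    simp_rw [hψ.2 i]
  calc eLpNorm ψ 6 (periodic a b h).meas
      ≤ eLpNorm ψ 6 (volume.restrict (Metric.closedBall 0 R)) := eLpNorm_mono_measure ψ
        (Measure.restrict_mono ((periodic_carrier_subset a b h).trans box_subset) le_rfl)
    _ ≤ _ := hK ψ hψ.contDiff
    _ ≤ C * (N * (d * ENNReal.ofReal ‖testPair hψ‖) + K * (N * ENNReal.ofReal ‖testPair hψ‖)) := by
        gcongr
        · exact (hN _ fderiv_periodic).trans (mul_le_mul_right (eLpNorm_fderiv_le hψ) _)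
        · exact (hN _ hψ.2).trans (mul_le_mul_right (eLpNorm_two_le hψ) _)
    _ = _ := by
        push_cast
        ring

lemma exists_sobolev6 (hd : d = 2 ∨ d = 3) (D : Setting d) : ∃ C, D.Sobolev6 C := by
  obtain ⟨C, hC⟩ := exists_compactSobolev6 hd
  cases D with
  | whole => exact ⟨_, sobolev6_of_support hC fun ψ hψ => ⟨hψ.2, subset_univ _⟩⟩
  | dirichlet U _ _ _ => exact ⟨_, sobolev6_of_support hC fun ψ hψ => hψ.2⟩
  | periodic a b h => exact exists_sobolev6_periodic hC h

end Setting

/-! ### Boundedness of the energy space in dimension one -/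

section OneDim

/-- The identification of `ℝ` with the one-dimensional Euclidean space. -/
def lineMap (t : ℝ) : Space 1 := WithLp.toLp 2 fun _ => t

lemma lineMap_eq_smul (t : ℝ) : lineMap t = t • EuclideanSpace.single 0 1 := by
  ext i
  fin_cases i
  simp [lineMap]

lemma continuous_lineMap : Continuous lineMap :=
  (PiLp.continuous_toLp 2 _).comp (continuous_pi fun _ => continuous_id)

lemma lineMap_apply_zero (x : Space 1) : lineMap (x 0) = x := by
  ext i
  fin_cases i
  simp [lineMap]

lemma measurePreserving_lineMap : MeasurePreserving lineMap :=
  (PiLp.volume_preserving_toLp (Fin 1)).comp (volume_preserving_funUnique (Fin 1) ℝ).symm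

lemma measurableEmbedding_lineMap : MeasurableEmbedding lineMap :=
  (MeasurableEquiv.toLp 2 (Fin 1 → ℝ)).measurableEmbedding.comp
    (MeasurableEquiv.funUnique (Fin 1) ℝ).symm.measurableEmbedding

lemma hasDerivAt_comp_lineMap {ψ : Space 1 → ℂ} (hψ : Differentiable ℝ ψ) (t : ℝ) :
    HasDerivAt (fun s => ψ (lineMap s)) (partialDeriv 0 ψ (lineMap t)) t := by
  have hline : HasDerivAt lineMap (EuclideanSpace.single 0 1) t := by
    simpa only [id_eq, one_smul, ← lineMap_eq_smul] using
      (hasDerivAt_id t).smul_const (EuclideanSpace.single (0 : Fin 1) (1 : ℝ))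
  exact (hψ (lineMap t)).hasFDerivAt.comp_hasDerivAt t hline

variable {φ φ' : ℝ → ℂ} {p q : ℝ}

lemma integral_norm_le_add_integral_norm_sq (hφ : Continuous φ) (hpq : p ≤ q) :
    ∫ s in p..q, ‖φ s‖ ≤ (q - p) + ∫ s in p..q, ‖φ s‖ ^ 2 := by
  have sq_cont : Continuous fun s => ‖φ s‖ ^ 2 := by fun_prop
  calc ∫ s in p..q, ‖φ s‖ ≤ ∫ s in p..q, (1 + ‖φ s‖ ^ 2) :=
        intervalIntegral.integral_mono_on hpq (hφ.norm.intervalIntegrable _ _)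
          ((continuous_const.add sq_cont).intervalIntegrable _ _) fun s _ => by
            nlinarith [sq_nonneg (‖φ s‖ - 1), norm_nonneg (φ s)]
    _ = (q - p) + ∫ s in p..q, ‖φ s‖ ^ 2 := by
        rw [intervalIntegral.integral_add intervalIntegrable_const
          (sq_cont.intervalIntegrable _ _), intervalIntegral.integral_const, smul_eq_mul, mul_one]

lemma norm_sub_le_integral_norm_deriv (hd : ∀ t, HasDerivAt φ (φ' t) t) (hc : Continuous φ')
    {s t : ℝ} (hs : s ∈ Icc p q) (ht : t ∈ Icc p q) :
    ‖φ t - φ s‖ ≤ ∫ r in p..q, ‖φ' r‖ := by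
  rw [← intervalIntegral.integral_eq_sub_of_hasDerivAt (fun x _ => hd x)
    (hc.intervalIntegrable _ _), intervalIntegral.integral_of_le (hs.1.trans hs.2)]
  exact intervalIntegral.norm_integral_le_integral_norm_uIoc.trans
    (setIntegral_mono_set hc.norm.integrableOn_Ioc
      (Filter.Eventually.of_forall fun _ => norm_nonneg _)
      (Ioc_subset_Ioc (le_min hs.1 ht.1) (max_le hs.2 ht.2)).eventuallyLE)

-- A nonhomogeneous form of the embedding `H¹ ⊆ L^∞` on an interval.
lemma norm_le_add_integral_norm_sq (hd : ∀ t, HasDerivAt φ (φ' t) t) (hc : Continuous φ')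
    (hpq : p < q) {t : ℝ} (ht : t ∈ Icc p q) :
    ‖φ t‖ ≤ 1 + (q - p) + (q - p)⁻¹ * (∫ s in p..q, ‖φ s‖ ^ 2) + ∫ s in p..q, ‖φ' s‖ ^ 2 := by
  have hφ : Continuous φ := continuous_iff_continuousAt.2 fun t => (hd t).continuousAt
  have hl : 0 < q - p := sub_pos.2 hpq
  have mean_le : (q - p) * (‖φ t‖ - ∫ r in p..q, ‖φ' r‖) ≤ ∫ s in p..q, ‖φ s‖ := by
    rw [← smul_eq_mul, ← intervalIntegral.integral_const]
    refine intervalIntegral.integral_mono_on hpq.le intervalIntegrable_const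
      (hφ.norm.intervalIntegrable _ _) fun s hs => ?_
    linarith [norm_sub_norm_le (φ t) (φ s), norm_sub_le_integral_norm_deriv hd hc hs ht]
  have le_mean : ‖φ t‖ - ∫ r in p..q, ‖φ' r‖ ≤ 1 + (q - p)⁻¹ * ∫ s in p..q, ‖φ s‖ ^ 2 :=
    calc _ ≤ (q - p)⁻¹ * ((q - p) + ∫ s in p..q, ‖φ s‖ ^ 2) := by
          rw [inv_mul_eq_div, le_div_iff₀' hl]
          exact mean_le.trans (integral_norm_le_add_integral_norm_sq hφ hpq.le)
      _ = _ := by rw [mul_add, inv_mul_cancel₀ hl.ne']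
  linarith [integral_norm_le_add_integral_norm_sq hc hpq.le]

end OneDim

namespace Setting

lemma norm_testL2_sq {d : ℕ} {D : Setting d} {ψ : Space d → ℂ} (hψ : D.IsTest ψ) :
    ‖testL2 hψ‖ ^ 2 = ∫ x, ‖ψ x‖ ^ 2 ∂D.meas := by
  rw [← inner_self_eq_norm_sq (𝕜 := ℂ), L2.inner_def, ← integral_re (L2.integrable_inner _ _)]
  refine integral_congr_ae ?_
  filter_upwards [coeFn_testL2 hψ] with x hx
  rw [hx, inner_self_eq_norm_sq]

variable {D : Setting 1}

lemma norm_testL2_sq_eq_lineMap {ψ : Space 1 → ℂ} (hψ : D.IsTest ψ) :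
    ‖testL2 hψ‖ ^ 2 = ∫ s in lineMap ⁻¹' D.carrier, ‖ψ (lineMap s)‖ ^ 2 := by
  rw [norm_testL2_sq, ← measurePreserving_lineMap.setIntegral_preimage_emb
    measurableEmbedding_lineMap]

/-- The nondegenerate intervals `[p, q]` of the line over which the square integral of every test
function is at most its squared `L²` norm: any interval for zero boundary values, a period for
periodic ones. They are long enough to run the interval Sobolev embedding on, even where the
interval leaves the domain. -/
def IsInterval (D : Setting 1) (p q : ℝ) : Prop :=
  p < q ∧ ∀ ψ (hψ : D.IsTest ψ), ∫ s in p..q, ‖ψ (lineMap s)‖ ^ 2 ≤ ‖testL2 hψ‖ ^ 2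

lemma isInterval_of_support (hD : ∀ ψ, D.IsTest ψ → HasCompactSupport ψ ∧ tsupport ψ ⊆ D.carrier)
    {p q : ℝ} (hpq : p < q) : D.IsInterval p q := by
  refine ⟨hpq, fun ψ hψ => ?_⟩
  obtain ⟨hs, hsub⟩ := hD ψ hψ
  have integral_eq : ∫ x, ‖ψ x‖ ^ 2 ∂D.meas = ∫ x, ‖ψ x‖ ^ 2 :=
    setIntegral_eq_integral_of_forall_compl_eq_zero fun x hx => by
      rw [image_eq_zero_of_notMem_tsupport fun h => hx (hsub h), norm_zero, zero_pow two_ne_zero]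
  have sq_compact : HasCompactSupport fun x => ‖ψ x‖ ^ 2 :=
    hs.comp_left (g := fun z : ℂ => ‖z‖ ^ 2) (by simp)
  have sq_integrable : Integrable fun x => ‖ψ x‖ ^ 2 :=
    (hψ.continuous.norm.pow 2).integrable_of_hasCompactSupport sq_compact
  rw [norm_testL2_sq, integral_eq,
    ← measurePreserving_lineMap.integral_comp measurableEmbedding_lineMap,
    intervalIntegral.integral_of_le hpq.le]
  exact setIntegral_le_integral
    ((measurePreserving_lineMap.integrable_comp_emb measurableEmbedding_lineMap).2 sq_integrable)
    (Filter.Eventually.of_forall fun _ => sq_nonneg _)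

lemma exists_isInterval (D : Setting 1) : ∃ l : ℝ, 0 < l ∧ ∀ x ∈ D.carrier, ∃ p,
    x 0 ∈ Icc p (p + l) ∧ D.IsInterval p (p + l) := by
  cases D with
  | whole =>
    exact ⟨1, one_pos, fun x _ => ⟨x 0, ⟨le_rfl, by linarith⟩,
      isInterval_of_support (D := whole) (fun ψ hψ => ⟨hψ.2, subset_univ _⟩) (by linarith)⟩⟩
  | dirichlet U hopen hne hbdd =>
    exact ⟨1, one_pos, fun x _ => ⟨x 0, ⟨le_rfl, by linarith⟩,
      isInterval_of_support (D := dirichlet U hopen hne hbdd) (fun ψ hψ => hψ.2) (by linarith)⟩⟩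
  | periodic a b h =>
    refine ⟨b 0 - a 0, sub_pos.2 (h 0), fun x hx => ⟨a 0, ⟨(hx 0).1.le, by linarith [(hx 0).2]⟩,
      by linarith [h 0], fun ψ hψ => ?_⟩⟩
    have preimage_carrier : lineMap ⁻¹' (periodic a b h).carrier = Ioo (a 0) (b 0) := by
      ext t
      simp [carrier, lineMap]
    rw [norm_testL2_sq_eq_lineMap, preimage_carrier, add_sub_cancel,
      intervalIntegral.integral_of_le (h 0).le, integral_Ioc_eq_integral_Ioo]

lemma exists_norm_test_le (D : Setting 1) : ∃ A B : ℝ, 0 ≤ A ∧ 0 ≤ B ∧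
    ∀ ψ (hψ : D.IsTest ψ), ∀ x ∈ D.carrier, ‖ψ x‖ ≤ A + B * ‖testPair hψ‖ ^ 2 := by
  obtain ⟨l, hl, h⟩ := exists_isInterval D
  refine ⟨1 + l, l⁻¹ + 1, by positivity, by positivity, fun ψ hψ x hx => ?_⟩
  obtain ⟨p, hp, hI⟩ := h x hx
  have value_le := (hI.2 ψ hψ).trans (pow_le_pow_left₀ (norm_nonneg _) (norm_testL2_le hψ) 2)
  have deriv_le := (hI.2 _ (hψ.partialDeriv 0)).trans
    (pow_le_pow_left₀ (norm_nonneg _) (norm_testL2_partialDeriv_le hψ 0) 2)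
  have norm_le := norm_le_add_integral_norm_sq (hasDerivAt_comp_lineMap hψ.differentiable)
    ((hψ.partialDeriv 0).continuous.comp continuous_lineMap) hI.1 hp
  rw [lineMap_apply_zero, add_sub_cancel_left] at norm_le
  calc ‖ψ x‖ ≤ _ := norm_le
    _ ≤ 1 + l + l⁻¹ * ‖testPair hψ‖ ^ 2 + ‖testPair hψ‖ ^ 2 := by gcongr
    _ = 1 + l + (l⁻¹ + 1) * ‖testPair hψ‖ ^ 2 := by ring

lemma exists_ae_norm_le_one_dim (D : Setting 1) : ∃ A B : ℝ, 0 ≤ A ∧ 0 ≤ B ∧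
    ∀ p ∈ D.gradGraph, ∀ᵐ x ∂D.meas, ‖p.fst x‖ ≤ A + B * ‖p‖ ^ 2 := by
  obtain ⟨A, B, hA, hB, h⟩ := exists_norm_test_le D
  refine ⟨A, B, hA, hB, fun p hp => ?_⟩
  obtain ⟨ψ, hψ, hlim⟩ := exists_testPair_tendsto hp
  have value_lim : Tendsto (fun n => testL2 (hψ n)) atTop (𝓝 p.fst) :=
    ((WithLp.fstL 2 ℂ D.L2 (PiLp 2 fun _ : Fin 1 => D.L2)).continuous.tendsto p).comp hlim
  obtain ⟨ns, hns, hae⟩ := exists_subseq_ae_tendsto value_lim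
  have bound_lim : Tendsto (fun n => A + B * ‖testPair (hψ (ns n))‖ ^ 2) atTop
      (𝓝 (A + B * ‖p‖ ^ 2)) :=
    (((hlim.norm.pow 2).const_mul B).const_add A).comp hns.tendsto_atTop
  have coe_eq : ∀ᵐ x ∂D.meas, ∀ n, testL2 (hψ n) x = ψ n x :=
    ae_all_iff.2 fun n => coeFn_testL2 _
  filter_upwards [hae, coe_eq, ae_restrict_mem D.measurableSet_carrier] with x hx hcoe hmem
  refine le_of_tendsto_of_tendsto' hx.norm bound_lim fun n => ?_
  rw [hcoe]
  exact h _ (hψ (ns n)) x hmem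

end Setting

/-! ### The regularized nonlinearity -/

section Nonlinearity

lemma abs_log_le_log_inv {ε a : ℝ} (hε : 0 < ε) (h1 : ε ≤ a) (h2 : a ≤ ε⁻¹) :
    |Real.log a| ≤ Real.log ε⁻¹ := by
  refine abs_le.2 ⟨?_, Real.log_le_log (hε.trans_le h1) h2⟩
  rw [Real.log_inv, neg_neg]
  exact Real.log_le_log hε h1

lemma abs_log_sub_log_mul_le {a b : ℝ} (ha : 0 < a) (hab : a ≤ b) :
    |Real.log b - Real.log a| * a ≤ b - a := by
  have hb := ha.trans_le hab
  rw [abs_of_nonneg (sub_nonneg.2 (Real.log_le_log ha hab)), ← Real.log_div hb.ne' ha.ne']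
  calc _ ≤ (b / a - 1) * a := by gcongr; exact Real.log_le_sub_one_of_pos (div_pos hb ha)
    _ = b - a := by field_simp

lemma norm_mul_sub_mul_le {R : Type*} [NormedRing R] (z w a b : R) :
    ‖z * a - w * b‖ ≤ ‖z - w‖ * ‖a‖ + ‖w‖ * ‖a - b‖ := by
  calc _ = ‖(z - w) * a + w * (a - b)‖ := by noncomm_ring
    _ ≤ ‖(z - w) * a‖ + ‖w * (a - b)‖ := norm_add_le _ _
    _ ≤ _ := add_le_add (norm_mul_le _ _) (norm_mul_le _ _)

variable {ε δ : ℝ} {z w : ℂ}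

/-- The modulus smoothed at the origin, `√(|z|² + δ²)`. It makes the nonlinearity smooth, so that
composition with it preserves the test functions. -/
def smoothNorm (δ : ℝ) (z : ℂ) : ℝ := √(‖z‖ ^ 2 + δ ^ 2)

lemma smoothNorm_zero_left (z : ℂ) : smoothNorm 0 z = ‖z‖ := by simp [smoothNorm]

lemma norm_le_smoothNorm (δ : ℝ) (z : ℂ) : ‖z‖ ≤ smoothNorm δ z :=
  Real.le_sqrt_of_sq_le (le_add_of_nonneg_right (sq_nonneg δ))

lemma smoothNorm_nonneg (δ : ℝ) (z : ℂ) : 0 ≤ smoothNorm δ z := Real.sqrt_nonneg _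

lemma smoothNorm_le_norm_add (hδ : 0 ≤ δ) (z : ℂ) : smoothNorm δ z ≤ ‖z‖ + δ := by
  rw [smoothNorm, Real.sqrt_le_left (by positivity)]
  nlinarith [mul_nonneg (norm_nonneg z) hδ]

lemma smoothNorm_le_smoothNorm (δ : ℝ) (h : ‖w‖ ≤ ‖z‖) : smoothNorm δ w ≤ smoothNorm δ z := by
  unfold smoothNorm
  gcongr

lemma smoothNorm_sub_le (δ : ℝ) (h : ‖w‖ ≤ ‖z‖) :
    smoothNorm δ z - smoothNorm δ w ≤ ‖z‖ - ‖w‖ := by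
  have hw : smoothNorm δ w ^ 2 = ‖w‖ ^ 2 + δ ^ 2 := Real.sq_sqrt (by positivity)
  rw [sub_le_iff_le_add, smoothNorm, Real.sqrt_le_left]
  · nlinarith [mul_nonneg (sub_nonneg.2 h) (sub_nonneg.2 (norm_le_smoothNorm δ w))]
  · linarith [smoothNorm_nonneg δ w]

lemma contDiff_smoothNorm (hδ : 0 < δ) : ContDiff ℝ ∞ (smoothNorm δ) :=
  ((contDiff_norm_sq ℝ).add contDiff_const).sqrt fun z => by positivity

lemma abs_log_smoothNorm_sub_mul_le (hε : 0 < ε) (δ : ℝ) (h : ‖w‖ ≤ ‖z‖) :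
    |Real.log (ε + smoothNorm δ z) - Real.log (ε + smoothNorm δ w)| * ‖w‖ ≤ ‖z - w‖ := by
  have hpos : 0 < ε + smoothNorm δ w := add_pos_of_pos_of_nonneg hε (smoothNorm_nonneg δ w)
  calc _ ≤ |Real.log (ε + smoothNorm δ z) - Real.log (ε + smoothNorm δ w)|
        * (ε + smoothNorm δ w) := by gcongr; linarith [norm_le_smoothNorm δ w]
    _ ≤ ε + smoothNorm δ z - (ε + smoothNorm δ w) :=
      abs_log_sub_log_mul_le hpos (by gcongr; exact smoothNorm_le_smoothNorm δ h)
    _ ≤ ‖z‖ - ‖w‖ := by rw [add_sub_add_left_eq_sub]; exact smoothNorm_sub_le δ h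
    _ ≤ ‖z - w‖ := norm_sub_norm_le z w

/-- The nonlinearity with the smoothed modulus, `z ↦ 2 z ln (ε + √(|z|² + δ²))`. -/
def smoothNonlin (ε δ : ℝ) (z : ℂ) : ℂ := z * ((2 * Real.log (ε + smoothNorm δ z) : ℝ) : ℂ)

lemma logPhase_eq (ε : ℝ) (z : ℂ) : logPhase ε z = 2 * Real.log (ε + ‖z‖) := by
  rw [logPhase, Real.log_pow, Nat.cast_two]

lemma smoothNonlin_zero_right (ε : ℝ) (z : ℂ) : smoothNonlin ε 0 z = regNonlin ε z := by
  rw [smoothNonlin, regNonlin, logPhase_eq, smoothNorm_zero_left]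

lemma smoothNonlin_apply_zero (ε δ : ℝ) : smoothNonlin ε δ 0 = 0 := zero_mul _

lemma contDiff_smoothNonlin (hε : 0 < ε) (hδ : 0 < δ) : ContDiff ℝ ∞ (smoothNonlin ε δ) := by
  have hlog : ContDiff ℝ ∞ fun z : ℂ => Real.log (ε + smoothNorm δ z) :=
    (contDiff_const.add (contDiff_smoothNorm hδ)).log fun z =>
      (add_pos_of_pos_of_nonneg hε (smoothNorm_nonneg δ z)).ne'
  exact contDiff_id.mul (Complex.ofRealCLM.contDiff.comp (contDiff_const.mul hlog))

lemma norm_smoothNonlin_sub_le (hε : 0 < ε) (hL : 1 ≤ Real.log ε⁻¹) (hδ : 0 ≤ δ) {K : ℝ}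
    (hK : ε + K + δ ≤ ε⁻¹) (hz : ‖z‖ ≤ K) (hw : ‖w‖ ≤ K) :
    ‖smoothNonlin ε δ z - smoothNonlin ε δ w‖ ≤ 4 * Real.log ε⁻¹ * ‖z - w‖ := by
  wlog hle : ‖w‖ ≤ ‖z‖ generalizing z w
  · rw [norm_sub_rev, norm_sub_rev z]
    exact this hw hz (not_le.1 hle).le
  have hlog : |Real.log (ε + smoothNorm δ z)| ≤ Real.log ε⁻¹ :=
    abs_log_le_log_inv hε (by linarith [smoothNorm_nonneg δ z])
      (by linarith [smoothNorm_le_norm_add hδ z])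
  have hdiff := abs_log_smoothNorm_sub_mul_le hε δ hle
  calc _ ≤ ‖z - w‖ * (2 * |Real.log (ε + smoothNorm δ z)|)
        + ‖w‖ * (2 * |Real.log (ε + smoothNorm δ z) - Real.log (ε + smoothNorm δ w)|) := by
        refine (norm_mul_sub_mul_le _ _ _ _).trans_eq ?_
        rw [← Complex.ofReal_sub, ← mul_sub, Complex.norm_real, Complex.norm_real, norm_mul,
          norm_mul, Real.norm_ofNat, Real.norm_eq_abs, Real.norm_eq_abs]
    _ ≤ ‖z - w‖ * (2 * Real.log ε⁻¹) + 2 * ‖z - w‖ := by gcongr ?_ + ?_ <;> [gcongr; linarith]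
    _ ≤ 4 * Real.log ε⁻¹ * ‖z - w‖ := by
        linarith [mul_le_mul_of_nonneg_right hL (norm_nonneg (z - w))]

lemma norm_smoothNonlin_sub_zero_le (hε : 0 < ε) (hδ : 0 ≤ δ) (z : ℂ) :
    ‖smoothNonlin ε δ z - smoothNonlin ε 0 z‖ ≤ 2 * δ / ε * ‖z‖ := by
  have hlog : |Real.log (ε + smoothNorm δ z) - Real.log (ε + ‖z‖)| * ε ≤ δ := by
    calc _ ≤ |Real.log (ε + smoothNorm δ z) - Real.log (ε + ‖z‖)| * (ε + ‖z‖) := by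
          gcongr; exact le_add_of_nonneg_right (norm_nonneg z)
      _ ≤ ε + smoothNorm δ z - (ε + ‖z‖) :=
          abs_log_sub_log_mul_le (by positivity) (by gcongr; exact norm_le_smoothNorm δ z)
      _ ≤ δ := by linarith [smoothNorm_le_norm_add hδ z]
  rw [smoothNonlin, smoothNonlin, smoothNorm_zero_left, ← mul_sub, ← Complex.ofReal_sub,
    ← mul_sub, norm_mul, Complex.norm_real, norm_mul, Real.norm_ofNat, Real.norm_eq_abs, mul_comm]
  gcongr
  rw [mul_div_assoc]
  gcongr
  exact (le_div_iff₀ hε).2 hlog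

lemma norm_exp_mul_I_sub_exp_mul_I_le (s t : ℝ) :
    ‖Complex.exp (s * Complex.I) - Complex.exp (t * Complex.I)‖ ≤ |s - t| := by
  have e : Complex.exp (s * Complex.I) - Complex.exp (t * Complex.I)
      = Complex.exp (t * Complex.I) * (Complex.exp ((s - t : ℝ) * Complex.I) - 1) := by
    rw [mul_sub, ← Complex.exp_add, mul_one]; push_cast; ring_nf
  rw [e, norm_mul, Complex.norm_exp_ofReal_mul_I, one_mul]
  exact norm_exp_mul_I_sub_one_le (s - t)

lemma norm_nonlinFlow_sub_le (hε : 0 < ε) (lam t : ℝ) (z w : ℂ) :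
    ‖nonlinFlow lam ε t z - nonlinFlow lam ε t w‖ ≤ (1 + 2 * |t * lam|) * ‖z - w‖ := by
  wlog hle : ‖w‖ ≤ ‖z‖ generalizing z w
  · rw [norm_sub_rev, norm_sub_rev z]
    exact this _ _ (not_le.1 hle).le
  have hdiff : |Real.log (ε + ‖z‖) - Real.log (ε + ‖w‖)| * ‖w‖ ≤ ‖z - w‖ := by
    simpa only [smoothNorm_zero_left] using abs_log_smoothNorm_sub_mul_le hε 0 hle
  have hphase : |-(t * lam * logPhase ε z) - -(t * lam * logPhase ε w)|
      = 2 * |t * lam| * |Real.log (ε + ‖z‖) - Real.log (ε + ‖w‖)| := by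
    rw [logPhase_eq, logPhase_eq, ← abs_two (α := ℝ), ← abs_mul, ← abs_mul, ← abs_neg, abs_two]
    ring_nf
  calc _ ≤ ‖z - w‖ * 1 + ‖w‖ * |-(t * lam * logPhase ε z) - -(t * lam * logPhase ε w)| := by
        refine (norm_mul_sub_mul_le _ _ _ _).trans ?_
        rw [Complex.norm_exp_ofReal_mul_I]
        gcongr
        exact norm_exp_mul_I_sub_exp_mul_I_le _ _
    _ = ‖z - w‖ + 2 * |t * lam| * (|Real.log (ε + ‖z‖) - Real.log (ε + ‖w‖)| * ‖w‖) := by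
        rw [hphase]; ring
    _ ≤ ‖z - w‖ + 2 * |t * lam| * ‖z - w‖ := by gcongr
    _ = _ := by ring

lemma norm_nonlinFlow_sub_sub_le (hε : 0 < ε) {K : ℝ} (hK : ε + K ≤ ε⁻¹) (lam t : ℝ)
    (hz : ‖z‖ ≤ K) : ‖nonlinFlow lam ε t z - z - (t : ℂ) * (-Complex.I * lam * regNonlin ε z)‖
      ≤ 8 * (t * lam * Real.log ε⁻¹) ^ 2 * ‖z‖ := by
  set θ : ℝ := -(t * lam * logPhase ε z) with hθ
  have hexp : nonlinFlow lam ε t z - z - (t : ℂ) * (-Complex.I * lam * regNonlin ε z)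
      = z * (Complex.exp (θ * Complex.I) - 1 - θ * Complex.I) := by
    rw [nonlinFlow, regNonlin, ← hθ, hθ]; push_cast; ring
  have hlog : |Real.log (ε + ‖z‖)| ≤ |Real.log ε⁻¹| :=
    (abs_log_le_log_inv hε (by linarith [norm_nonneg z]) (by linarith)).trans (le_abs_self _)
  have hθ_le : θ ^ 2 ≤ 4 * (t * lam * Real.log ε⁻¹) ^ 2 := by
    calc θ ^ 2 = 4 * ((t * lam) ^ 2 * Real.log (ε + ‖z‖) ^ 2) := by rw [hθ, logPhase_eq]; ring
      _ ≤ 4 * ((t * lam) ^ 2 * Real.log ε⁻¹ ^ 2) := by gcongr 4 * (_ * ?_); exact sq_le_sq.2 hlog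
      _ = _ := by ring
  rw [hexp, norm_mul, mul_comm]
  gcongr
  linarith [norm_exp_mul_I_sub_one_sub_le θ]

end Nonlinearity

section Cutoff

/-- A smooth bump on `ℂ`, equal to `1` on the unit disc and supported in the disc of radius `2`. -/
def discBump : ContDiffBump (0 : ℂ) := ⟨1, 2, one_pos, one_lt_two⟩

/-- A smooth map, Lipschitz uniformly in `K`, that is the identity on the disc of radius `K` and
takes values in the disc of radius `2 K`. -/
def discCutoff (K : ℝ) (z : ℂ) : ℂ := discBump (K⁻¹ • z) • z

variable {K : ℝ}

lemma contDiff_discCutoff (K : ℝ) : ContDiff ℝ ∞ (discCutoff K) :=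
  (discBump.contDiff.comp (contDiff_id.const_smul K⁻¹)).smul contDiff_id

lemma discCutoff_of_norm_le (hK : 0 < K) {z : ℂ} (hz : ‖z‖ ≤ K) : discCutoff K z = z := by
  have hmem : K⁻¹ • z ∈ Metric.closedBall (0 : ℂ) discBump.rIn := by
    rw [mem_closedBall_zero_iff, norm_smul, norm_inv, Real.norm_of_nonneg hK.le]
    exact inv_mul_le_one_of_le₀ hz hK.le
  rw [discCutoff, discBump.one_of_mem_closedBall hmem, one_smul]

lemma discCutoff_zero (K : ℝ) : discCutoff K 0 = 0 := smul_zero _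

lemma norm_discCutoff_le_norm (K : ℝ) (z : ℂ) : ‖discCutoff K z‖ ≤ ‖z‖ := by
  rw [discCutoff, norm_smul, Real.norm_of_nonneg discBump.nonneg]
  exact mul_le_of_le_one_left (norm_nonneg z) discBump.le_one

lemma norm_discCutoff_le (hK : 0 < K) (z : ℂ) : ‖discCutoff K z‖ ≤ 2 * K := by
  rcases le_total ‖z‖ (2 * K) with h | h
  · exact (norm_discCutoff_le_norm K z).trans h
  · have hdist : discBump.rOut ≤ dist (K⁻¹ • z) 0 := by
      rw [dist_zero_right, norm_smul, norm_inv, Real.norm_of_nonneg hK.le, inv_mul_eq_div]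
      exact (le_div_iff₀ hK).2 h
    rw [discCutoff, discBump.zero_of_le_dist hdist, zero_smul, norm_zero]
    positivity

lemma exists_lipschitzWith_discCutoff :
    ∃ C : NNReal, ∀ K : ℝ, 0 < K → LipschitzWith C (discCutoff K) := by
  obtain ⟨C, hC⟩ := ContDiff.lipschitzWith_of_hasCompactSupport
    (f := fun z : ℂ => discBump z • z) (𝕂 := ℝ) discBump.hasCompactSupport.smul_right
    (discBump.contDiff.smul contDiff_id) (n := ∞) (by simp)
  have hscale {K : ℝ} (hK : 0 < K) (z : ℂ) :
      discCutoff K z = K • (discBump (K⁻¹ • z) • (K⁻¹ • z)) := by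
    rw [smul_comm K, smul_inv_smul₀ hK.ne', discCutoff]
  refine ⟨C, fun K hK => LipschitzWith.of_dist_le_mul fun z w => ?_⟩
  rw [hscale hK, hscale hK, dist_smul₀, Real.norm_of_nonneg hK.le]
  calc _ ≤ K * (C * dist (K⁻¹ • z) (K⁻¹ • w)) := by gcongr; exact hC.dist_le_mul _ _
    _ = C * dist z w := by
      rw [dist_smul₀, norm_inv, Real.norm_of_nonneg hK.le]
      field_simp

end Cutoff

/-! ### The nonlinearity and the Schrödinger group on the energy space -/

section CutoffNonlin

/-- `F` is a limit of smooth `L`-Lipschitz maps fixing the origin, with an error small relative to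
`|z|`. Unlike smoothness, this is satisfied by the regularized nonlinearity after a cutoff, and it
suffices to control composition with `F` in the energy space. -/
def IsSmoothLipschitzLimit (L : NNReal) (F : ℂ → ℂ) : Prop :=
  ∀ η : ℝ, 0 < η → ∃ G : ℂ → ℂ, ContDiff ℝ ∞ G ∧ LipschitzWith L G ∧ G 0 = 0 ∧
    ∀ z, ‖F z - G z‖ ≤ η * ‖z‖

/-- A globally Lipschitz nonlinearity that coincides with the regularized one on the disc of radius
`K`; it takes the place of the latter along a solution bounded pointwise by `K`. -/
structure IsCutoffNonlin (ε K : ℝ) (L : NNReal) (F : ℂ → ℂ) : Prop where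
  lipschitz : LipschitzWith L F
  zero : F 0 = 0
  eq : ∀ z, ‖z‖ ≤ K → F z = regNonlin ε z
  isSmoothLipschitzLimit : IsSmoothLipschitzLimit L F

variable {ε δ K : ℝ} {C : NNReal}

lemma lipschitzWith_smoothNonlin_comp_discCutoff (hC : LipschitzWith C (discCutoff K))
    (hε : 0 < ε) (hL : 1 ≤ Real.log ε⁻¹) (hK : 0 < K) (h : ε + 2 * K + δ ≤ ε⁻¹) (hδ : 0 ≤ δ) :
    LipschitzWith (4 * C * (Real.log ε⁻¹).toNNReal) (smoothNonlin ε δ ∘ discCutoff K) := by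
  refine LipschitzWith.of_dist_le_mul fun z w => ?_
  have hdisc := hC.dist_le_mul z w
  rw [dist_eq_norm (discCutoff K z)] at hdisc
  push_cast
  rw [Real.coe_toNNReal _ (by linarith), dist_eq_norm]
  calc _ ≤ 4 * Real.log ε⁻¹ * ‖discCutoff K z - discCutoff K w‖ :=
        norm_smoothNonlin_sub_le hε hL hδ h (norm_discCutoff_le hK z) (norm_discCutoff_le hK w)
    _ ≤ 4 * Real.log ε⁻¹ * (C * dist z w) := by gcongr
    _ = _ := by ring

lemma norm_smoothNonlin_discCutoff_sub_le (hε : 0 < ε) (hδ : 0 ≤ δ) (z : ℂ) :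
    ‖smoothNonlin ε 0 (discCutoff K z) - smoothNonlin ε δ (discCutoff K z)‖
      ≤ 2 * δ / ε * ‖z‖ := by
  rw [norm_sub_rev]
  refine (norm_smoothNonlin_sub_zero_le hε hδ _).trans ?_
  gcongr
  exact norm_discCutoff_le_norm K z

lemma exists_isCutoffNonlin : ∃ C : NNReal, ∀ ε K : ℝ, 0 < ε → 1 ≤ Real.log ε⁻¹ → 0 < K →
    ε + 2 * K + 1 ≤ ε⁻¹ → ∃ F, IsCutoffNonlin ε K (C * (Real.log ε⁻¹).toNNReal) F := by
  obtain ⟨C, hC⟩ := exists_lipschitzWith_discCutoff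
  refine ⟨4 * C, fun ε K hε hL hK h => ⟨smoothNonlin ε 0 ∘ discCutoff K, ?_⟩⟩
  have hlip {δ : ℝ} (h0 : 0 ≤ δ) (h1 : δ ≤ 1) :=
    lipschitzWith_smoothNonlin_comp_discCutoff (hC K hK) hε hL hK (by linarith) h0
  have hzero (δ : ℝ) : (smoothNonlin ε δ ∘ discCutoff K) 0 = 0 := by
    rw [Function.comp_apply, discCutoff_zero, smoothNonlin_apply_zero]
  refine ⟨hlip le_rfl zero_le_one, hzero 0, fun z hz => ?_, fun η hη => ?_⟩
  · rw [Function.comp_apply, discCutoff_of_norm_le hK hz, smoothNonlin_zero_right]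
  have hδ : 0 < min 1 (η * ε / 2) := by positivity
  refine ⟨_, (contDiff_smoothNonlin hε hδ).comp (contDiff_discCutoff K),
    hlip hδ.le (min_le_left _ _), hzero _, fun z => ?_⟩
  refine (norm_smoothNonlin_discCutoff_sub_le hε hδ.le z).trans ?_
  gcongr
  rw [div_le_iff₀ hε]
  linarith [min_le_right 1 (η * ε / 2)]

end CutoffNonlin

namespace Setting

variable {d : ℕ} {D : Setting d}

lemma norm_testPair_comp_snd_le {F : ℂ → ℂ} {K : NNReal} (hF : LipschitzWith K F) (h0 : F 0 = 0)
    (hF' : ContDiff ℝ ∞ F) {ψ : Space d → ℂ} (hψ : D.IsTest ψ) :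
    ‖(testPair (hψ.comp hF' h0)).snd‖ ≤ K * ‖(testPair hψ).snd‖ := by
  have hpartial (j : Fin d) : ‖testL2 ((hψ.comp hF' h0).partialDeriv j)‖
      ≤ K * ‖testL2 (hψ.partialDeriv j)‖ := by
    refine Lp.norm_le_mul_norm_of_ae_le_mul ?_
    filter_upwards [coeFn_testL2 ((hψ.comp hF' h0).partialDeriv j),
      coeFn_testL2 (hψ.partialDeriv j)] with x hcomp hψx
    rw [hcomp, hψx]
    exact norm_partialDeriv_comp_le hF (hF'.differentiable (by simp)) hψ.differentiable j x
  refine (sq_le_sq₀ (norm_nonneg _) (by positivity)).1 ?_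
  rw [mul_pow, PiLp.norm_sq_eq_of_L2, PiLp.norm_sq_eq_of_L2, Finset.mul_sum]
  refine Finset.sum_le_sum fun j _ => ?_
  rw [← mul_pow]
  gcongr
  exact hpartial j

lemma norm_graphGroup_lipComp_sub_le_of_contDiff {F : ℂ → ℂ} {K : NNReal}
    (hF : LipschitzWith K F) (h0 : F 0 = 0) (hF' : ContDiff ℝ ∞ F) (t : ℝ) {p : D.Pairs}
    (hp : p ∈ D.gradGraph) :
    ‖graphGroup D.gradGraph t (lipComp hF h0 p.fst) - lipComp hF h0 p.fst‖
      ≤ 3 * √|t| * (K * ‖p.snd‖) := by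
  refine gradGraph_induction (P := fun p : D.Pairs =>
    ‖graphGroup D.gradGraph t (lipComp hF h0 p.fst) - lipComp hF h0 p.fst‖
      ≤ 3 * √|t| * (K * ‖p.snd‖)) ?_ (fun ψ hψ => ?_) hp
  · have hcont : Continuous fun p : D.Pairs => lipComp hF h0 p.fst :=
      (continuous_lipComp hF h0).comp (by fun_prop)
    exact isClosed_le (((graphGroup D.gradGraph t).continuous.comp hcont).sub hcont).norm
      (by fun_prop)
  · calc ‖graphGroup D.gradGraph t (lipComp hF h0 (testL2 hψ)) - lipComp hF h0 (testL2 hψ)‖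
        = ‖graphGroup D.gradGraph t (testL2 (hψ.comp hF' h0)) - testL2 (hψ.comp hF' h0)‖ := by
          rw [testL2_comp hF h0 hF' hψ]
      _ ≤ 3 * √|t| * ‖(testPair (hψ.comp hF' h0)).snd‖ :=
          norm_graphGroup_sub_le isResolvent_gradGraph isClosed_gradGraph
            (testPair_mem (hψ.comp hF' h0)) t
      _ ≤ _ := by gcongr; exact norm_testPair_comp_snd_le hF h0 hF' hψ

lemma norm_lipComp_sub_lipComp_le {F G : ℂ → ℂ} {K K' : NNReal} (hF : LipschitzWith K F)
    (h0 : F 0 = 0) (hG : LipschitzWith K' G) (h0' : G 0 = 0) {η : ℝ}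
    (h : ∀ z, ‖F z - G z‖ ≤ η * ‖z‖) (u : D.L2) :
    ‖lipComp hF h0 u - lipComp hG h0' u‖ ≤ η * ‖u‖ := by
  refine Lp.norm_le_mul_norm_of_ae_le_mul ?_
  filter_upwards [coeFn_lipComp hF h0 u, coeFn_lipComp hG h0' u,
    Lp.coeFn_sub (lipComp hF h0 u) (lipComp hG h0' u)] with x hFx hGx hsub
  rw [hsub, Pi.sub_apply, hFx, hGx]
  exact h _

lemma norm_graphGroup_sub_self_le (t : ℝ) (u v : D.L2) :
    ‖graphGroup D.gradGraph t u - u‖ ≤ ‖graphGroup D.gradGraph t v - v‖ + 2 * ‖u - v‖ := by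
  calc _ = ‖graphGroup D.gradGraph t (u - v) + (graphGroup D.gradGraph t v - v) - (u - v)‖ := by
        rw [map_sub]; congr 1; abel
    _ ≤ ‖u - v‖ + ‖graphGroup D.gradGraph t v - v‖ + ‖u - v‖ := by
        refine (norm_sub_le _ _).trans (add_le_add ((norm_add_le _ _).trans_eq ?_) le_rfl)
        rw [norm_graphGroup isResolvent_gradGraph]
    _ = _ := by ring

lemma norm_graphGroup_lipComp_sub_le {F : ℂ → ℂ} {K : NNReal} (hF : LipschitzWith K F)
    (h0 : F 0 = 0) (happ : IsSmoothLipschitzLimit K F) (t : ℝ) {p : D.Pairs}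
    (hp : p ∈ D.gradGraph) :
    ‖graphGroup D.gradGraph t (lipComp hF h0 p.fst) - lipComp hF h0 p.fst‖
      ≤ 3 * √|t| * (K * ‖p.snd‖) := by
  have hη (η : ℝ) (hη : 0 < η) :
      ‖graphGroup D.gradGraph t (lipComp hF h0 p.fst) - lipComp hF h0 p.fst‖
        ≤ 3 * √|t| * (K * ‖p.snd‖) + 2 * (η * ‖p.fst‖) := by
    obtain ⟨G, hs, hG, h0', hFG⟩ := happ η hη
    refine (norm_graphGroup_sub_self_le t _ (lipComp hG h0' p.fst)).trans ?_
    gcongr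
    · exact norm_graphGroup_lipComp_sub_le_of_contDiff hG h0' hs t hp
    · exact norm_lipComp_sub_lipComp_le hF h0 hG h0' hFG p.fst
  have hlim : Tendsto (fun η : ℝ => 3 * √|t| * (K * ‖p.snd‖) + 2 * (η * ‖p.fst‖)) (𝓝[>] 0)
      (𝓝 (3 * √|t| * (K * ‖p.snd‖) + 2 * (0 * ‖p.fst‖))) :=
    (Continuous.tendsto (by fun_prop) 0).mono_left nhdsWithin_le_nhds
  rw [zero_mul, mul_zero, add_zero] at hlim
  exact ge_of_tendsto hlim (eventually_mem_nhdsWithin.mono hη)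

lemma norm_lipComp_sub_le {F : ℂ → ℂ} {K : NNReal} (hF : LipschitzWith K F) (h0 : F 0 = 0)
    (u v : D.L2) : ‖lipComp hF h0 u - lipComp hF h0 v‖ ≤ K * ‖u - v‖ :=
  hF.norm_compLp_sub_le h0 u v

lemma norm_lipComp_le {F : ℂ → ℂ} {K : NNReal} (hF : LipschitzWith K F) (h0 : F 0 = 0)
    (u : D.L2) : ‖lipComp hF h0 u‖ ≤ K * ‖u‖ := hF.norm_compLp_le h0 u

lemma coeFn_flowB (lam ε t : ℝ) (z : D.L2) :
    D.flowB lam ε t z =ᵐ[D.meas] fun x => nonlinFlow lam ε t (z x) := MemLp.coeFn_toLp _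

lemma norm_flowB (lam ε t : ℝ) (z : D.L2) : ‖D.flowB lam ε t z‖ = ‖z‖ := by
  refine le_antisymm (Lp.norm_le_norm_of_ae_le ?_) (Lp.norm_le_norm_of_ae_le ?_) <;>
  · filter_upwards [coeFn_flowB lam ε t z] with x hx
    rw [hx, norm_nonlinFlow]

lemma norm_flowB_sub_le {ε : ℝ} (hε : 0 < ε) (lam t : ℝ) (z w : D.L2) :
    ‖D.flowB lam ε t z - D.flowB lam ε t w‖ ≤ (1 + 2 * |t * lam|) * ‖z - w‖ := by
  refine Lp.norm_le_mul_norm_of_ae_le_mul ?_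
  filter_upwards [coeFn_flowB lam ε t z, coeFn_flowB lam ε t w, Lp.coeFn_sub z w,
    Lp.coeFn_sub (D.flowB lam ε t z) (D.flowB lam ε t w)] with x hz hw hzw hflow
  rw [hzw, hflow, Pi.sub_apply, Pi.sub_apply, hz, hw]
  exact norm_nonlinFlow_sub_le hε lam t _ _

lemma norm_flowA (t : ℝ) (v : D.L2) : ‖D.flowA t v‖ = ‖v‖ := by
  rw [flowA_eq]; exact norm_graphGroup isResolvent_gradGraph t v

lemma norm_lieTrotter (lam ε τ : ℝ) (u₀ : D.L2) (n : ℕ) : ‖D.lieTrotter lam ε τ u₀ n‖ = ‖u₀‖ := by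
  induction n with
  | zero => rfl
  | succ n ih => rw [lieTrotter, norm_flowA, norm_flowB, ih]

end Setting

/-! ### Regularity of the solution -/

lemma continuousOn_forall_of_ae {X : Type*} [TopologicalSpace X] {u : ℝ → X} {T : ℝ} (hT : 0 < T)
    (hu : ContinuousOn u (Icc 0 T)) {P : X → Prop} (hP : IsClosed {x | P x})
    (h : ∀ᵐ t ∂(volume.restrict (Ioo 0 T)), P (u t)) : ∀ t ∈ Icc 0 T, P (u t) := by
  set S : Set ℝ := Ioo 0 T ∩ {t | t ∈ Ioo 0 T → P (u t)}
  have hdense : Icc 0 T ⊆ closure S := by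
    rw [← closure_Ioo hT.ne]
    exact closure_minimal ((Measure.dense_of_ae ((ae_restrict_iff' measurableSet_Ioo).1 h)
      ).open_subset_closure_inter isOpen_Ioo) isClosed_closure
  intro t ht
  have hcont : ContinuousWithinAt u S t :=
    (hu t ht).mono (inter_subset_left.trans Ioo_subset_Icc_self)
  refine hP.closure_subset_iff.2 ?_ (hcont.mem_closure_image (hdense ht))
  rintro _ ⟨s, hs, rfl⟩
  exact hs.2 hs.1

lemma tendstoUniformlyOn_of_norm_sub_le {α E : Type*} [SeminormedAddCommGroup E] {s : Set α}
    {F : ℕ → α → E} {f : α → E} {a : ℕ → ℝ} (ha : Tendsto a atTop (𝓝 0))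
    (h : ∀ n, ∀ x ∈ s, ‖F n x - f x‖ ≤ a n) : TendstoUniformlyOn F f atTop s := by
  rw [Metric.tendstoUniformlyOn_iff]
  intro η hη
  filter_upwards [ha.eventually (gt_mem_nhds hη)] with n hn x hx
  rw [dist_eq_norm']
  exact (h n x hx).trans_lt hn

lemma hasDerivAt_inner_of_tendsto {H : Type*} [NormedAddCommGroup H] [InnerProductSpace ℂ H]
    {s : Set ℝ} (hs : IsOpen s) {u N : ℝ → H} {w : ℕ → H} {w' : H} {g : ℕ → ℝ → ℂ} {g' : ℝ → ℂ}
    {B : ℝ} (hw : Tendsto w atTop (𝓝 w')) (hN : ∀ t ∈ s, ‖N t‖ ≤ B)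
    (hg : TendstoUniformlyOn g g' atTop s)
    (hd : ∀ n, ∀ t ∈ s, HasDerivAt (fun r => inner ℂ (w n) (u r)) (g n t + inner ℂ (w n) (N t)) t)
    {t : ℝ} (ht : t ∈ s) :
    HasDerivAt (fun r => inner ℂ w' (u r)) (g' t + inner ℂ w' (N t)) t := by
  have hlim : Tendsto (fun n => ‖w n - w'‖ * B) atTop (𝓝 0) := by
    simpa using (tendsto_iff_norm_sub_tendsto_zero.1 hw).mul_const B
  have hunif : TendstoUniformlyOn (fun n t => inner ℂ (w n) (N t)) (fun t => inner ℂ w' (N t))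
      atTop s := by
    refine tendstoUniformlyOn_of_norm_sub_le hlim fun n t ht => ?_
    rw [← inner_sub_left]
    exact (norm_inner_le_norm _ _).trans (by gcongr; exact hN t ht)
  exact hasDerivAt_of_tendstoUniformlyOn hs (hg.add hunif) (Eventually.of_forall hd)
    (fun t _ => hw.inner tendsto_const_nhds) ht

namespace Setting

variable {d : ℕ} {D : Setting d}

lemma isClosed_ae_norm_le (K : ℝ) : IsClosed {u : D.L2 | ∀ᵐ x ∂D.meas, ‖u x‖ ≤ K} := by
  refine IsSeqClosed.isClosed fun v u hv hlim => ?_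
  obtain ⟨ns, -, hns⟩ := exists_subseq_ae_tendsto hlim
  filter_upwards [hns, ae_all_iff.2 fun n => hv (ns n)] with x hx hbound
  exact le_of_tendsto' hx.norm hbound

lemma eq_of_hasWeakDeriv {u : D.L2} {γ : PiLp 2 fun _ : Fin d => D.L2}
    (h : WithLp.toLp 2 (u, γ) ∈ D.gradGraph) {g : Fin d → D.L2}
    (hg : ∀ j, D.HasWeakDeriv j u (g j)) : γ = WithLp.toLp 2 g := by
  ext1 j
  exact (hasWeakDeriv_of_mem_gradGraph h j).unique (hg j)

lemma toLp_mem_gradGraph_of_hasWeakDeriv {u : D.L2} (hu : D.MemEnergy u) {g : Fin d → D.L2}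
    (hg : ∀ j, D.HasWeakDeriv j u (g j)) : WithLp.toLp 2 (u, WithLp.toLp 2 g) ∈ D.gradGraph := by
  obtain ⟨γ, hγ⟩ := memEnergy_iff.1 hu
  rwa [eq_of_hasWeakDeriv hγ hg] at hγ

lemma exists_mem_gradGraph_of_h1Norm_le {u : D.L2} (hu : D.MemEnergy u) {m : ℝ}
    (h : D.h1Norm u ≤ ENNReal.ofReal m) :
    ∃ p ∈ D.gradGraph, p.fst = u ∧ ‖p‖ ≤ |m| + 1 := by
  have hlt : D.h1Norm u < ENNReal.ofReal (|m| + 1) :=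
    h.trans_lt ((ENNReal.ofReal_lt_ofReal_iff (by positivity)).2 (by linarith [le_abs_self m]))
  simp only [h1Norm, iInf_lt_iff] at hlt
  obtain ⟨g, hg, hlt⟩ := hlt
  rw [ENNReal.ofReal_lt_ofReal_iff (by positivity)] at hlt
  refine ⟨_, toLp_mem_gradGraph_of_hasWeakDeriv hu hg, rfl, ?_⟩
  rw [WithLp.prod_norm_eq_of_L2, PiLp.norm_sq_eq_of_L2]
  exact hlt.le

lemma graphLaplacian_sum_of_hasWeakDeriv {u : D.L2} {g k : Fin d → D.L2}
    (hu : WithLp.toLp 2 (u, WithLp.toLp 2 g) ∈ D.gradGraph)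
    (hk : ∀ j, D.HasWeakDeriv j (g j) (k j)) : GraphLaplacian D.gradGraph u (∑ j, k j) := by
  refine ⟨_, hu, fun p hp => ?_⟩
  refine gradGraph_induction (P := fun p : D.Pairs => inner ℂ (WithLp.toLp 2 g) p.snd
    = -inner ℂ (∑ j, k j) p.fst) (isClosed_eq (by fun_prop) (by fun_prop)) (fun ψ hψ => ?_) hp
  rw [← inner_conj_symm, ← inner_conj_symm (∑ j, k j), ← map_neg]
  congr 1
  rw [PiLp.inner_apply, inner_sum, ← Finset.sum_neg_distrib]
  exact Finset.sum_congr rfl fun j _ => hasWeakDeriv_iff.1 (hk j) ψ hψ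

lemma exists_graphLaplacian_of_h2Norm_le {u : D.L2} (hu : D.MemEnergy u) {M : ℝ}
    (h : D.h2Norm u ≤ ENNReal.ofReal M) :
    ∃ f, GraphLaplacian D.gradGraph u f ∧ ‖u‖ ≤ |M| + 1 ∧ ‖f‖ ≤ d * (|M| + 1) := by
  have hlt : D.h2Norm u < ENNReal.ofReal (|M| + 1) :=
    h.trans_lt ((ENNReal.ofReal_lt_ofReal_iff (by positivity)).2 (by linarith [le_abs_self M]))
  simp only [h2Norm, iInf_lt_iff] at hlt
  obtain ⟨g, k, hg, hk, hlt⟩ := hlt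
  rw [ENNReal.ofReal_lt_ofReal_iff (by positivity), Real.sqrt_lt' (by positivity)] at hlt
  have hgrad : 0 ≤ ∑ j, ‖g j‖ ^ 2 := Finset.sum_nonneg fun _ _ => sq_nonneg _
  have hrow (j : Fin d) : 0 ≤ ∑ i, ‖k j i‖ ^ 2 := Finset.sum_nonneg fun _ _ => sq_nonneg _
  have hhess : 0 ≤ ∑ j, ∑ i, ‖k j i‖ ^ 2 := Finset.sum_nonneg fun j _ => hrow j
  have hdiag (j : Fin d) : ‖k j j‖ ^ 2 ≤ ∑ j, ∑ i, ‖k j i‖ ^ 2 :=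
    (Finset.single_le_sum (f := fun i => ‖k j i‖ ^ 2) (fun _ _ => sq_nonneg _)
      (Finset.mem_univ j)).trans
    (Finset.single_le_sum (f := fun j => ∑ i, ‖k j i‖ ^ 2) (fun j _ => hrow j)
      (Finset.mem_univ j))
  have hlap (j : Fin d) : ‖k j j‖ ≤ |M| + 1 :=
    abs_le_of_sq_le_sq' (by linarith [hdiag j, sq_nonneg ‖u‖]) (by positivity) |>.2
  refine ⟨∑ j, k j j, graphLaplacian_sum_of_hasWeakDeriv (k := fun j => k j j)
    (toLp_mem_gradGraph_of_hasWeakDeriv hu hg) (fun j => hk j j),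
    (abs_le_of_sq_le_sq' (by linarith) (by positivity)).2, (norm_sum_le _ _).trans ?_⟩
  refine (Finset.sum_le_sum fun j _ => hlap j).trans_eq ?_
  rw [Finset.sum_const, Finset.card_univ, Fintype.card_fin, nsmul_eq_mul]

lemma exists_ae_norm_le_of_regNorm_le (hd : d = 1 ∨ d = 2 ∨ d = 3) (D : Setting d) :
    ∃ K : ℝ → ℝ, (∀ M, 0 < K M) ∧ ∀ (M : ℝ) (u : D.L2), D.MemEnergy u →
      D.regNorm u ≤ ENNReal.ofReal M → ∀ᵐ x ∂D.meas, ‖u x‖ ≤ K M := by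
  rcases hd with rfl | hd
  · obtain ⟨A, B, hA, hB, hAB⟩ := exists_ae_norm_le_one_dim D
    refine ⟨fun M => A + B * (|M| + 1) ^ 2 + 1, fun M => by positivity, fun M u hu hM => ?_⟩
    rw [regNorm, if_pos rfl] at hM
    obtain ⟨p, hp, rfl, hpM⟩ := exists_mem_gradGraph_of_h1Norm_le hu hM
    filter_upwards [hAB p hp] with x hx
    have : B * ‖p‖ ^ 2 ≤ B * (|M| + 1) ^ 2 := by gcongr
    linarith
  · obtain ⟨C, hC⟩ := exists_sobolev6 hd D
    obtain ⟨B, hB, hbound⟩ := ae_norm_le_of_graphLaplacian hC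
    refine ⟨fun M => 2 * (|M| + 1 + B * (|M| + 1 + d * (|M| + 1)) + 2), fun M => by positivity,
      fun M u hu hM => ?_⟩
    rw [regNorm, if_neg (by omega)] at hM
    obtain ⟨f, hf, huM, hfM⟩ := exists_graphLaplacian_of_h2Norm_le hu hM
    filter_upwards [hbound u f hf] with x hx
    refine hx.trans ?_
    gcongr
    exact (norm_sub_le _ _).trans (add_le_add huM hfM)

/-- The properties of the solution that enter the error analysis, for the equation with a Lipschitz
nonlinearity `F`: `K` bounds the solution pointwise, and `m` bounds it in `L²` and measures the
regularity along the Schrödinger group that comes from the energy space. -/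
structure IsRegularSolution (D : Setting d) (lam T K m : ℝ) {L : NNReal} {F : ℂ → ℂ}
    (hF : LipschitzWith L F) (h0 : F 0 = 0) (u : ℝ → D.L2) : Prop where
  continuousOn : ContinuousOn u (Icc 0 T)
  ae_norm_le : ∀ t ∈ Icc 0 T, ∀ᵐ x ∂D.meas, ‖u t x‖ ≤ K
  norm_le : ∀ t ∈ Icc 0 T, ‖u t‖ ≤ m
  group : ∀ t ∈ Icc 0 T, ∀ s, ‖graphGroup D.gradGraph s (u t) - u t‖ ≤ 3 * √|s| * m
  group_nonlin : ∀ t ∈ Icc 0 T, ∀ s, ‖graphGroup D.gradGraph s (lipComp hF h0 (u t))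
    - lipComp hF h0 (u t)‖ ≤ 3 * √|s| * (L * m)
  hasDerivAt : ∀ w f, GraphLaplacian D.gradGraph w f → ∀ t ∈ Ioo 0 T,
    HasDerivAt (fun s => inner ℂ w (u s)) (Complex.I * inner ℂ f (u t)
      + inner ℂ w ((-Complex.I * lam) • lipComp hF h0 (u t))) t

lemma norm_neg_I_mul_smul (lam : ℝ) (v : D.L2) : ‖(-Complex.I * lam) • v‖ = |lam| * ‖v‖ := by
  simp [norm_smul]

lemma norm_inner_testL2_laplacian_sub_le {w f : D.L2} {γ : PiLp 2 fun _ : Fin d => D.L2}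
    (hf : ∀ p ∈ D.gradGraph, inner ℂ γ p.snd = -inner ℂ f p.fst)
    {ψ : Space d → ℂ} (hψ : D.IsTest ψ) {p : D.Pairs} (hp : p ∈ D.gradGraph) :
    ‖inner ℂ (testL2 hψ.laplacian) p.fst - inner ℂ f p.fst‖
      ≤ ‖testPair hψ - WithLp.toLp 2 (w, γ)‖ * ‖p‖ := by
  have hfp : inner ℂ f p.fst = -inner ℂ γ p.snd := by rw [hf p hp, neg_neg]
  rw [inner_testL2_laplacian hψ hp, hfp, neg_sub_neg, ← inner_sub_left, ← norm_neg,
    ← inner_neg_left, neg_sub]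
  refine (norm_inner_le_norm _ _).trans ?_
  gcongr
  · exact WithLp.norm_snd_le _ (testPair hψ - WithLp.toLp 2 (w, γ))
  · exact WithLp.norm_snd_le _ p

lemma integral_regNonlin_eq {ε K : ℝ} {L : NNReal} {F : ℂ → ℂ} (hF : IsCutoffNonlin ε K L F)
    {u : D.L2} (hu : ∀ᵐ x ∂D.meas, ‖u x‖ ≤ K) {ψ : Space d → ℂ} (hψ : D.IsTest ψ) :
    ∫ x, regNonlin ε (u x) * starRingEnd ℂ (ψ x) ∂D.meas
      = inner ℂ (testL2 hψ) (lipComp hF.lipschitz hF.zero u) := by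
  rw [inner_testL2]
  refine integral_congr_ae ?_
  filter_upwards [hu, coeFn_lipComp hF.lipschitz hF.zero u] with x hx hcomp
  rw [hcomp, Function.comp_apply, hF.eq _ hx]

namespace IsSolution

variable {lam ε T K m : ℝ} {u₀ : D.L2} {u : ℝ → D.L2} {L : NNReal} {F : ℂ → ℂ}

lemma forall_of_gradGraph (h : D.IsSolution lam ε T u₀ u) (hT : 0 < T)
    (hm : ∀ᵐ t ∂(volume.restrict (Ioo 0 T)), ∃ p ∈ D.gradGraph, p.fst = u t ∧ ‖p‖ ≤ m)
    {P : D.L2 → Prop} (hP : IsClosed {v | P v})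
    (hG : ∀ p ∈ D.gradGraph, ‖p‖ ≤ m → P p.fst) : ∀ t ∈ Icc 0 T, P (u t) := by
  refine continuousOn_forall_of_ae hT h.continuousOn hP ?_
  filter_upwards [hm] with t ⟨p, hp, hpu, hpm⟩
  exact hpu ▸ hG p hp hpm

lemma hasDerivAt_testL2 (h : D.IsSolution lam ε T u₀ u) (hF : IsCutoffNonlin ε K L F)
    (hK : ∀ t ∈ Icc 0 T, ∀ᵐ x ∂D.meas, ‖u t x‖ ≤ K) {ψ : Space d → ℂ} (hψ : D.IsTest ψ)
    {t : ℝ} (ht : t ∈ Ioo 0 T) :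
    HasDerivAt (fun s => inner ℂ (testL2 hψ) (u s)) (Complex.I * inner ℂ (testL2 hψ.laplacian) (u t)
      + inner ℂ (testL2 hψ) ((-Complex.I * lam) • lipComp hF.lipschitz hF.zero (u t))) t := by
  have := h.equation _ hψ.conj t ht
  rw [laplacian_conj, ← inner_testL2 hψ.laplacian,
    integral_regNonlin_eq hF (hK t (Ioo_subset_Icc_self ht)) hψ] at this
  simp_rw [← inner_testL2 hψ] at this
  convert this using 1
  rw [inner_smul_right]
  ring

lemma hasDerivAt_graphLaplacian (h : D.IsSolution lam ε T u₀ u) (hF : IsCutoffNonlin ε K L F)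
    (hT : 0 < T) (hK : ∀ t ∈ Icc 0 T, ∀ᵐ x ∂D.meas, ‖u t x‖ ≤ K) (hN : ∀ t ∈ Icc 0 T, ‖u t‖ ≤ m)
    (hm : ∀ᵐ t ∂(volume.restrict (Ioo 0 T)), ∃ p ∈ D.gradGraph, p.fst = u t ∧ ‖p‖ ≤ m)
    {w f : D.L2} (hw : GraphLaplacian D.gradGraph w f) {t : ℝ} (ht : t ∈ Ioo 0 T) :
    HasDerivAt (fun s => inner ℂ w (u s)) (Complex.I * inner ℂ f (u t)
      + inner ℂ w ((-Complex.I * lam) • lipComp hF.lipschitz hF.zero (u t))) t := by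
  obtain ⟨γ, hγ, hf⟩ := hw
  obtain ⟨ψ, hψ, hlim⟩ := exists_testPair_tendsto hγ
  have hlim_fst : Tendsto (fun n => testL2 (hψ n)) atTop (𝓝 w) :=
    ((WithLp.continuous_fst 2 _ _).tendsto (WithLp.toLp 2 (w, γ))).comp hlim
  have hlim_norm : Tendsto (fun n => ‖testPair (hψ n) - WithLp.toLp 2 (w, γ)‖ * m) atTop (𝓝 0) := by
    simpa using (tendsto_iff_norm_sub_tendsto_zero.1 hlim).mul_const m
  have hlap (n : ℕ) : ∀ t ∈ Icc 0 T, ‖inner ℂ (testL2 (hψ n).laplacian) (u t) - inner ℂ f (u t)‖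
      ≤ ‖testPair (hψ n) - WithLp.toLp 2 (w, γ)‖ * m := by
    refine h.forall_of_gradGraph hT hm (P := fun v =>
      ‖inner ℂ (testL2 (hψ n).laplacian) v - inner ℂ f v‖
        ≤ ‖testPair (hψ n) - WithLp.toLp 2 (w, γ)‖ * m) (isClosed_le (by fun_prop) (by fun_prop))
      fun p hp hpm => (norm_inner_testL2_laplacian_sub_le hf (hψ n) hp).trans (by gcongr)
  have hnonlin : ∀ t ∈ Ioo 0 T,
      ‖(-Complex.I * lam) • lipComp hF.lipschitz hF.zero (u t)‖ ≤ |lam| * (L * m) := by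
    intro t ht
    rw [norm_neg_I_mul_smul]
    gcongr
    exact (norm_lipComp_le _ _ _).trans (by gcongr; exact hN t (Ioo_subset_Icc_self ht))
  refine hasDerivAt_inner_of_tendsto isOpen_Ioo (g' := fun t => Complex.I * inner ℂ f (u t))
    hlim_fst hnonlin (tendstoUniformlyOn_of_norm_sub_le hlim_norm fun n t ht => ?_)
    (fun n t ht => h.hasDerivAt_testL2 hF hK (hψ n) ht) ht
  rw [← mul_sub, norm_mul, Complex.norm_I, one_mul]
  exact hlap n t (Ioo_subset_Icc_self ht)

lemma isRegularSolution (h : D.IsSolution lam ε T u₀ u) (hF : IsCutoffNonlin ε K L F)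
    (hT : 0 < T) (hK : ∀ᵐ t ∂(volume.restrict (Ioo 0 T)), ∀ᵐ x ∂D.meas, ‖u t x‖ ≤ K)
    (hm : ∀ᵐ t ∂(volume.restrict (Ioo 0 T)), ∃ p ∈ D.gradGraph, p.fst = u t ∧ ‖p‖ ≤ m) :
    D.IsRegularSolution lam T K m hF.lipschitz hF.zero u := by
  have hK' := continuousOn_forall_of_ae hT h.continuousOn (isClosed_ae_norm_le K) hK
  have hN : ∀ t ∈ Icc 0 T, ‖u t‖ ≤ m :=
    h.forall_of_gradGraph hT hm (P := fun v => ‖v‖ ≤ m)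
      (isClosed_le continuous_norm continuous_const)
      fun p _ hpm => (WithLp.norm_fst_le _ p).trans hpm
  refine ⟨h.continuousOn, hK', hN, fun t ht s => ?_, fun t ht s => ?_, fun w f hw t ht =>
    h.hasDerivAt_graphLaplacian hF hT hK' hN hm hw ht⟩
  · refine h.forall_of_gradGraph hT hm (P := fun v =>
      ‖graphGroup D.gradGraph s v - v‖ ≤ 3 * √|s| * m)
      (isClosed_le (by fun_prop) (by fun_prop)) (fun p hp hpm => ?_) t ht
    refine (norm_graphGroup_sub_le isResolvent_gradGraph isClosed_gradGraph
      (u := p.fst) (g := p.snd) hp s).trans ?_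
    gcongr
    exact (WithLp.norm_snd_le _ p).trans hpm
  · have hcont : Continuous (lipComp (D := D) hF.lipschitz hF.zero) := continuous_lipComp _ _
    refine h.forall_of_gradGraph hT hm (P := fun v =>
      ‖graphGroup D.gradGraph s (lipComp hF.lipschitz hF.zero v)
        - lipComp hF.lipschitz hF.zero v‖ ≤ 3 * √|s| * (L * m))
      (isClosed_le (by fun_prop) (by fun_prop)) (fun p hp hpm => ?_) t ht
    refine (norm_graphGroup_lipComp_sub_le hF.lipschitz hF.zero hF.isSmoothLipschitzLimit s
      hp).trans ?_
    gcongr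
    exact (WithLp.norm_snd_le _ p).trans hpm

end IsSolution

end Setting

/-! ### Error analysis of the splitting -/

lemma le_mul_pow_mul_of_le {e : ℕ → ℝ} {a δ : ℝ} (ha : 0 ≤ a) (hδ : 0 ≤ δ) {N : ℕ} (h0 : e 0 = 0)
    (h : ∀ n < N, e (n + 1) ≤ (1 + a) * e n + δ) : ∀ n ≤ N, e n ≤ n * (1 + a) ^ n * δ := by
  intro n
  induction n with
  | zero => simp [h0]
  | succ n ih =>
    intro hn
    have hpow : 1 ≤ (1 + a) ^ (n + 1) := one_le_pow₀ (by linarith)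
    calc e (n + 1) ≤ (1 + a) * (n * (1 + a) ^ n * δ) + 1 * δ := by
          rw [one_mul]
          exact (h n (by omega)).trans (by gcongr; exact ih (by omega))
      _ ≤ (1 + a) * (n * (1 + a) ^ n * δ) + (1 + a) ^ (n + 1) * δ := by gcongr
      _ = ((n + 1 : ℕ) : ℝ) * (1 + a) ^ (n + 1) * δ := by push_cast; ring

lemma one_add_pow_le_exp {a b : ℝ} (ha : 0 ≤ a) {n : ℕ} (h : n * a ≤ b) :
    (1 + a) ^ n ≤ Real.exp b := by
  calc (1 + a) ^ n ≤ Real.exp a ^ n := by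
        gcongr
        rw [add_comm]
        exact Real.add_one_le_exp a
    _ = Real.exp (n * a) := (Real.exp_nat_mul a n).symm
    _ ≤ Real.exp b := Real.exp_le_exp.2 h

/-- The constant in the local error of the splitting, when `C * Real.log ε⁻¹` is a Lipschitz
constant of the nonlinearity: the first summand bounds the variation of the solution over one time
step, the second one the Taylor remainder of the nonlinear flow. -/
def localErrorConst (lam C : ℝ) : ℝ := |lam| * C * (|lam| * C + 6) + 8 * lam ^ 2

lemma localErrorConst_nonneg (lam : ℝ) {C : ℝ} (hC : 0 ≤ C) : 0 ≤ localErrorConst lam C := by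
  rw [localErrorConst]; positivity

/-- The two summands on the left are bounded by the common scale `ℓ * √τ * τ`, because
`ℓ * τ ≤ √τ`. -/
lemma local_error_add_le {lam C m ℓ τ : ℝ} (hC : 0 ≤ C) (hm : 0 ≤ m) (hℓ : 0 ≤ ℓ) (hτ : 0 ≤ τ)
    (h : ℓ * √τ ≤ 1) :
    8 * (τ * lam * ℓ) ^ 2 * m + |lam| * (C * ℓ) * (|lam| * (C * ℓ * m) * τ + 6 * √τ * m) * τ
      ≤ localErrorConst lam C * m * ℓ * √τ * τ := by
  have hscale : ℓ * τ ≤ √τ := by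
    calc ℓ * τ = ℓ * √τ * √τ := by rw [mul_assoc, Real.mul_self_sqrt hτ]
      _ ≤ √τ := mul_le_of_le_one_left (Real.sqrt_nonneg τ) h
  calc _ = (8 * lam ^ 2 * (ℓ * τ) + |lam| * C * (|lam| * C * (ℓ * τ) + 6 * √τ)) * m * ℓ * τ := by
        ring
    _ ≤ (8 * lam ^ 2 * √τ + |lam| * C * (|lam| * C * √τ + 6 * √τ)) * m * ℓ * τ := by gcongr
    _ = localErrorConst lam C * m * ℓ * √τ * τ := by rw [localErrorConst]; ring

namespace Setting

variable {d : ℕ} {D : Setting d} {lam ε T K m t τ : ℝ}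

lemma norm_flowA_sub (τ : ℝ) (v w : D.L2) : ‖D.flowA τ v - D.flowA τ w‖ = ‖v - w‖ := by
  rw [flowA_eq, flowA_eq, ← map_sub, norm_graphGroup isResolvent_gradGraph]

lemma norm_flowA_sub_eq (τ : ℝ) (v w : D.L2) :
    ‖D.flowA τ v - w‖ = ‖v - graphGroup D.gradGraph (-τ) w‖ := by
  rw [← norm_flowA_sub τ v, flowA_eq τ (graphGroup _ _ w), ← graphGroup_add isResolvent_gradGraph,
    add_neg_cancel, graphGroup_zero isResolvent_gradGraph]

lemma norm_flowB_sub_sub_le {L : NNReal} {F : ℂ → ℂ} (hε : 0 < ε) (hF : IsCutoffNonlin ε K L F)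
    (hK : ε + K ≤ ε⁻¹) (lam t : ℝ) {z : D.L2} (hz : ∀ᵐ x ∂D.meas, ‖z x‖ ≤ K) :
    ‖D.flowB lam ε t z - z - (t : ℂ) • ((-Complex.I * lam) • lipComp hF.lipschitz hF.zero z)‖
      ≤ 8 * (t * lam * Real.log ε⁻¹) ^ 2 * ‖z‖ := by
  refine Lp.norm_le_mul_norm_of_ae_le_mul ?_
  filter_upwards [hz, coeFn_flowB lam ε t z, coeFn_lipComp hF.lipschitz hF.zero z,
    Lp.coeFn_sub (D.flowB lam ε t z) z,
    Lp.coeFn_sub (D.flowB lam ε t z - z)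
      ((t : ℂ) • ((-Complex.I * lam) • lipComp hF.lipschitz hF.zero z)),
    Lp.coeFn_smul (t : ℂ) ((-Complex.I * lam : ℂ) • lipComp hF.lipschitz hF.zero z),
    Lp.coeFn_smul (-Complex.I * lam : ℂ) (lipComp hF.lipschitz hF.zero z)]
    with x hx hflow hcomp hsub hsub' hsmul hsmul'
  rw [hsub', Pi.sub_apply, hsub, Pi.sub_apply, hsmul, Pi.smul_apply, hsmul', Pi.smul_apply, hflow,
    hcomp, Function.comp_apply, hF.eq _ hx, smul_eq_mul, smul_eq_mul]
  exact norm_nonlinFlow_sub_sub_le hε hK lam t hx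

namespace IsRegularSolution

section Lipschitz

variable {L : NNReal} {F : ℂ → ℂ} {hF : LipschitzWith L F} {h0 : F 0 = 0} {u : ℝ → D.L2}

lemma nonneg (h : D.IsRegularSolution lam T K m hF h0 u) (hT : 0 ≤ T) : 0 ≤ m :=
  (norm_nonneg _).trans (h.norm_le 0 ⟨le_rfl, hT⟩)

lemma norm_graphGroup_neg_sub_smul_le (h : D.IsRegularSolution lam T K m hF h0 u) {B : ℝ} {c : D.L2}
    (ht : 0 ≤ t) (hτ : 0 ≤ τ) (htτ : t + τ ≤ T)
    (hB : ∀ r ∈ Ioo 0 τ, ‖graphGroup D.gradGraph (-r) ((-Complex.I * lam) •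
      lipComp hF h0 (u (t + r))) - c‖ ≤ B) :
    ‖graphGroup D.gradGraph (-τ) (u (t + τ)) - u t - (τ : ℂ) • c‖ ≤ B * τ := by
  have := norm_graphGroup_sub_sub_smul_le (G := D.gradGraph) isResolvent_gradGraph (v := u)
    (N := fun r => (-Complex.I * lam) • lipComp hF h0 (u r)) (a := t) (b := t + τ) (c := c)
    (by linarith) (h.continuousOn.mono (Icc_subset_Icc ht htτ))
    (fun w f hw r hr => h.hasDerivAt w f hw r ⟨ht.trans_lt hr.1, hr.2.trans_le htτ⟩)
    (fun r hr => by simpa using hB (r - t) ⟨by linarith [hr.1], by linarith [hr.2]⟩)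
  rwa [sub_add_cancel_left, add_sub_cancel_left] at this

lemma norm_graphGroup_neg_sub_le (h : D.IsRegularSolution lam T K m hF h0 u)
    (ht : 0 ≤ t) (hτ : 0 ≤ τ) (htτ : t + τ ≤ T) :
    ‖graphGroup D.gradGraph (-τ) (u (t + τ)) - u t‖ ≤ |lam| * (L * m) * τ := by
  have := h.norm_graphGroup_neg_sub_smul_le (c := 0) (B := |lam| * (L * m)) ht hτ htτ
    fun r hr => by
      rw [sub_zero, norm_graphGroup isResolvent_gradGraph, norm_neg_I_mul_smul]
      gcongr
      refine (norm_lipComp_le _ _ _).trans ?_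
      gcongr
      exact h.norm_le _ ⟨by linarith [hr.1], by linarith [hr.2]⟩
  simpa using this

lemma norm_sub_le (h : D.IsRegularSolution lam T K m hF h0 u)
    (ht : 0 ≤ t) (hτ : 0 ≤ τ) (htτ : t + τ ≤ T) :
    ‖u (t + τ) - u t‖ ≤ |lam| * (L * m) * τ + 3 * √τ * m := by
  have hgroup := h.group (t + τ) ⟨by linarith, htτ⟩ (-τ)
  rw [abs_neg, abs_of_nonneg hτ, norm_sub_rev] at hgroup
  have hmid := norm_sub_le_norm_sub_add_norm_sub (u (t + τ))
    (graphGroup D.gradGraph (-τ) (u (t + τ))) (u t)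
  have hneg := h.norm_graphGroup_neg_sub_le ht hτ htτ
  linarith

lemma norm_graphGroup_neg_nonlin_sub_le (h : D.IsRegularSolution lam T K m hF h0 u)
    (ht : 0 ≤ t) (hτ : 0 ≤ τ) (htτ : t + τ ≤ T) :
    ‖graphGroup D.gradGraph (-τ) (lipComp hF h0 (u (t + τ))) - lipComp hF h0 (u t)‖
      ≤ L * (|lam| * (L * m) * τ + 6 * √τ * m) := by
  have hgroup := h.group_nonlin (t + τ) ⟨by linarith, htτ⟩ (-τ)
  rw [abs_neg, abs_of_nonneg hτ] at hgroup
  calc _ ≤ 3 * √τ * (L * m) + L * (|lam| * (L * m) * τ + 3 * √τ * m) :=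
        (norm_sub_le_norm_sub_add_norm_sub _ (lipComp hF h0 (u (t + τ))) _).trans <|
          add_le_add hgroup <| (norm_lipComp_sub_le hF h0 _ _).trans <| by
            gcongr
            exact h.norm_sub_le ht hτ htτ
    _ = _ := by ring

lemma norm_graphGroup_neg_sub_sub_le (h : D.IsRegularSolution lam T K m hF h0 u)
    (ht : 0 ≤ t) (hτ : 0 ≤ τ) (htτ : t + τ ≤ T) :
    ‖graphGroup D.gradGraph (-τ) (u (t + τ)) - u t
        - (τ : ℂ) • ((-Complex.I * lam) • lipComp hF h0 (u t))‖
      ≤ |lam| * L * (|lam| * (L * m) * τ + 6 * √τ * m) * τ := by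
  refine h.norm_graphGroup_neg_sub_smul_le ht hτ htτ fun r hr => ?_
  have hm : 0 ≤ m := h.nonneg (by linarith)
  rw [map_smul, ← smul_sub, norm_neg_I_mul_smul, mul_assoc]
  gcongr
  refine (h.norm_graphGroup_neg_nonlin_sub_le ht hr.1.le (by linarith [hr.2])).trans ?_
  gcongr <;> exact hr.2.le

end Lipschitz

variable {C : NNReal} {F : ℂ → ℂ} {u : ℝ → D.L2}

lemma norm_flowA_flowB_sub_le (hε : 0 < ε) (hL : 1 ≤ Real.log ε⁻¹)
    (hF : IsCutoffNonlin ε K (C * (Real.log ε⁻¹).toNNReal) F) (hK : ε + K ≤ ε⁻¹)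
    (h : D.IsRegularSolution lam T K m hF.lipschitz hF.zero u)
    (ht : 0 ≤ t) (hτ : 0 ≤ τ) (htτ : t + τ ≤ T) (hs : Real.log ε⁻¹ * √τ ≤ 1) :
    ‖D.flowA τ (D.flowB lam ε τ (u t)) - u (t + τ)‖
      ≤ localErrorConst lam C * m * Real.log ε⁻¹ * √τ * τ := by
  have htT : t ∈ Icc 0 T := ⟨ht, by linarith⟩
  have hexact := h.norm_graphGroup_neg_sub_sub_le ht hτ htτ
  rw [NNReal.coe_mul, Real.coe_toNNReal _ (by linarith)] at hexact
  have hsplit : ‖D.flowB lam ε τ (u t) - u t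
      - (τ : ℂ) • ((-Complex.I * lam) • lipComp hF.lipschitz hF.zero (u t))‖
        ≤ 8 * (τ * lam * Real.log ε⁻¹) ^ 2 * m :=
    (norm_flowB_sub_sub_le hε hF hK lam τ (h.ae_norm_le t htT)).trans
      (by gcongr; exact h.norm_le t htT)
  rw [norm_flowA_sub_eq, ← sub_sub_sub_cancel_right _ _ (u t), ← sub_sub_sub_cancel_right _ _
    ((τ : ℂ) • ((-Complex.I * lam) • lipComp hF.lipschitz hF.zero (u t)))]
  exact ((_root_.norm_sub_le _ _).trans (add_le_add hsplit hexact)).trans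
    (local_error_add_le C.2 (h.nonneg (by linarith)) (by linarith) hτ hs)

lemma norm_lieTrotter_succ_sub_le (hε : 0 < ε) (hL : 1 ≤ Real.log ε⁻¹)
    (hF : IsCutoffNonlin ε K (C * (Real.log ε⁻¹).toNNReal) F) (hK : ε + K ≤ ε⁻¹)
    (h : D.IsRegularSolution lam T K m hF.lipschitz hF.zero u) (u₀ : D.L2) {n : ℕ}
    (hτ : 0 ≤ τ) (hn : (n + 1 : ℕ) * τ ≤ T) (hs : Real.log ε⁻¹ * √τ ≤ 1) :
    ‖D.lieTrotter lam ε τ u₀ (n + 1) - u ((n + 1 : ℕ) * τ)‖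
      ≤ (1 + 2 * |τ * lam|) * ‖D.lieTrotter lam ε τ u₀ n - u (n * τ)‖
        + localErrorConst lam C * m * Real.log ε⁻¹ * √τ * τ := by
  have htime : ((n + 1 : ℕ) : ℝ) * τ = n * τ + τ := by push_cast; ring
  rw [htime] at hn ⊢
  rw [lieTrotter]
  refine (norm_sub_le_norm_sub_add_norm_sub _ (D.flowA τ (D.flowB lam ε τ (u (n * τ)))) _).trans
    (add_le_add ?_ (h.norm_flowA_flowB_sub_le hε hL hF hK (by positivity) hτ hn hs))
  rw [norm_flowA_sub]
  exact norm_flowB_sub_le hε lam τ _ _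

lemma norm_lieTrotter_sub_le (hε : 0 < ε) (hL : 1 ≤ Real.log ε⁻¹)
    (hF : IsCutoffNonlin ε K (C * (Real.log ε⁻¹).toNNReal) F) (hK : ε + K ≤ ε⁻¹)
    (h : D.IsRegularSolution lam T K m hF.lipschitz hF.zero u) (hT : 0 ≤ T) {n : ℕ}
    (hτ : 0 ≤ τ) (hn : n * τ ≤ T) (hs : Real.log ε⁻¹ * √τ ≤ 1) :
    ‖D.lieTrotter lam ε τ (u 0) n - u (n * τ)‖
      ≤ T * Real.exp (2 * |lam| * T) * localErrorConst lam C * m * Real.log ε⁻¹ * √τ := by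
  have hm : 0 ≤ m := h.nonneg hT
  have hC : 0 ≤ localErrorConst lam C := localErrorConst_nonneg lam C.2
  have hgronwall := le_mul_pow_mul_of_le (a := 2 * |τ * lam|) (N := n)
    (δ := localErrorConst lam C * m * Real.log ε⁻¹ * √τ * τ)
    (e := fun k => ‖D.lieTrotter lam ε τ (u 0) k - u (k * τ)‖) (by positivity) (by positivity)
    (by simp [lieTrotter]) (fun k hk => h.norm_lieTrotter_succ_sub_le hε hL hF hK (u 0) hτ
      (hn.trans' (by gcongr; exact hk)) hs) n le_rfl
  have hexp : (1 + 2 * |τ * lam|) ^ n ≤ Real.exp (2 * |lam| * T) := by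
    refine one_add_pow_le_exp (by positivity) ?_
    calc n * (2 * |τ * lam|) = 2 * |lam| * (n * τ) := by rw [abs_mul, abs_of_nonneg hτ]; ring
      _ ≤ 2 * |lam| * T := by gcongr
  calc _ ≤ _ := hgronwall
    _ = (n * τ) * (1 + 2 * |τ * lam|) ^ n * localErrorConst lam C * m * Real.log ε⁻¹ * √τ := by
      ring
    _ ≤ _ := by gcongr

end IsRegularSolution

lemma exists_norm_lieTrotter_sub_le (D : Setting d) (lam : ℝ) : ∃ C : ℝ → ℝ → ℝ,
    ∀ T ε K m : ℝ, 0 < T → 0 < ε → 1 ≤ Real.log ε⁻¹ → 0 < K → ε + 2 * K + 1 ≤ ε⁻¹ →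
      ∀ (u₀ : D.L2) (u : ℝ → D.L2), D.IsSolution lam ε T u₀ u →
      (∀ᵐ t ∂(volume.restrict (Ioo 0 T)), ∀ᵐ x ∂D.meas, ‖u t x‖ ≤ K) →
      (∀ᵐ t ∂(volume.restrict (Ioo 0 T)), ∃ p ∈ D.gradGraph, p.fst = u t ∧ ‖p‖ ≤ m) →
      ∀ (τ : ℝ) (n : ℕ), 0 < τ → n * τ ≤ T →
        ‖D.lieTrotter lam ε τ u₀ n - u (n * τ)‖ ≤ C T m * Real.log ε⁻¹ * √τ := by
  obtain ⟨C, hC⟩ := exists_isCutoffNonlin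
  refine ⟨fun T m => 2 * m + T * Real.exp (2 * |lam| * T) * localErrorConst lam C * m,
    fun T ε K m hT hε hL hK hεK u₀ u hu hb hm τ n hτ hn => ?_⟩
  obtain ⟨F, hF⟩ := hC ε K hε hL hK hεK
  have h := hu.isRegularSolution hF hT hb hm
  have hm0 : 0 ≤ m := h.nonneg hT.le
  have hconst : 0 ≤ localErrorConst lam C := localErrorConst_nonneg lam C.2
  rw [add_mul, add_mul]
  rcases le_total (Real.log ε⁻¹ * √τ) 1 with hs | hs
  · rw [← hu.initial]
    exact (h.norm_lieTrotter_sub_le hε hL hF (by linarith) hT.le hτ.le hn hs).trans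
      (le_add_of_nonneg_left (by positivity))
  · refine le_trans ?_ (le_add_of_nonneg_right (by positivity))
    calc _ ≤ ‖D.lieTrotter lam ε τ u₀ n‖ + ‖u (n * τ)‖ := norm_sub_le _ _
      _ ≤ m + m := by
        rw [norm_lieTrotter, ← hu.initial]
        exact add_le_add (h.norm_le 0 ⟨le_rfl, hT.le⟩) (h.norm_le _ ⟨by positivity, hn⟩)
      _ = 2 * m * 1 := by ring
      _ ≤ 2 * m * (Real.log ε⁻¹ * √τ) := by gcongr
      _ = _ := by ring

end Setting

end

/-- The `L²` error bound `C(T, ‖u‖_{L^∞(0,T;H¹)}) ln(1/ε) τ^{1/2}` of the Lie–Trotter splitting for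
the regularized logarithmic Schrödinger equation. The threshold `ε₀` depends only on a bound `M` of
the solution in `L^∞(0,T;H¹)` if `d = 1`, in `L^∞(0,T;H²)` if `d = 2, 3`; the constant `C` depends
only on `T` and on a bound `m` of the solution in `L^∞(0,T;H¹)`. -/
theorem theorem2p1 (d : ℕ) (hd : d = 1 ∨ d = 2 ∨ d = 3) (D : Setting d)
    (lam : ℝ) (hlam : lam ≠ 0) :
    ∃ (ε₀ : ℝ → ℝ) (C : ℝ → ℝ → ℝ), (∀ M, 0 < ε₀ M) ∧
      ∀ T : ℝ, 0 < T → ∀ M m ε : ℝ, 0 < ε → ε ≤ ε₀ M →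
      ∀ (u₀ : D.L2) (u : ℝ → D.L2), D.IsSolution lam ε T u₀ u →
        D.linftyNorm T D.regNorm u ≤ ENNReal.ofReal M →
        D.linftyNorm T D.h1Norm u ≤ ENNReal.ofReal m →
        ∀ (τ : ℝ) (n : ℕ), 0 < τ → n * τ ≤ T →
          ‖D.lieTrotter lam ε τ u₀ n - u (n * τ)‖
            ≤ C T m * Real.log ε⁻¹ * τ ^ (1 / 2 : ℝ) := by
  obtain ⟨K, hK, hKu⟩ := Setting.exists_ae_norm_le_of_regNorm_le hd D
  obtain ⟨C, hC⟩ := Setting.exists_norm_lieTrotter_sub_le D lam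
  refine ⟨fun M => min (Real.exp (-1)) (2 * K M + 2)⁻¹, fun T m => C T (|m| + 1), fun M => ?_,
    fun T hT M m ε hε hεM u₀ u hu hM hm τ n hτ hn => ?_⟩
  · have := hK M
    positivity
  have hKM := hK M
  have hL : 1 ≤ Real.log ε⁻¹ := by
    rw [Real.log_inv, le_neg, Real.log_le_iff_le_exp hε]
    exact hεM.trans (min_le_left _ _)
  have hε1 : ε ≤ 1 := hεM.trans ((min_le_left _ _).trans (Real.exp_le_one_iff.2 (by norm_num)))
  have hεK : ε + 2 * K M + 1 ≤ ε⁻¹ := by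
    have := (le_inv_comm₀ hε (by positivity)).1 (hεM.trans (min_le_right _ _))
    linarith
  rw [← Real.sqrt_eq_rpow]
  refine hC T ε (K M) (|m| + 1) hT hε hL hKM hεK u₀ u hu ?_ ?_ τ n hτ hn
  · filter_upwards [hu.boundary, ENNReal.ae_le_essSup fun t => D.regNorm (u t)] with t h1 h2
    exact hKu M _ h1 (h2.trans hM)
  · filter_upwards [hu.boundary, ENNReal.ae_le_essSup fun t => D.h1Norm (u t)] with t h1 h2
    exact Setting.exists_mem_gradGraph_of_h1Norm_le h1 (h2.trans hm)
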